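/- Let $f(\alpha,\beta)=(\alpha+\beta)\bmod 2$ on $\{0,1\}^2$. For $p\in[0,1]$ consider the probabilistic cellular automaton (PCA) on $\{0,1\}^{\mathbb Z}$, i.e. the Markov chain $(X_t)_{t\in\mathbb N}$ such that, given $X_t$, the states $(X_{t+1}(x))_{x\in\mathbb Z}$ are independent and $X_{t+1}(x)$ equals $f(X_t(x-1),X_t(x+1))$ with probability $p$ and $1-f(X_t(x-1),X_t(x+1))$ with probability $1-p$. A basic i.i.d. coupling of this PCA is an i.i.d. family $(F_{x,t})_{x\in\mathbb Z,\,t\in\mathbb N}$ of random functions $\{0,1\}^3\to\{0,1\}$, on some probability space, such that for all $(a,b,c)\in\{0,1\}^3$ $$F_{x,t}(a,b,c)\sim p\,\delta_{f(a,c)}+(1-p)\,\delta_{1-f(a,c)}$$ (the joint law of the eight values of $F_{x,t}$ is otherwise arbitrary). For $\xi\in\{0,1\}^{\mathbb Z}$ let $X_0^\xi=\xi$ and $X_{t+1}^\xi(x)=F_{x,t}\big(X_t^\xi(x-1),X_t^\xi(x),X_t^\xi(x+1)\big)$. Theorem. (i) There is $p_0<1$ such that for every $p\in(p_0,1]\cap[0,1]$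 every basic i.i.d. coupling satisfies $$\limsup_{t\to+\infty}\mathbb P\big(\exists\,\xi_1,\xi_2\in\{0,1\}^{\mathbb Z}\text{ such that }X_t^{\xi_1}(0)\neq X_t^{\xi_2}(0)\big)>0.$$ (ii) In particular, for the same $p$ and every basic i.i.d. coupling, coupling from the past (CFTP) fails at every cell: if $F_t[\eta](x)=F_{x,t}(\eta(x-1),\eta(x),\eta(x+1))$ then, for every $x\in\mathbb Z$, it is not true that almost surely there is $T\in\mathbb N$ such that $\big(F_0\circ F_1\circ\cdots\circ F_{T-1}\big)[\xi](x)$ is the same for all $\xi\in\{0,1\}^{\mathbb Z}$. (iii) This happens even though, for every $p\in(0,1)$, the PCA is ergodic: it has an invariant probability measure to which the law of $X_t$ converges weakly as $t\to+\infty$, for every initial law. -/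

import Mathlib

open MeasureTheory ProbabilityTheory Filter Topology

/-- Configurations: one state in `{0,1}` (`false` is `0`, `true` is `1`) per cell of `ℤ`. -/
abbrev Config : Type := ℤ → Bool

/-- Addition modulo `2` of two states. -/
def addMod2 (a c : Bool) : Bool := xor a c

noncomputable section

/-- The law `p · δ_{f(a,c)} + (1 - p) · δ_{1 - f(a,c)}` of the new state of a cell whose left and
right neighbours have states `a` and `c`, where `f` is addition modulo `2`. -/
def localLaw (p : unitInterval) (a c : Bool) : Measure Bool :=
  ENNReal.ofReal (p : ℝ) • Measure.dirac (addMod2 a c) +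
    ENNReal.ofReal (1 - (p : ℝ)) • Measure.dirac (!(addMod2 a c))

instance localLaw.instIsProbabilityMeasure (p : unitInterval) (a c : Bool) :
    IsProbabilityMeasure (localLaw p a c) := by
  refine ⟨?_⟩
  simp only [localLaw, Measure.add_apply, Measure.smul_apply, measure_univ, smul_eq_mul, mul_one]
  rw [← ENNReal.ofReal_add p.2.1 (by linarith [p.2.2])]
  simp

/-- The law of the next configuration given that the present one is `η`: the new states are
independent, the one at `x` with law `localLaw p (η (x - 1)) (η (x + 1))`. -/
def stepLaw (p : unitInterval) (η : Config) : Measure Config :=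
  Measure.infinitePi fun x : ℤ => localLaw p (η (x - 1)) (η (x + 1))

instance stepLaw.instIsProbabilityMeasure (p : unitInterval) (η : Config) :
    IsProbabilityMeasure (stepLaw p η) := by
  unfold stepLaw; infer_instance

theorem measurable_localLaw (p : unitInterval) (u : Set Bool) :
    Measurable fun q : Bool × Bool => localLaw p q.1 q.2 u :=
  measurable_of_finite _

theorem measurable_neighbours (f : Bool × Bool → ENNReal) (hf : Measurable f) (x : ℤ) :
    Measurable fun η : Config => f (η (x - 1), η (x + 1)) :=
  hf.comp ((measurable_pi_apply (x - 1)).prodMk (measurable_pi_apply (x + 1)))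

theorem stepLaw_pi (p : unitInterval) (s : Finset ℤ) (t : ℤ → Set Bool) (η : Config) :
    stepLaw p η ((s : Set ℤ).pi t) = ∏ x ∈ s, localLaw p (η (x - 1)) (η (x + 1)) (t x) := by
  unfold stepLaw
  rw [Measure.infinitePi_pi _ fun x _ => (Set.toFinite (t x)).measurableSet]

theorem measurable_stepLaw_pi (p : unitInterval) (s : Finset ℤ) (t : ℤ → Set Bool) :
    Measurable fun η : Config => stepLaw p η ((s : Set ℤ).pi t) := by
  simp only [stepLaw_pi]
  exact Finset.measurable_prod _ fun x _ =>
    measurable_neighbours _ (measurable_localLaw p (t x)) x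

theorem measurable_stepLaw (p : unitInterval) : Measurable (stepLaw p) := by
  have hpi : IsPiSystem (squareCylinders fun _ : ℤ => {s : Set Bool | MeasurableSet s}) :=
    isPiSystem_squareCylinders (fun _ => MeasurableSpace.isPiSystem_measurableSet)
      (fun _ => MeasurableSet.univ (α := Bool))
  refine Measurable.measure_of_isPiSystem_of_isProbabilityMeasure
    (generateFrom_squareCylinders (α := fun _ : ℤ => Bool)).symm hpi fun S hS => ?_
  obtain ⟨s, t, -, rfl⟩ := hS
  exact measurable_stepLaw_pi p s t

/-- The transition kernel of the PCA on `{0,1}^ℤ`. -/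
def pcaKernel (p : unitInterval) : Kernel Config Config := ⟨stepLaw p, measurable_stepLaw p⟩

instance pcaKernel.instIsMarkovKernel (p : unitInterval) : IsMarkovKernel (pcaKernel p) :=
  ⟨fun η => stepLaw.instIsProbabilityMeasure p η⟩

/-- The law at time `t` of the Markov chain with transition kernel `κ` and initial law `μ₀`. -/
def lawAt (κ : Kernel Config Config) [IsMarkovKernel κ] (μ₀ : ProbabilityMeasure Config) :
    ℕ → ProbabilityMeasure Config
  | 0 => μ₀
  | t + 1 => ⟨κ ∘ₘ (lawAt κ μ₀ t : Measure Config), inferInstance⟩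

/-- Ergodicity: there is an invariant probability measure to which the law at time `t` converges
weakly as `t → ∞`, whatever the initial law. -/
def IsErgodicPCA (κ : Kernel Config Config) [IsMarkovKernel κ] : Prop :=
  ∃ ν : ProbabilityMeasure Config, Kernel.Invariant κ (ν : Measure Config) ∧
    ∀ μ₀ : ProbabilityMeasure Config, Tendsto (lawAt κ μ₀) atTop (𝓝 ν)

end

/-- A map `{0,1}^3 → {0,1}`, giving the new state of a cell from the present states of its left
neighbour, of itself and of its right neighbour. -/
abbrev UpdateFn : Type := Bool → Bool → Bool → Bool

/-- `F` is a basic i.i.d. coupling of the PCA with parameter `p`, on the probability space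
`(Ω, μ)`: the random functions `F x t`, for `x ∈ ℤ` and `t ∈ ℕ`, are i.i.d., and for each
`(a, b, c)` the random state `F x t (a, b, c)` has law `p · δ_{f(a,c)} + (1 - p) · δ_{1 - f(a,c)}`.
Nothing is assumed on the joint law of the values of `F x t` at distinct triples. -/
structure IsBasicIIDCoupling (p : unitInterval) {Ω : Type*} [MeasurableSpace Ω] (μ : Measure Ω)
    (F : ℤ → ℕ → Ω → UpdateFn) : Prop where
  measurable : ∀ x t, Measurable (F x t)
  iIndepFun : iIndepFun (fun i : ℤ × ℕ => F i.1 i.2) μ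
  identDistrib : ∀ x t, IdentDistrib (F x t) (F 0 0) μ μ
  law : ∀ x t a b c, μ.map (fun ω => F x t ω a b c) = localLaw p a c

/-- Simultaneous update of all cells, cell `x` being updated with `g x`. -/
def globalUpdate (g : ℤ → UpdateFn) (η : Config) : Config :=
  fun x => g x (η (x - 1)) (η x) (η (x + 1))

/-- `forwardState F ω ξ t` is `X_t^ξ`: the configuration at time `t` started from `ξ` at time `0`,
with `X_{t+1}(x) = F_{x,t}(X_t(x-1), X_t(x), X_t(x+1))`. -/
def forwardState {Ω : Type*} (F : ℤ → ℕ → Ω → UpdateFn) (ω : Ω) (ξ : Config) : ℕ → Config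
  | 0 => ξ
  | t + 1 => globalUpdate (fun x => F x t ω) (forwardState F ω ξ t)

/-- Coupling from the past: `pastState F ω T ξ` is the configuration at time `0` started from `ξ`
at time `-T`, where the step from time `-(s+1)` to time `-s` uses the functions `F x s`. -/
def pastState {Ω : Type*} (F : ℤ → ℕ → Ω → UpdateFn) (ω : Ω) : ℕ → Config → Config
  | 0, ξ => ξ
  | T + 1, ξ => pastState F ω T (globalUpdate (fun x => F x T ω) ξ)

/-- Coupling from the past succeeds at cell `x`: almost surely there is a (random) starting time
`-T` such that the state of `x` at time `0` is the same for all configurations at time `-T`. -/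
def CFTPSucceedsAt {Ω : Type*} [MeasurableSpace Ω] (μ : Measure Ω) (F : ℤ → ℕ → Ω → UpdateFn)
    (x : ℤ) : Prop :=
  ∀ᵐ ω ∂μ, ∃ T : ℕ, ∀ ξ₁ ξ₂ : Config, pastState F ω T ξ₁ x = pastState F ω T ξ₂ x

/-! Run two copies with the same update functions and let D be the set where they differ. Writing
each update as addition modulo 2 plus a noise, D evolves by the linear rule D(x-1) + D(x+1) plus the
difference N of the two noises, and N vanishes at x when D vanishes at x and its two neighbours. The
small parameter is ε = `maxNoiseDist`, the largest probability that the noises at two triples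
differ. It satisfies ε ≤ 2(1-p), but it depends on the coupling and may be far smaller than 1-p. If
ε = 0, D is exactly linear and a one spreads forever.

Let ε > 0. A break, that is a site with D(x-1) ≠ D(x+1), becomes a one unless noise hits it. Hence
ones approach any target c at speed one: the zeros around c end at a break one step nearer than the
nearest one. Three things can prevent this. (1) D is nonzero and 2-periodic on a long run, so that
breaks are missing. But the law of the first copy is nearly uniform, since nontrivial characters
contract by |2p-1| at each step; it therefore often shows a pattern which disturbs such a run with
probability at least ε/4, whatever the second copy is (`exists_disturbing_pattern`,
`IsPairProcess.measureReal_hasRun_le`). (2) Noise hits the two nearest breaks at once: ε² per step.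
(3) Noise hits the nearest break while all others are at least 2J farther from c. A lone break
splits into two diverging ones, so this isolation occurs about once in J steps
(`IsNoisyRule.not_isIsolated`). Any other noise on the nearest break costs a distance of at most 2J,
and Markov's inequality bounds the number of hits. With ε of order n^(-8), J = n^4, K = 128 n^5 and
T = 4096 n^9, the failure probability tends to 0 as n grows (`IsPairProcess.measureReal_vanish_le`,
`failBound_le`).

Then renormalise: given the past, a block containing a one hands ones over to itself and its two
neighbours with probability close to one, with finite range. A Lipschitz percolation argument
(`occupied_of_not_isBackPath`, `measure_exists_isBackPath_le`) keeps block 0 occupied at each level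
with probability at least 1/2, so the origin is separated at all multiples of T with probability
bounded below. Time reversal of the i.i.d. environment carries this over to coupling from the past.
Ergodicity is the contraction of characters. -/

/-! ### Conditioning and independence in infinite product spaces. -/

section ProductSpace

variable {ι α : Type*}

/-- `A` only depends on the coordinates in `I`. -/
def SetDependsOn (A : Set (ι → α)) (I : Set ι) : Prop :=
  ∀ ω ω' : ι → α, (∀ i ∈ I, ω i = ω' i) → (ω ∈ A ↔ ω' ∈ A)

theorem SetDependsOn.mono {A : Set (ι → α)} {I J : Set ι} (h : SetDependsOn A I) (hIJ : I ⊆ J) :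
    SetDependsOn A J := fun ω ω' hω => h ω ω' fun i hi => hω i (hIJ hi)

variable [MeasurableSpace α] (ν : Measure α) [IsProbabilityMeasure ν]

open Classical in
-- Gluing two independent samples along `I` gives a sample again. With Fubini this replaces
-- conditional expectation given the coordinates in `I`.
theorem measurePreserving_piecewise (I : Set ι) :
    MeasurePreserving (fun z : (ι → α) × (ι → α) => I.piecewise z.1 z.2)
      ((Measure.infinitePi fun _ : ι => ν).prod (Measure.infinitePi fun _ : ι => ν))
      (Measure.infinitePi fun _ : ι => ν) := by
  have hm : Measurable (fun z : (ι → α) × (ι → α) => I.piecewise z.1 z.2) := by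
    refine measurable_pi_lambda _ fun i => ?_
    by_cases hi : i ∈ I
    · simpa [Set.piecewise, hi, Function.comp_def] using (measurable_pi_apply i).comp measurable_fst
    · simpa [Set.piecewise, hi, Function.comp_def] using (measurable_pi_apply i).comp measurable_snd
  refine ⟨hm, Measure.eq_infinitePi _ fun s t ht => ?_⟩
  rw [Measure.map_apply hm (MeasurableSet.pi s.countable_toSet fun i _ => ht i)]
  have : (fun z : (ι → α) × (ι → α) => I.piecewise z.1 z.2) ⁻¹' ((s : Set ι).pi t) =
      (((s.filter (· ∈ I) : Finset ι) : Set ι).pi t) ×ˢ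
        (((s.filter (· ∉ I) : Finset ι) : Set ι).pi t) := by
    ext z
    simp only [Set.mem_preimage, Set.mem_pi, Set.mem_prod, Finset.coe_filter, Set.mem_ofPred_eq,
      Set.piecewise, Finset.mem_coe]
    constructor
    · intro h
      exact ⟨fun i hi => by simpa [hi.2] using h i hi.1, fun i hi => by simpa [hi.2] using h i hi.1⟩
    · rintro ⟨h1, h2⟩ i hi
      by_cases hI : i ∈ I
      · simpa [hI] using h1 i ⟨hi, hI⟩
      · simpa [hI] using h2 i ⟨hi, hI⟩
  rw [this, Measure.prod_prod, Measure.infinitePi_pi _ fun i _ => ht i,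
    Measure.infinitePi_pi _ fun i _ => ht i, Finset.prod_filter_mul_prod_filter_not]

theorem SetDependsOn.measurableSet [DiscreteMeasurableSpace α] [Finite α] {A : Set (ι → α)}
    {I : Finset ι} (h : SetDependsOn A I) : MeasurableSet A := by
  have : A = I.restrict ⁻¹' (I.restrict '' A) := by
    ext ω
    constructor
    · exact fun hω => ⟨ω, hω, rfl⟩
    · rintro ⟨ω', hω', he⟩
      exact (h ω' ω fun i hi => congrFun he ⟨i, hi⟩).1 hω'
  rw [this]
  exact (Finset.measurable_restrict I) (Set.toFinite _).measurableSet

open Classical in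
theorem measureReal_eq_integral_piecewise (I : Set ι) {E : Set (ι → α)} (hE : MeasurableSet E) :
    (Measure.infinitePi fun _ : ι => ν).real E =
      ∫ ω, (Measure.infinitePi fun _ : ι => ν).real {ω' | I.piecewise ω ω' ∈ E}
        ∂(Measure.infinitePi fun _ : ι => ν) := by
  have hp := measurePreserving_piecewise ν I
  have h1 := hp.measure_preimage hE.nullMeasurableSet
  have hE' : MeasurableSet ((fun z : (ι → α) × (ι → α) => I.piecewise z.1 z.2) ⁻¹' E) :=
    hp.measurable hE
  rw [Measure.prod_apply hE'] at h1
  rw [Measure.real, ← h1, ← integral_toReal]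
  · rfl
  · exact (measurable_measure_prodMk_left hE').aemeasurable
  · exact Eventually.of_forall fun _ => measure_lt_top _ _

/-- The point `ω''` is `ω` on `I` glued to `ω'` off `I`; the existential form spares applications
the `piecewise`. Thus `h` bounds the probability of `E` given the coordinates in `I`. -/
theorem measureReal_le_integral_of_section (I : Set ι) {E : Set (ι → α)} (hE : MeasurableSet E)
    {φ : (ι → α) → ℝ} (hφ : Integrable φ (Measure.infinitePi fun _ : ι => ν))
    (h : ∀ ω, (Measure.infinitePi fun _ : ι => ν).real
      {ω' : ι → α | ∃ ω'' : ι → α, ω'' ∈ E ∧ (∀ i ∈ I, ω'' i = ω i) ∧ ∀ i ∉ I, ω'' i = ω' i} ≤ φ ω) :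
    (Measure.infinitePi fun _ : ι => ν).real E ≤ ∫ ω, φ ω ∂(Measure.infinitePi fun _ : ι => ν) := by
  classical
  rw [measureReal_eq_integral_piecewise ν I hE]
  refine integral_mono_of_nonneg (Eventually.of_forall fun _ => measureReal_nonneg) hφ
    (Eventually.of_forall fun ω => (measureReal_mono ?_ (measure_ne_top _ _)).trans (h ω))
  intro ω' hω'
  exact ⟨_, hω', fun i hi => by simp [hi], fun i hi => by simp [hi]⟩

theorem measureReal_inter_le_of_section (I : Set ι) {A E : Set (ι → α)} (hA : MeasurableSet A)
    (hAI : SetDependsOn A I) (hE : MeasurableSet E) {c : ℝ}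
    (h : ∀ ω ∈ A, (Measure.infinitePi fun _ : ι => ν).real
      {ω' : ι → α | ∃ ω'' : ι → α, ω'' ∈ E ∧ (∀ i ∈ I, ω'' i = ω i) ∧ ∀ i ∉ I, ω'' i = ω' i} ≤ c) :
    (Measure.infinitePi fun _ : ι => ν).real (A ∩ E) ≤
      c * (Measure.infinitePi fun _ : ι => ν).real A := by
  classical
  have := measureReal_le_integral_of_section ν I (hA.inter hE)
    (φ := A.indicator fun _ => c) ((integrable_const c).indicator hA) ?_
  · rwa [integral_indicator_const _ hA, smul_eq_mul, mul_comm] at this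
  · intro ω
    by_cases hω : ω ∈ A
    · rw [Set.indicator_of_mem hω]
      refine (measureReal_mono ?_ (measure_ne_top _ _)).trans (h ω hω)
      rintro ω' ⟨ω'', h1, h2⟩
      exact ⟨ω'', h1.2, h2⟩
    · rw [Set.indicator_of_notMem hω]
      refine le_of_eq ?_
      convert measureReal_empty (μ := Measure.infinitePi fun _ : ι => ν)
      ext ω'
      simp only [Set.mem_ofPred_eq, Set.mem_empty_iff_false, iff_false, not_exists, not_and]
      intro ω'' h1 h2
      exact absurd ((hAI ω'' ω h2).1 h1.1) hω

theorem measureReal_le_of_section (I : Set ι) {E : Set (ι → α)} (hE : MeasurableSet E) {c : ℝ}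
    (h : ∀ ω : ι → α, (Measure.infinitePi fun _ : ι => ν).real
      {ω' : ι → α | ∃ ω'' : ι → α, ω'' ∈ E ∧ (∀ i ∈ I, ω'' i = ω i) ∧ ∀ i ∉ I, ω'' i = ω' i} ≤ c) :
    (Measure.infinitePi fun _ : ι => ν).real E ≤ c := by
  have := measureReal_inter_le_of_section ν I (A := Set.univ) MeasurableSet.univ
    (fun _ _ _ => Iff.rfl) hE (fun ω _ => h ω)
  simpa using this

theorem measureReal_inter_eq_mul {I : Set ι} {A E : Set (ι → α)} (hA : MeasurableSet A)
    (hAI : SetDependsOn A I) (hE : MeasurableSet E) (hEI : SetDependsOn E Iᶜ) :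
    (Measure.infinitePi fun _ : ι => ν).real (A ∩ E) =
      (Measure.infinitePi fun _ : ι => ν).real A * (Measure.infinitePi fun _ : ι => ν).real E := by
  classical
  rw [measureReal_eq_integral_piecewise ν I (hA.inter hE), ← smul_eq_mul,
    ← integral_indicator_const _ hA]
  refine integral_congr_ae (Eventually.of_forall fun ω => ?_)
  have h1 : ∀ ω', I.piecewise ω ω' ∈ A ↔ ω ∈ A := fun ω' =>
    hAI _ _ fun i hi => by simp [hi]
  have h2 : ∀ ω', I.piecewise ω ω' ∈ E ↔ ω' ∈ E := fun ω' =>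
    hEI _ _ fun i hi => Set.piecewise_eq_of_notMem _ _ _ hi
  by_cases hω : ω ∈ A
  · simp [Set.mem_inter_iff, h1, h2, hω]
  · simp [Set.mem_inter_iff, h1, h2, hω]

theorem measureReal_biInter_le_pow {κ : Type*} (S : Finset κ) (I : κ → Set ι)
    (E : κ → Set (ι → α)) (hE : ∀ k ∈ S, MeasurableSet (E k))
    (hEI : ∀ k ∈ S, SetDependsOn (E k) (I k))
    (hI : (S : Set κ).PairwiseDisjoint I) {c : ℝ} (hc : 0 ≤ c)
    (h : ∀ k ∈ S, (Measure.infinitePi fun _ : ι => ν).real (E k) ≤ c) :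
    (Measure.infinitePi fun _ : ι => ν).real (⋂ k ∈ S, E k) ≤ c ^ S.card := by
  classical
  induction S using Finset.induction_on with
  | empty => simp
  | insert a S ha ih =>
    rw [Finset.set_biInter_insert, Finset.card_insert_of_notMem ha, pow_succ, mul_comm]
    have hd : SetDependsOn (⋂ k ∈ S, E k) (I a)ᶜ := by
      intro ω ω' hω
      simp only [Set.mem_iInter]
      refine forall₂_congr fun k hk => hEI k (by simp [hk]) ω ω' fun i hi => hω i fun hia => ?_
      have := hI (by simp [hk] : k ∈ ((insert a S : Finset κ) : Set κ))
        (by simp : a ∈ ((insert a S : Finset κ) : Set κ)) (by rintro rfl; exact ha hk)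
      exact Set.disjoint_left.1 this hi hia
    rw [measureReal_inter_eq_mul ν (I := I a) (hE a (by simp)) (hEI a (by simp))
      (Finset.measurableSet_biInter _ fun k hk => hE k (by simp [hk])) hd]
    refine mul_le_mul (h a (by simp)) ?_ measureReal_nonneg hc
    exact ih (fun k hk => hE k (by simp [hk])) (fun k hk => hEI k (by simp [hk]))
      (hI.subset (by simp)) (fun k hk => h k (by simp [hk]))

/-- Relabelling an i.i.d. family without repetition keeps its law. Space-time translations and time
reversal enter through this. -/
theorem measurePreserving_reindex {κ : Type*} {σ : κ → ι} (hσ : Function.Injective σ) :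
    MeasurePreserving (fun (ω : ι → α) k => ω (σ k)) (Measure.infinitePi fun _ : ι => ν)
      (Measure.infinitePi fun _ : κ => ν) := by
  have hm : Measurable (fun (ω : ι → α) k => ω (σ k)) :=
    measurable_pi_lambda _ fun k => measurable_pi_apply _
  refine ⟨hm, Measure.eq_infinitePi _ fun s t ht => ?_⟩
  rw [Measure.map_apply hm (MeasurableSet.pi s.countable_toSet fun i _ => ht i)]
  have : (fun (ω : ι → α) k => ω (σ k)) ⁻¹' ((s : Set κ).pi t) =
      ((s.map ⟨σ, hσ⟩ : Finset ι) : Set ι).pi (Function.extend σ t fun _ => Set.univ) := by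
    ext ω
    simp [Set.mem_pi, hσ.extend_apply]
  rw [this, Measure.infinitePi_pi, Finset.prod_map]
  · simp [hσ.extend_apply]
  · intro i hi
    obtain ⟨j, -, rfl⟩ := Finset.mem_map.1 hi
    simpa [hσ.extend_apply] using ht j

end ProductSpace

/-! ### Deterministic motion of ones under the noisy linear rule. -/

section Geometry

/-- The sites whose two neighbours have different states. -/
def IsBreak (D : Config) (x : ℤ) : Prop := D (x - 1) ≠ D (x + 1)

instance (D : Config) : DecidablePred (IsBreak D) := fun x =>
  inferInstanceAs (Decidable (D (x - 1) ≠ D (x + 1)))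

/-- `D` coincides on `[x, x + m)` with a nonzero configuration of period `2`. -/
def HasRun (D : Config) (x : ℤ) (m : ℕ) : Prop :=
  ∃ b : Bool → Bool, (∃ i, b i = true) ∧ ∀ y, x ≤ y → y < x + m → D y = b (decide (Even y))

/-- Without a break inside the window `D` is 2-periodic there, and the one at `y` makes it nonzero.
-/
theorem exists_isBreak_of_not_hasRun {D : Config} {u : ℤ} {m : ℕ} (h : ¬ HasRun D u m)
    {y : ℤ} (hy : D y = true) (h1 : u ≤ y) (h2 : y < u + m) :
    ∃ x, u + 1 ≤ x ∧ x + 2 ≤ u + m ∧ IsBreak D x := by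
  by_contra! hno
  simp only [IsBreak, ne_eq, not_not] at hno
  apply h
  let b : Bool → Bool := fun i => if i = decide (Even u) then D u else D (u + 1)
  have key : ∀ k : ℕ, (k : ℤ) < m → D (u + k) = b (decide (Even (u + k))) := by
    intro k
    induction k using Nat.strong_induction_on with
    | _ k ih =>
      intro hk
      match k, ih, hk with
      | 0, _, _ => simp [b]
      | 1, _, _ =>
        have : ¬ (Odd u ↔ Even u) := by rw [← Int.not_even_iff_odd]; tauto
        simp [b, this]
      | k + 2, ih, hk =>
        have h3 := ih k (by omega) (by push_cast at hk; omega)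
        have h4 := hno (u + k + 1) (by omega) (by push_cast at hk; omega)
        have e1 : u + k + 1 - 1 = u + (k : ℤ) := by ring
        have e2 : u + (k : ℤ) + 1 + 1 = u + ((k + 2 : ℕ) : ℤ) := by push_cast; ring
        rw [e1, e2] at h4
        rw [← h4, h3]
        congr 2
        push_cast
        simp [Int.even_add, parity_simps]
  have key' : ∀ z, u ≤ z → z < u + m → D z = b (decide (Even z)) := by
    intro z hz1 hz2
    obtain ⟨k, rfl⟩ : ∃ k : ℕ, z = u + k := ⟨(z - u).toNat, by omega⟩
    exact key k (by omega)
  exact ⟨b, ⟨_, (key' y h1 h2).symm.trans hy⟩, key'⟩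

/-- An element of `S` nearest to `c`. -/
noncomputable def nearest (c : ℤ) (S : Finset ℤ) : ℤ :=
  open Classical in
  if h : S.Nonempty then (S.exists_min_image (fun x => |x - c|) h).choose else c

theorem nearest_mem {c : ℤ} {S : Finset ℤ} (h : S.Nonempty) : nearest c S ∈ S := by
  unfold nearest
  rw [dif_pos h]
  exact (S.exists_min_image (fun x => |x - c|) h).choose_spec.1

theorem abs_nearest_sub_le {c x : ℤ} {S : Finset ℤ} (h : x ∈ S) : |nearest c S - c| ≤ |x - c| := by
  unfold nearest
  rw [dif_pos ⟨x, h⟩]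
  exact (S.exists_min_image (fun x => |x - c|) ⟨x, h⟩).choose_spec.2 x h

/-- The breaks at distance at most `R` from `c`. -/
noncomputable def breaks (c : ℤ) (R : ℕ) (D : Config) : Finset ℤ := (Finset.Icc (c - R) (c + R)).filter (IsBreak D)

theorem mem_breaks {c : ℤ} {R : ℕ} {D : Config} {x : ℤ} :
    x ∈ breaks c R D ↔ |x - c| ≤ R ∧ IsBreak D x := by
  simp only [breaks, Finset.mem_filter, Finset.mem_Icc, abs_le]
  constructor
  · rintro ⟨⟨h1, h2⟩, h⟩; exact ⟨⟨by omega, by omega⟩, h⟩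
  · rintro ⟨⟨h1, h2⟩, h⟩; exact ⟨⟨by omega, by omega⟩, h⟩

/-- A break nearest to `c`. -/
noncomputable def firstBreak (c : ℤ) (R : ℕ) (D : Config) : ℤ := nearest c (breaks c R D)

/-- A second nearest break. -/
noncomputable def secondBreak (c : ℤ) (R : ℕ) (D : Config) : ℤ :=
  nearest c ((breaks c R D).erase (firstBreak c R D))

/-- `D` vanishes around `c` and its first break is far nearer to `c` than all other breaks. -/
def IsIsolated (c : ℤ) (R J : ℕ) (D : Config) : Prop :=
  (∀ x, |x - c| ≤ 1 → D x = false) ∧ IsBreak D (firstBreak c R D) ∧ |firstBreak c R D - c| ≤ R ∧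
    ∀ y, IsBreak D y → |y - c| < |firstBreak c R D - c| + 2 * J → y = firstBreak c R D

/-- If the one nearest to `c` is at distance at least two, there is a zero two sites nearer to `c`,
so the site between is a break; this gains the unit in `k - 1`. If a one is within distance one of
`c`, the absence of a run gives a break within `m`. -/
theorem exists_isBreak_le {D : Config} {c : ℤ} {m k : ℕ}
    (hrun : ¬ HasRun D (c - 1) m) (hm : 3 ≤ m)
    (hone : ∃ y, |y - c| ≤ k ∧ D y = true) :
    ∃ x, |x - c| ≤ max (k - 1 : ℤ) m ∧ IsBreak D x := by
  by_cases h1 : ∃ y, |y - c| ≤ 1 ∧ D y = true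
  · obtain ⟨y, hy, hDy⟩ := h1
    rw [abs_le] at hy
    obtain ⟨x, hx1, hx2, hx⟩ := exists_isBreak_of_not_hasRun hrun hDy (by omega) (by omega)
    refine ⟨x, le_max_of_le_right ?_, hx⟩
    rw [abs_le]; omega
  · push Not at h1
    obtain ⟨y, hy, hDy⟩ := hone
    let S := (Finset.Icc (c - k) (c + k)).filter fun y => D y = true
    have hyS : y ∈ S := by
      rw [abs_le] at hy
      simp only [S, Finset.mem_filter, Finset.mem_Icc]
      exact ⟨⟨by omega, by omega⟩, hDy⟩
    have h2 := nearest_mem (c := c) ⟨y, hyS⟩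
    set z := nearest c S with hz
    have hzmin : ∀ w, |w - c| < |z - c| → D w = false := by
      intro w hw
      by_contra hDw
      have h3 : |z - c| ≤ |y - c| := abs_nearest_sub_le hyS
      have : w ∈ S := by
        have : |w - c| ≤ k := by omega
        rw [abs_le] at this
        simp only [S, Finset.mem_filter, Finset.mem_Icc]
        exact ⟨⟨by omega, by omega⟩, by simpa using hDw⟩
      have h8 : |z - c| ≤ |w - c| := abs_nearest_sub_le this
      omega
    have hDz : D z = true := (Finset.mem_filter.1 h2).2
    have hzk : |z - c| ≤ k := (abs_nearest_sub_le hyS).trans hy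
    have hz2 : 1 < |z - c| := by
      by_contra hcon
      exact h1 z (by omega) hDz
    rcases le_or_gt c z with hcz | hcz
    · rw [abs_of_nonneg (by omega)] at hz2 hzk
      refine ⟨z - 1, le_max_of_le_left (by rw [abs_le]; omega), ?_⟩
      have : D (z - 1 - 1) = false := hzmin _ (by
        rw [abs_of_nonneg (by omega : (0 : ℤ) ≤ z - c), abs_lt]; omega)
      rw [IsBreak, this, sub_add_cancel, hDz]; simp
    · rw [abs_of_neg (by omega)] at hz2 hzk
      refine ⟨z + 1, le_max_of_le_left (by rw [abs_le]; omega), ?_⟩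
      have : D (z + 1 + 1) = false := hzmin _ (by
        rw [abs_of_neg (by omega : z - c < 0), abs_lt]; omega)
      rw [IsBreak, this, add_sub_cancel_right, hDz]; simp

/-- One neighbour of a break carries a one; the window of length `m` with end `x` on that side
contains another break. -/
theorem exists_second_isBreak {D : Config} {x : ℤ} {m : ℕ} (hm : 2 ≤ m) (hx : IsBreak D x)
    (h1 : ¬ HasRun D x m) (h2 : ¬ HasRun D (x - m + 1) m) :
    ∃ y, y ≠ x ∧ |y - x| ≤ m ∧ IsBreak D y := by
  rcases Bool.eq_false_or_eq_true (D (x + 1)) with h | h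
  · obtain ⟨y, hy1, hy2, hy⟩ := exists_isBreak_of_not_hasRun h1 h (by omega) (by omega)
    exact ⟨y, by omega, by rw [abs_le]; omega, hy⟩
  · have h' : D (x - 1) = true := by
      rw [IsBreak, h] at hx; simpa using hx
    obtain ⟨y, hy1, hy2, hy⟩ := exists_isBreak_of_not_hasRun h2 h' (by omega) (by omega)
    exact ⟨y, by omega, by rw [abs_le]; omega, hy⟩

/-- The new one is at the first break if no noise hits it, and otherwise at the second break, which
`hdouble` keeps free of noise. In the latter case non-isolation bounds the loss by `2 * J`, except
when a one is next to `c`: then the first break is within `m` and the second within `2 * m`. -/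
theorem exists_one_step {D D' N : Config} {c : ℤ} {R J m k : ℕ} (hm : 3 ≤ m)
    (hD' : ∀ x, D' x = xor (xor (D (x - 1)) (D (x + 1))) (N x))
    (hR : k + m + 2 * J + 1 ≤ R) (hR' : 2 * m + 2 * J + 1 ≤ R)
    (hrun : ∀ x, |x - c| ≤ R → ¬ HasRun D x m)
    (hdouble : ¬ (firstBreak c R D ≠ secondBreak c R D ∧ N (firstBreak c R D) = true ∧
      N (secondBreak c R D) = true))
    (hiso : ¬ (IsIsolated c R J D ∧ N (firstBreak c R D) = true))
    (hone : ∃ y, |y - c| ≤ k ∧ D y = true) :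
    ∃ y, |y - c| ≤ max (k - 1 : ℤ) (2 * m) + (if N (firstBreak c R D) = true then 2 * J else 0) ∧
      D' y = true := by
  set x₁ := firstBreak c R D with hx₁
  set x₂ := secondBreak c R D with hx₂
  have hD'b : ∀ x, IsBreak D x → N x = false → D' x = true := by
    intro x hx hN
    rw [hD', hN]
    simpa [IsBreak, bne_iff_ne] using hx
  have hr0 : ¬ HasRun D (c - 1) m := hrun _ (by rw [abs_le]; omega)
  have hfirst : ∀ j : ℕ, max (j - 1 : ℤ) m ≤ R → (∃ y, |y - c| ≤ j ∧ D y = true) →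
      x₁ ∈ breaks c R D ∧ |x₁ - c| ≤ max (j - 1 : ℤ) m := by
    intro j hj hone
    obtain ⟨x, hx, hxb⟩ := exists_isBreak_le hr0 hm hone
    have hxm : x ∈ breaks c R D := mem_breaks.2 ⟨hx.trans hj, hxb⟩
    exact ⟨nearest_mem ⟨x, hxm⟩, (abs_nearest_sub_le hxm).trans hx⟩
  obtain ⟨hm1, hle1⟩ := hfirst k (by omega) hone
  obtain ⟨hb1R, hb1⟩ := mem_breaks.1 hm1
  have hsec : ∀ y, |y - c| ≤ R → y ≠ x₁ → IsBreak D y →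
      x₂ ∈ (breaks c R D).erase x₁ ∧ |x₂ - c| ≤ |y - c| := by
    intro y hyR hy hyb
    have : y ∈ (breaks c R D).erase x₁ := Finset.mem_erase.2 ⟨hy, mem_breaks.2 ⟨hyR, hyb⟩⟩
    exact ⟨nearest_mem ⟨y, this⟩, abs_nearest_sub_le this⟩
  rcases Bool.eq_false_or_eq_true (N x₁) with hN1 | hN1
  swap
  · refine ⟨x₁, ?_, hD'b _ hb1 hN1⟩
    simp only [hN1, Bool.false_eq_true, if_false]
    omega
  obtain ⟨y, hyne, hy, hyb⟩ := exists_second_isBreak (by omega : 2 ≤ m) hb1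
    (hrun _ hb1R) (hrun _ (by rw [abs_le] at hle1 ⊢; omega))
  have hyc : |y - c| ≤ |x₁ - c| + m := by
    calc |y - c| = |(y - x₁) + (x₁ - c)| := by ring_nf
      _ ≤ _ := (abs_add_le _ _).trans (by omega)
  obtain ⟨hm2, hle2⟩ := hsec y (by omega) hyne hyb
  obtain ⟨hne2, hm2'⟩ := Finset.mem_erase.1 hm2
  obtain ⟨hb2R, hb2⟩ := mem_breaks.1 hm2'
  have hN2 : N x₂ = false := by
    by_contra h
    exact hdouble ⟨hne2.symm, hN1, by simpa using h⟩
  refine ⟨x₂, ?_, hD'b _ hb2 hN2⟩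
  simp only [hN1, if_true]
  by_cases h0 : ∃ y, |y - c| ≤ 1 ∧ D y = true
  · have := (hfirst 1 (by push_cast; omega) (by simpa using h0)).2
    push_cast at this
    omega
  · have hni : ¬ IsIsolated c R J D := fun h => hiso ⟨h, hN1⟩
    push Not at h0
    simp only [IsIsolated, ← hx₁, not_and, not_forall] at hni
    obtain ⟨w, hw1, hw2, hw3⟩ := hni (fun x hx => by simpa using h0 x hx) hb1 hb1R
    have := (hsec w (by omega) hw3 hw1).2
    omega

/-- A sequence of configurations following the additive rule up to an error `N`, which vanishes
where the configuration does. -/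
structure IsNoisyRule (a : ℕ) (D N : ℕ → Config) : Prop where
  step : ∀ s, a ≤ s → ∀ x, D (s + 1) x = xor (xor (D s (x - 1)) (D s (x + 1))) (N s x)
  quiet : ∀ s, a ≤ s → ∀ x, D s (x - 1) = false → D s x = false → D s (x + 1) = false →
    N s x = false

theorem IsNoisyRule.zero {a : ℕ} {D N : ℕ → Config} (h : IsNoisyRule a D N) {s : ℕ} (hs : a ≤ s)
    {x : ℤ} (h1 : D s (x - 1) = false) (h2 : D s x = false) (h3 : D s (x + 1) = false) :
    D (s + 1) x = false := by
  rw [h.step s hs, h.quiet s hs x h1 h2 h3, h1, h3]; rfl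

/-- The distance to `c` drops by one per step down to `2 * m`, and each noisy first break adds at
most `2 * J`. The bounds on `R` keep all breaks used inside the window. -/
theorem IsNoisyRule.exists_one {a : ℕ} {D N : ℕ → Config} (h : IsNoisyRule a D N) {c : ℤ}
    {R J m T k K : ℕ} (hm : 3 ≤ m)
    (hR : k + 2 * m + 2 * J * (K + 1) + 1 ≤ R) (hR' : 4 * m + 2 * J * (K + 1) + 1 ≤ R)
    (hrun : ∀ s < T, ∀ x, |x - c| ≤ R → ¬ HasRun (D (a + s)) x m)
    (hdouble : ∀ s < T, ¬ (firstBreak c R (D (a + s)) ≠ secondBreak c R (D (a + s)) ∧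
      N (a + s) (firstBreak c R (D (a + s))) = true ∧
      N (a + s) (secondBreak c R (D (a + s))) = true))
    (hiso : ∀ s < T, ¬ (IsIsolated c R J (D (a + s)) ∧
      N (a + s) (firstBreak c R (D (a + s))) = true))
    (hcount : ((Finset.range T).filter fun s =>
      N (a + s) (firstBreak c R (D (a + s))) = true).card ≤ K)
    (hone : ∃ y, |y - c| ≤ k ∧ D a y = true) :
    ∃ y, |y - c| ≤ max (k - T : ℤ) (2 * m) + 2 * J * K ∧ D (a + T) y = true := by
  have key : ∀ t ≤ T, ∃ y, |y - c| ≤ max (k - t : ℤ) (2 * m) + 2 * J *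
      ((Finset.range t).filter fun s => N (a + s) (firstBreak c R (D (a + s))) = true).card ∧
      D (a + t) y = true := by
    intro t ht
    induction t with
    | zero =>
      obtain ⟨y, hy, hDy⟩ := hone
      exact ⟨y, by simp; left; omega, hDy⟩
    | succ t ih =>
      obtain ⟨y, hy, hDy⟩ := ih (by omega)
      set q := ((Finset.range t).filter fun s =>
        N (a + s) (firstBreak c R (D (a + s))) = true).card with hq
      have hqK : q ≤ K := (Finset.card_le_card (Finset.filter_subset_filter _
        (Finset.range_mono (by omega)))).trans hcount
      have hqJ : J * q ≤ J * K := Nat.mul_le_mul_left _ hqK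
      have hR1 : k + 2 * m + 2 * (J * K) + 2 * J + 1 ≤ R := by nlinarith
      have hR2 : 4 * m + 2 * (J * K) + 2 * J + 1 ≤ R := by nlinarith
      have hy' : |y - c| ≤ max (k - t : ℤ) (2 * m) + 2 * (J * q : ℕ) := by
        push_cast; linarith [hy]
      obtain ⟨z, hz, hDz⟩ := exists_one_step (k := (max (k - t : ℤ) (2 * m) + 2 * (J * q : ℕ)).toNat)
        hm (h.step (a + t) (by omega)) (by omega) (by omega) (hrun t (by omega))
        (hdouble t (by omega)) (hiso t (by omega)) ⟨y, by omega, hDy⟩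
      refine ⟨z, hz.trans ?_, hDz⟩
      rw [Finset.range_add_one, Finset.filter_insert]
      split_ifs with hN
      · rw [Finset.card_insert_of_notMem (by simp), ← hq]
        have : (2 : ℤ) * J * (q + 1 : ℕ) = 2 * (J * q : ℕ) + 2 * J := by push_cast; ring
        rw [this]; push_cast; omega
      · rw [← hq]
        have : (2 : ℤ) * J * q = 2 * (J * q : ℕ) := by push_cast; ring
        rw [this]; push_cast; omega
  obtain ⟨y, hy, hDy⟩ := key T le_rfl
  refine ⟨y, hy.trans ?_, hDy⟩
  have := Nat.mul_le_mul_left (2 * J) hcount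
  have h2 : (2 * J * ((Finset.range T).filter fun s =>
      N (a + s) (firstBreak c R (D (a + s))) = true).card : ℤ) ≤ 2 * J * K := by exact_mod_cast this
  linarith

/-- Absence of noise around the first break of `D s`, then along the two diagonals leaving it. -/
def IsQuietCone (c : ℤ) (R J s : ℕ) (D N : ℕ → Config) : Prop :=
  (∀ x, |x - firstBreak c R (D s)| ≤ 2 * J → N s x = false) ∧
    ∀ j : ℕ, j + 1 < J → N (s + 1 + j) (firstBreak c R (D s) + (j + 1)) = false ∧
      N (s + 1 + j) (firstBreak c R (D s) - (j + 1)) = false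

/-- An isolated break `x₁` free of noise becomes the only one at distance less than `2 * J` from
`x₁`, and its offspring leaves along both diagonals. At time `s + 1 + j` there are breaks at `x₁ ±
(j + 1)`, while no break is nearer to `c` than `|x₁ - c| - 1 - j`, because the zeros around `c` are
eaten at speed at most one. Both breaks thus exceed the least distance by at most `2 * (j + 1) < 2 *
J`, and two such breaks contradict isolation. -/
theorem IsNoisyRule.not_isIsolated {a : ℕ} {D N : ℕ → Config} (h : IsNoisyRule a D N) {c : ℤ}
    {R J s : ℕ} (hs : a ≤ s) (hiso : IsIsolated c R J (D s)) (hq : IsQuietCone c R J s D N)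
    {j : ℕ} (hj : j + 1 < J) : ¬ IsIsolated c R J (D (s + 1 + j)) := by
  obtain ⟨hz, hb, -, hu⟩ := hiso
  obtain ⟨hq1, hq2⟩ := hq
  set x₁ := firstBreak c R (D s) with hx₁
  have hd : 1 ≤ |x₁ - c| := by
    by_contra hcon
    have : x₁ = c := by
      have := abs_nonneg (x₁ - c)
      have h0 : |x₁ - c| = 0 := by omega
      rw [abs_eq_zero] at h0; omega
    apply hb
    rw [this, hz _ (by rw [abs_le]; omega), hz _ (by rw [abs_le]; omega)]
  have hzero : ∀ k : ℕ, (k : ℤ) ≤ |x₁ - c| → ∀ x, |x - c| ≤ k → D s x = false := by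
    intro k
    induction k with
    | zero => intro _ x hx; exact hz x (by push_cast at hx; omega)
    | succ k ih =>
      intro hk x hx
      push_cast at hk hx
      by_cases hxk : |x - c| ≤ k
      · exact ih (by omega) x hxk
      · by_cases hk0 : k = 0
        · exact hz x (by omega)
        have hnb : ∀ y, |y - c| = k → D s (y - 1) = D s (y + 1) := by
          intro y hy
          by_contra hyb
          have := hu y hyb (by omega)
          rw [this] at hy; omega
        rcases le_or_gt c x with hcx | hcx
        · rw [abs_of_nonneg (by omega)] at hx hxk
          have := hnb (x - 1) (by rw [abs_of_nonneg (by omega)]; omega)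
          rw [sub_add_cancel] at this
          rw [← this]
          exact ih (by omega) _ (by rw [abs_le]; omega)
        · rw [abs_of_neg (by omega)] at hx hxk
          have := hnb (x + 1) (by rw [abs_of_neg (by omega)]; omega)
          rw [add_sub_cancel_right] at this
          rw [this]
          exact ih (by omega) _ (by rw [abs_le]; omega)
  have hcone : ∀ i : ℕ, ∀ x, |x - c| ≤ |x₁ - c| - i → D (s + i) x = false := by
    intro i
    induction i with
    | zero =>
      intro x hx
      exact hzero (|x₁ - c|).toNat (by omega) x (by push_cast at hx; omega)
    | succ i ih =>
      intro x hx
      push_cast at hx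
      rw [abs_le] at hx
      exact h.zero (s := s + i) (by omega) (ih _ (by rw [abs_le]; omega)) (ih _ (by rw [abs_le]; omega))
        (ih _ (by rw [abs_le]; omega))
  -- Values between the diagonals do not matter; only the collar of zeros outside them does, and it
  -- loses one site at each end per step.
  have hspread : ∀ i : ℕ, i < J → (D (s + 1 + i) (x₁ + i) = true ∧ D (s + 1 + i) (x₁ - i) = true) ∧
      ∀ x, (i : ℤ) < |x - x₁| → |x - x₁| ≤ 2 * J - 1 - i → D (s + 1 + i) x = false := by
    intro i
    induction i with
    | zero =>
      intro hJ
      have h1 : D (s + 1) x₁ = true := by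
        rw [h.step s hs, hq1 x₁ (by simp)]
        simpa [IsBreak, bne_iff_ne] using hb
      refine ⟨⟨by simpa using h1, by simpa using h1⟩, fun x hx1 hx2 => ?_⟩
      push_cast at hx1 hx2
      rw [add_zero, h.step s hs, hq1 x (by omega)]
      have : ¬ IsBreak (D s) x := by
        intro hxb
        have hle : |x - c| ≤ |x - x₁| + |x₁ - c| := by
          calc |x - c| = |(x - x₁) + (x₁ - c)| := by ring_nf
            _ ≤ _ := abs_add_le _ _
        have := hu x hxb (by omega)
        rw [this] at hx1; simp at hx1
      simp only [IsBreak, ne_eq, not_not] at this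
      simp [this]
    | succ i ih =>
      intro hi
      obtain ⟨⟨h1, h2⟩, h3⟩ := ih (by omega)
      have e : s + 1 + (i + 1) = (s + 1 + i) + 1 := by ring
      rw [e]
      refine ⟨⟨?_, ?_⟩, fun x hx1 hx2 => ?_⟩
      · have h4 : D (s + 1 + i) (x₁ + (i + 1) + 1) = false := h3 _ (by
          rw [abs_of_nonneg (by omega)]; omega) (by rw [abs_of_nonneg (by omega)]; omega)
        push_cast
        rw [h.step _ (by omega), (hq2 i hi).1, h4]
        have : x₁ + ((i : ℤ) + 1) - 1 = x₁ + i := by ring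
        rw [this, h1]; rfl
      · have h4 : D (s + 1 + i) (x₁ - (i + 1) - 1) = false := h3 _ (by
          rw [abs_of_neg (by omega)]; omega) (by rw [abs_of_neg (by omega)]; omega)
        push_cast
        rw [h.step _ (by omega), (hq2 i hi).2, h4]
        have : x₁ - ((i : ℤ) + 1) + 1 = x₁ - i := by ring
        rw [this, h2]; rfl
      · push_cast at hx1 hx2
        have hn : ∀ y, |y - x| ≤ 1 → D (s + 1 + i) y = false := by
          intro y hy
          have h5 : |y - x₁| ≤ |y - x| + |x - x₁| := by
            calc |y - x₁| = |(y - x) + (x - x₁)| := by ring_nf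
              _ ≤ _ := abs_add_le _ _
          have h6 : |x - x₁| ≤ |y - x| + |y - x₁| := by
            calc |x - x₁| = |-(y - x) + (y - x₁)| := by ring_nf
              _ ≤ _ := (abs_add_le _ _).trans (by rw [abs_neg])
          exact h3 y (by omega) (by omega)
        exact h.zero (by omega) (hn _ (by simp)) (hn _ (by simp)) (hn _ (by simp))
  rintro ⟨-, hb', -, hu'⟩
  set y₁ := firstBreak c R (D (s + 1 + j)) with hy₁
  have hfar : |x₁ - c| - 1 - j ≤ |y₁ - c| := by
    by_contra hcon
    have hc1 := hcone (1 + j)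
    rw [← add_assoc] at hc1
    apply hb'
    have h7 : ∀ y, |y - y₁| ≤ 1 → D (s + 1 + j) y = false := by
      intro y hy
      refine hc1 y ?_
      have : |y - c| ≤ |y - y₁| + |y₁ - c| := by
        calc |y - c| = |(y - y₁) + (y₁ - c)| := by ring_nf
          _ ≤ _ := abs_add_le _ _
      push_cast; omega
    rw [h7 _ (by simp), h7 _ (by simp)]
  obtain ⟨⟨h1, h2⟩, h3⟩ := hspread j (by omega)
  have hb1 : IsBreak (D (s + 1 + j)) (x₁ + (j + 1)) := by
    have h4 : D (s + 1 + j) (x₁ + (j + 1) + 1) = false := h3 _ (by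
      rw [abs_of_nonneg (by omega)]; omega) (by rw [abs_of_nonneg (by omega)]; omega)
    have : x₁ + ((j : ℤ) + 1) - 1 = x₁ + j := by ring
    rw [IsBreak, h4, this, h1]; simp
  have hb2 : IsBreak (D (s + 1 + j)) (x₁ - (j + 1)) := by
    have h4 : D (s + 1 + j) (x₁ - (j + 1) - 1) = false := h3 _ (by
      rw [abs_of_neg (by omega)]; omega) (by rw [abs_of_neg (by omega)]; omega)
    have : x₁ - ((j : ℤ) + 1) + 1 = x₁ - j := by ring
    rw [IsBreak, h4, this, h2]; simp
  have e1 : |x₁ + (j + 1) - c| ≤ |x₁ - c| + (j + 1) := by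
    calc |x₁ + (j + 1) - c| = |(x₁ - c) + ((j : ℤ) + 1)| := by ring_nf
      _ ≤ _ := (abs_add_le _ _).trans (by rw [abs_of_nonneg (by omega : (0 : ℤ) ≤ (j : ℤ) + 1)])
  have e2 : |x₁ - (j + 1) - c| ≤ |x₁ - c| + (j + 1) := by
    calc |x₁ - (j + 1) - c| = |(x₁ - c) + -((j : ℤ) + 1)| := by ring_nf
      _ ≤ _ := (abs_add_le _ _).trans (by
        rw [abs_neg, abs_of_nonneg (by omega : (0 : ℤ) ≤ (j : ℤ) + 1)])
  have := hu' _ hb1 (by omega)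
  have := hu' _ hb2 (by omega)
  omega

end Geometry

/-! ### Fourier analysis of the PCA and ergodicity. -/

section Characters

/-- The character of `Bool`, as a function with values `1` and `-1`. -/
def boolSign (b : Bool) : ℝ := if b then -1 else 1

theorem boolSign_mul_self (a : Bool) : boolSign a * boolSign a = 1 := by
  cases a <;> simp [boolSign]

theorem abs_boolSign (a : Bool) : |boolSign a| = 1 := by
  cases a <;> simp [boolSign]

/-- The character of `{0,1}^ℤ` attached to a finite set of sites. -/
def configChar (A : Finset ℤ) (η : Config) : ℝ := ∏ x ∈ A, boolSign (η x)

theorem abs_configChar (A : Finset ℤ) (η : Config) : |configChar A η| = 1 := by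
  simp [configChar, Finset.abs_prod, abs_boolSign]

theorem measurable_configChar (A : Finset ℤ) : Measurable (configChar A) :=
  Finset.measurable_prod _ fun x _ =>
    (measurable_of_finite boolSign).comp (measurable_pi_apply x)

theorem integrable_configChar (A : Finset ℤ) (μ : Measure Config) [IsFiniteMeasure μ] :
    Integrable (configChar A) μ :=
  Integrable.of_bound (measurable_configChar A).aestronglyMeasurable 1
    (Eventually.of_forall fun η => by simp [abs_configChar])

theorem integral_configChar_infinitePi (A : Finset ℤ) (m : ℤ → Measure Bool)
    [∀ x, IsProbabilityMeasure (m x)] :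
    ∫ η, configChar A η ∂(Measure.infinitePi m) = ∏ x ∈ A, ∫ b, boolSign b ∂(m x) := by
  have h1 : ∀ η : Config, configChar A η =
      (fun v : A → Bool => ∏ x : A, boolSign (v x)) (A.restrict η) := fun η => by
    simp only [configChar, Finset.restrict]
    exact (Finset.prod_coe_sort A fun x => boolSign (η x)).symm
  simp_rw [h1]
  rw [integral_restrict_infinitePi m (X := fun _ : ℤ => Bool)
    (f := fun v : A → Bool => ∏ x : A, boolSign (v x)) (measurable_of_finite _).aestronglyMeasurable,
    integral_fintype_prod_eq_prod (fun (x : A) b => boolSign b) (μ := fun x : A => m x)]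
  exact Finset.prod_coe_sort A fun x => ∫ b, boolSign b ∂(m x)

theorem integral_boolSign_localLaw (p : unitInterval) (a c : Bool) :
    ∫ b, boolSign b ∂(localLaw p a c) = (2 * (p : ℝ) - 1) * (boolSign a * boolSign c) := by
  have hp := p.2.1
  have hp' := p.2.2
  rw [localLaw, integral_add_measure, integral_smul_measure, integral_smul_measure,
    integral_dirac, integral_dirac, ENNReal.toReal_ofReal hp, ENNReal.toReal_ofReal (by linarith)]
  · cases a <;> cases c <;> simp [addMod2, boolSign] <;> ring
  · exact (Integrable.of_finite).smul_measure ENNReal.ofReal_ne_top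
  · exact (Integrable.of_finite).smul_measure ENNReal.ofReal_ne_top

/-- The sites with exactly one neighbour in `A`. -/
def neighbourSymmDiff (A : Finset ℤ) : Finset ℤ :=
  symmDiff (A.map ⟨fun x => x - 1, sub_left_injective⟩) (A.map ⟨fun x => x + 1, add_left_injective 1⟩)

theorem neighbourSymmDiff_nonempty {A : Finset ℤ} (hA : A.Nonempty) :
    (neighbourSymmDiff A).Nonempty := by
  refine ⟨A.max' hA + 1, ?_⟩
  rw [neighbourSymmDiff, Finset.mem_symmDiff]
  right
  constructor
  · simpa using A.max'_mem hA
  · intro h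
    obtain ⟨y, hy, hyx⟩ := Finset.mem_map.1 h
    have := A.le_max' y hy
    simp only [Function.Embedding.coeFn_mk] at hyx
    omega

theorem prod_symmDiff_of_mul_self {f : ℤ → ℝ} (hf : ∀ x, f x * f x = 1) (B C : Finset ℤ) :
    ∏ x ∈ symmDiff B C, f x = (∏ x ∈ B, f x) * ∏ x ∈ C, f x := by
  have h1 : symmDiff B C = (B \ C) ∪ (C \ B) := rfl
  rw [h1, Finset.prod_union (Finset.disjoint_left.2 fun x hx hx' => by
    simp only [Finset.mem_sdiff] at hx hx'; exact hx'.2 hx.1),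
    ← Finset.prod_inter_mul_prod_sdiff B C, ← Finset.prod_inter_mul_prod_sdiff C B,
    Finset.inter_comm C B]
  have h2 : (∏ x ∈ B ∩ C, f x) * ∏ x ∈ B ∩ C, f x = 1 := by
    rw [← Finset.prod_mul_distrib]; exact Finset.prod_eq_one fun x _ => hf x
  linear_combination -(∏ x ∈ B \ C, f x) * (∏ x ∈ C \ B, f x) * h2

theorem configChar_neighbourSymmDiff (A : Finset ℤ) (η : Config) :
    configChar (neighbourSymmDiff A) η =
      ∏ x ∈ A, (boolSign (η (x - 1)) * boolSign (η (x + 1))) := by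
  rw [configChar, neighbourSymmDiff, prod_symmDiff_of_mul_self fun x => boolSign_mul_self (η x),
    Finset.prod_map, Finset.prod_map, Finset.prod_mul_distrib]
  rfl

theorem integral_configChar_stepLaw (p : unitInterval) (A : Finset ℤ) (η : Config) :
    ∫ η', configChar A η' ∂(stepLaw p η) =
      (2 * (p : ℝ) - 1) ^ A.card * configChar (neighbourSymmDiff A) η := by
  rw [stepLaw, integral_configChar_infinitePi, configChar_neighbourSymmDiff,
    ← Finset.prod_const, ← Finset.prod_mul_distrib]
  exact Finset.prod_congr rfl fun x _ => integral_boolSign_localLaw p _ _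

/-- All nontrivial characters have mean at most `δ` in absolute value. -/
def CharBound (μ : Measure Config) (δ : ℝ) : Prop :=
  ∀ A : Finset ℤ, A.Nonempty → |∫ η, configChar A η ∂μ| ≤ δ

theorem charBound_one (μ : Measure Config) [IsProbabilityMeasure μ] : CharBound μ 1 := by
  intro A _
  refine (abs_integral_le_integral_abs).trans ?_
  simp [abs_configChar]

theorem abs_two_mul_sub_one_le (p : unitInterval) : |2 * (p : ℝ) - 1| ≤ 1 := by
  have := p.2.1; have := p.2.2
  rw [abs_le]; constructor <;> linarith

/-- One step turns the character of `A` into `(2p-1)^|A|` times that of `neighbourSymmDiff A`. This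
set is nonempty, since `max A + 1` lies in only one of the two translates, so a factor `|2p-1|` is
gained whatever `A` is. -/
theorem CharBound.bind {p : unitInterval} {μ : Measure Config} [IsProbabilityMeasure μ] {δ : ℝ}
    (h : CharBound μ δ) : CharBound (pcaKernel p ∘ₘ μ) (|2 * (p : ℝ) - 1| * δ) := by
  intro A hA
  have h1 : ∫ η, configChar A η ∂(pcaKernel p ∘ₘ μ) =
      ∫ η, ∫ η', configChar A η' ∂(pcaKernel p η) ∂μ := by
    rw [Measure.comp_eq_comp_const_apply, Kernel.integral_comp (integrable_configChar A _)]
    rfl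
  have h2 : ∀ η, ∫ η', configChar A η' ∂(pcaKernel p η) =
      (2 * (p : ℝ) - 1) ^ A.card * configChar (neighbourSymmDiff A) η :=
    fun η => integral_configChar_stepLaw p A η
  simp_rw [h1, h2]
  rw [integral_const_mul, abs_mul, abs_pow]
  refine mul_le_mul ?_ (h _ (neighbourSymmDiff_nonempty hA)) (abs_nonneg _) (abs_nonneg _)
  exact pow_le_of_le_one (abs_nonneg _) (abs_two_mul_sub_one_le p) hA.card_pos.ne'

theorem measurableSet_cylinder (S : Finset ℤ) (v : Config) :
    MeasurableSet {η : Config | ∀ x ∈ S, η x = v x} := by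
  have : SetDependsOn {η : Config | ∀ x ∈ S, η x = v x} (S : Set ℤ) := by
    intro η η' h
    simp only [Set.mem_ofPred_eq]
    exact forall₂_congr fun x hx => by rw [h x hx]
  exact this.measurableSet

theorem CharBound.nonneg {μ : Measure Config} {δ : ℝ} (h : CharBound μ δ) : 0 ≤ δ :=
  (abs_nonneg _).trans (h {0} (by simp))

/-- The indicator of a cylinder is a sum of `2^|S|` signed characters with weight `2^(-|S|)`, so the
error `δ` does not grow with `S`. Long patterns are later handled thanks to this uniformity. -/
theorem CharBound.abs_measureReal_sub_le {μ : Measure Config} [IsProbabilityMeasure μ] {δ : ℝ}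
    (h : CharBound μ δ) (S : Finset ℤ) (v : Config) :
    |μ.real {η : Config | ∀ x ∈ S, η x = v x} - (1 / 2) ^ S.card| ≤ δ := by
  have h1 : ∀ η : Config, ({η : Config | ∀ x ∈ S, η x = v x}.indicator (fun _ => (1 : ℝ))) η =
      (1 / 2) ^ S.card * ∑ A ∈ S.powerset, configChar A v * configChar A η := by
    intro η
    have h2 : ∏ x ∈ S, (1 + boolSign (v x) * boolSign (η x)) =
        ∑ A ∈ S.powerset, configChar A v * configChar A η := by
      rw [Finset.prod_one_add]
      exact Finset.sum_congr rfl fun A _ => Finset.prod_mul_distrib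
    rw [← h2, ← Finset.prod_const, ← Finset.prod_mul_distrib]
    by_cases hη : ∀ x ∈ S, η x = v x
    · rw [Set.indicator_of_mem (by exact hη)]
      symm
      refine Finset.prod_eq_one fun x hx => ?_
      rw [hη x hx, boolSign_mul_self]; norm_num
    · rw [Set.indicator_of_notMem (by exact hη)]
      push Not at hη
      obtain ⟨x, hx, hne⟩ := hη
      symm
      refine Finset.prod_eq_zero hx ?_
      revert hne
      cases η x <;> cases v x <;> simp [boolSign]
  have h3 : μ.real {η : Config | ∀ x ∈ S, η x = v x} =
      (1 / 2) ^ S.card * ∑ A ∈ S.powerset, configChar A v * ∫ η, configChar A η ∂μ := by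
    have h4 := integral_indicator_const (μ := μ) (1 : ℝ) (measurableSet_cylinder S v)
    rw [smul_eq_mul, mul_one] at h4
    rw [← h4]
    simp_rw [h1]
    rw [integral_const_mul, integral_finsetSum]
    · simp_rw [integral_const_mul]
    · exact fun A _ => (integrable_configChar A μ).const_mul _
  have h5 : ∑ A ∈ S.powerset, configChar A v * ∫ η, configChar A η ∂μ =
      1 + ∑ A ∈ S.powerset.erase ∅, configChar A v * ∫ η, configChar A η ∂μ := by
    rw [← Finset.add_sum_erase _ _ (Finset.empty_mem_powerset S)]
    simp [configChar]
  rw [h3, h5, mul_add, mul_one, add_sub_cancel_left, abs_mul, abs_of_nonneg (by positivity)]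
  have h6 : |∑ A ∈ S.powerset.erase ∅, configChar A v * ∫ η, configChar A η ∂μ| ≤
      2 ^ S.card * δ := by
    refine (Finset.abs_sum_le_sum_abs _ _).trans ?_
    calc ∑ A ∈ S.powerset.erase ∅, |configChar A v * ∫ η, configChar A η ∂μ|
        ≤ ∑ A ∈ S.powerset.erase ∅, δ := by
          refine Finset.sum_le_sum fun A hA => ?_
          rw [abs_mul, abs_configChar, one_mul]
          exact h A (Finset.nonempty_iff_ne_empty.2 (Finset.mem_erase.1 hA).1)
      _ ≤ ∑ A ∈ S.powerset, δ :=
          Finset.sum_le_sum_of_subset_of_nonneg (Finset.erase_subset _ _) fun _ _ _ => h.nonneg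
      _ = 2 ^ S.card * δ := by simp
  calc (1 / 2 : ℝ) ^ S.card * _ ≤ (1 / 2 : ℝ) ^ S.card * (2 ^ S.card * δ) := by gcongr
    _ = δ := by rw [← mul_assoc, ← mul_pow]; norm_num

/-- The uniform measure on `{0,1}^ℤ`. -/
noncomputable def uniformConfig : ProbabilityMeasure Config :=
  ⟨Measure.infinitePi fun _ : ℤ => localLaw ⟨1 / 2, by norm_num, by norm_num⟩ false false,
    inferInstance⟩

theorem charBound_uniformConfig : CharBound (uniformConfig : Measure Config) 0 := by
  intro A hA
  obtain ⟨x, hx⟩ := hA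
  refine le_of_eq (abs_eq_zero.2 ?_)
  change ∫ η, configChar A η ∂(Measure.infinitePi _) = 0
  rw [integral_configChar_infinitePi]
  refine Finset.prod_eq_zero hx ?_
  rw [integral_boolSign_localLaw]
  norm_num

theorem tendsto_uniformConfig {μ : ℕ → ProbabilityMeasure Config} {δ : ℕ → ℝ}
    (h : ∀ t, CharBound (μ t : Measure Config) (δ t)) (hδ : Tendsto δ atTop (𝓝 0)) :
    Tendsto μ atTop (𝓝 uniformConfig) := by
  let C : Set (Set Config) := {E | ∃ (S : Finset ℤ) (v : Config), E = {η | ∀ x ∈ S, η x = v x}}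
  have hC : IsPiSystem C := by
    rintro _ ⟨S, v, rfl⟩ _ ⟨S', v', rfl⟩ ⟨w, hw, hw'⟩
    refine ⟨S ∪ S', w, ?_⟩
    ext η
    simp only [Set.mem_inter_iff, Set.mem_ofPred_eq, Finset.mem_union] at hw hw' ⊢
    constructor
    · rintro ⟨h1, h2⟩ x (hx | hx)
      · rw [h1 x hx, hw x hx]
      · rw [h2 x hx, hw' x hx]
    · intro h1
      exact ⟨fun x hx => by rw [h1 x (Or.inl hx), hw x hx],
        fun x hx => by rw [h1 x (Or.inr hx), hw' x hx]⟩
  refine hC.tendsto_probabilityMeasure_of_tendsto_of_mem ?_ ?_ ?_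
  · rintro _ ⟨S, v, rfl⟩
    exact measurableSet_cylinder S v
  · intro u hu v hv
    obtain ⟨S, w, hw, hSu⟩ := isOpen_pi_iff.1 hu v hv
    refine ⟨_, ⟨S, v, rfl⟩, ?_, fun η hη => hSu fun x hx => ?_⟩
    · have : {η : Config | ∀ x ∈ S, η x = v x} = (S : Set ℤ).pi fun x => {v x} := by
        ext η; simp [Set.mem_pi]
      rw [this]
      exact (isOpen_set_pi S.finite_toSet fun x _ => isOpen_discrete _).mem_nhds (by simp)
    · rw [hη x hx]; exact (hw x hx).2
  · rintro _ ⟨S, v, rfl⟩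
    rw [← NNReal.tendsto_coe]
    have h1 : ((uniformConfig {η : Config | ∀ x ∈ S, η x = v x} : NNReal) : ℝ) = (1 / 2) ^ S.card := by
      have := charBound_uniformConfig.abs_measureReal_sub_le S v
      have h2 := abs_eq_zero.1 (le_antisymm this (abs_nonneg _))
      exact sub_eq_zero.1 h2
    rw [h1, tendsto_iff_norm_sub_tendsto_zero]
    exact squeeze_zero (fun _ => norm_nonneg _)
      (fun t => (h t).abs_measureReal_sub_le S v) hδ

theorem isErgodicPCA_pcaKernel {p : unitInterval} (h0 : 0 < (p : ℝ)) (h1 : (p : ℝ) < 1) :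
    IsErgodicPCA (pcaKernel p) := by
  refine ⟨uniformConfig, ?_, fun μ₀ => ?_⟩
  · let ν : ProbabilityMeasure Config :=
      ⟨pcaKernel p ∘ₘ (uniformConfig : Measure Config), inferInstance⟩
    have hν : CharBound (ν : Measure Config) 0 := by
      have := charBound_uniformConfig.bind (p := p)
      rwa [mul_zero] at this
    -- The image of the uniform law has vanishing nontrivial characters too, so the constant
    -- sequence converges to both: invariance is uniqueness of limits.
    have := tendsto_nhds_unique (tendsto_const_nhds (x := ν) (f := (atTop : Filter ℕ)))
      (tendsto_uniformConfig (μ := fun _ => ν) (fun _ => hν) tendsto_const_nhds)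
    exact congrArg Subtype.val this
  · have key : ∀ t, CharBound (lawAt (pcaKernel p) μ₀ t : Measure Config) (|2 * (p : ℝ) - 1| ^ t) := by
      intro t
      induction t with
      | zero => rw [pow_zero]; exact charBound_one _
      | succ t ih => rw [pow_succ']; exact ih.bind
    refine tendsto_uniformConfig key (tendsto_pow_atTop_nhds_zero_of_lt_one (abs_nonneg _) ?_)
    rw [abs_lt]; constructor <;> linarith

end Characters

/-! ### The noise of a coupling and the pattern that disturbs 2-periodic runs. -/

section Noise

/-- The deviation of `g` from addition modulo `2` of the two outer states. -/
def updateNoise (g : UpdateFn) (u : Bool × Bool × Bool) : Bool :=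
  xor (g u.1 u.2.1 u.2.2) (xor u.1 u.2.2)

/-- The states of `x` and of its neighbours. -/
def nbhd (η : Config) (x : ℤ) : Bool × Bool × Bool := (η (x - 1), η x, η (x + 1))

/-- The set of sites where two configurations differ. -/
def diff (z : Config × Config) : Config := fun x => xor (z.1 x) (z.2 x)

/-- The difference at `x` of the noises acting on two configurations. -/
def noiseDiff (g : UpdateFn) (z : Config × Config) (x : ℤ) : Bool :=
  xor (updateNoise g (nbhd z.1 x)) (updateNoise g (nbhd z.2 x))

theorem diff_globalUpdate (g : ℤ → UpdateFn) (z : Config × Config) (x : ℤ) :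
    diff (globalUpdate g z.1, globalUpdate g z.2) x =
      xor (xor (diff z (x - 1)) (diff z (x + 1))) (noiseDiff (g x) z x) := by
  simp only [diff, noiseDiff, globalUpdate, updateNoise, nbhd]
  cases z.1 (x - 1) <;> cases z.2 (x - 1) <;> cases z.1 (x + 1) <;> cases z.2 (x + 1) <;> simp

theorem xor_eq_false_iff_eq {a b : Bool} : xor a b = false ↔ a = b := by
  cases a <;> cases b <;> simp

theorem noiseDiff_eq_false {g : UpdateFn} {z : Config × Config} {x : ℤ}
    (h1 : diff z (x - 1) = false) (h2 : diff z x = false) (h3 : diff z (x + 1) = false) :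
    noiseDiff g z x = false := by
  simp only [diff, xor_eq_false_iff_eq] at h1 h2 h3
  simp [noiseDiff, nbhd, h1, h2, h3]

variable (ν : Measure UpdateFn)

/-- The probability that the noises at two given triples differ. -/
noncomputable def noiseDist (u u' : Bool × Bool × Bool) : ℝ :=
  ν.real {g | updateNoise g u ≠ updateNoise g u'}

theorem noiseDist_self (u : Bool × Bool × Bool) : noiseDist ν u u = 0 := by
  simp [noiseDist]

/-- The largest distance between the noises at two triples. -/
noncomputable def maxNoiseDist : ℝ :=
  Finset.univ.sup' Finset.univ_nonempty
    fun q : (Bool × Bool × Bool) × (Bool × Bool × Bool) => noiseDist ν q.1 q.2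

theorem noiseDist_le_max (u u' : Bool × Bool × Bool) : noiseDist ν u u' ≤ maxNoiseDist ν :=
  Finset.le_sup' (fun q : (Bool × Bool × Bool) × (Bool × Bool × Bool) => noiseDist ν q.1 q.2)
    (Finset.mem_univ (u, u'))

theorem exists_noiseDist_eq_max : ∃ u u', noiseDist ν u u' = maxNoiseDist ν := by
  obtain ⟨q, -, hq⟩ := Finset.exists_mem_eq_sup' (Finset.univ_nonempty)
    (fun q : (Bool × Bool × Bool) × (Bool × Bool × Bool) => noiseDist ν q.1 q.2)
  exact ⟨q.1, q.2, hq.symm⟩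

theorem maxNoiseDist_nonneg : 0 ≤ maxNoiseDist ν := by
  rw [← noiseDist_self ν (false, false, false)]
  exact noiseDist_le_max ν _ _

variable [IsProbabilityMeasure ν]

theorem noiseDist_triangle (u v w : Bool × Bool × Bool) :
    noiseDist ν u w ≤ noiseDist ν u v + noiseDist ν v w := by
  refine (measureReal_mono ?_).trans (measureReal_union_le _ _)
  intro g hg
  by_contra h
  simp only [Set.mem_union, Set.mem_ofPred_eq, not_or, not_not, ne_eq] at h hg
  exact hg (h.1.trans h.2)

/-- Coordinatewise addition modulo `2` of triples. -/
def tripleXor (u w : Bool × Bool × Bool) : Bool × Bool × Bool :=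
  (xor u.1 w.1, xor u.2.1 w.2.1, xor u.2.2 w.2.2)

theorem nbhd_snd (z : Config × Config) (x : ℤ) :
    nbhd z.2 x = tripleXor (nbhd z.1 x) (nbhd (diff z) x) := by
  simp [nbhd, tripleXor, diff]

/-- The triples of consecutive values of a sequence of period `4`. -/
def cyclicTriple (k : Fin 4 → Bool) (φ : Fin 4) : Bool × Bool × Bool := (k φ, k (φ + 1), k (φ + 2))

/-- Sequences of period 4 over F₂ form the ring F₂[X]/(X+1)^4, and not being 2-periodic means lying
outside the ideal of (X+1)^2. The shifts of such a sequence span at least the ideal of X+1, all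
words of even weight, which projects onto all triples. -/
theorem exists_sum_cyclicTriple : ∀ k0 k1 k2 k3 w0 w1 w2 : Bool, ¬ (k2 = k0 ∧ k3 = k1) →
    ∃ c0 c1 c2 c3 : Bool,
      w0 = xor (xor (xor (c0 && k0) (c1 && k1)) (c2 && k2)) (c3 && k3) ∧
      w1 = xor (xor (xor (c0 && k1) (c1 && k2)) (c2 && k3)) (c3 && k0) ∧
      w2 = xor (xor (xor (c0 && k2) (c1 && k3)) (c2 && k0)) (c3 && k1) := by
  decide

/-- At most four translations by cyclic triples lead from `u` to `u'`, a pair at maximal distance.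
If each cost less than a quarter of the maximum, the triangle inequality would fail. -/
theorem exists_maxNoiseDist_le {k : Fin 4 → Bool} (hk : ¬ (k 2 = k 0 ∧ k 3 = k 1)) :
    ∃ φ u, maxNoiseDist ν ≤ 4 * noiseDist ν u (tripleXor u (cyclicTriple k φ)) := by
  by_contra! hcon
  obtain ⟨u, u', hu⟩ := exists_noiseDist_eq_max ν
  obtain ⟨c0, c1, c2, c3, h0, h1, h2⟩ := exists_sum_cyclicTriple (k 0) (k 1) (k 2) (k 3)
    (xor u.1 u'.1) (xor u.2.1 u'.2.1) (xor u.2.2 u'.2.2) hk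
  have hpos : 0 < maxNoiseDist ν := by
    have := hcon 0 (false, false, false)
    have h3 : 0 ≤ noiseDist ν (false, false, false)
        (tripleXor (false, false, false) (cyclicTriple k 0)) := measureReal_nonneg
    linarith
  let adv : Bool → Fin 4 → Bool × Bool × Bool → Bool × Bool × Bool := fun c φ v =>
    if c then tripleXor v (cyclicTriple k φ) else v
  have hadv : ∀ c φ v, noiseDist ν v (adv c φ v) < maxNoiseDist ν / 4 := by
    intro c φ v
    cases c
    · simpa [adv, noiseDist_self] using hpos
    · have := hcon φ v
      simp only [adv, if_true]; linarith
  have hend : u' = adv c3 3 (adv c2 2 (adv c1 1 (adv c0 0 u))) := by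
    have e1 : u'.1 = xor u.1 (xor u.1 u'.1) := by simp
    have e2 : u'.2.1 = xor u.2.1 (xor u.2.1 u'.2.1) := by simp
    have e3 : u'.2.2 = xor u.2.2 (xor u.2.2 u'.2.2) := by simp
    rw [h0] at e1
    rw [h1] at e2
    rw [h2] at e3
    have : u' = (u'.1, u'.2.1, u'.2.2) := rfl
    rw [this, e1, e2, e3]
    have f1 : (3 : Fin 4) + 1 = 0 := rfl
    have f2 : (3 : Fin 4) + 2 = 1 := rfl
    have f3 : (2 : Fin 4) + 2 = 0 := rfl
    have f4 : (2 : Fin 4) + 1 = 3 := rfl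
    have f5 : (1 : Fin 4) + 2 = 3 := rfl
    have f6 : (1 : Fin 4) + 1 = 2 := rfl
    cases c0 <;> cases c1 <;> cases c2 <;> cases c3 <;>
      simp [adv, tripleXor, cyclicTriple, f1, f2, f3, f4, f5, f6]
  have t1 := noiseDist_triangle ν u (adv c0 0 u) u'
  have t2 := noiseDist_triangle ν (adv c0 0 u) (adv c1 1 (adv c0 0 u)) u'
  have t3 := noiseDist_triangle ν (adv c1 1 (adv c0 0 u)) (adv c2 2 (adv c1 1 (adv c0 0 u))) u'
  have s0 := hadv c0 0 u
  have s1 := hadv c1 1 (adv c0 0 u)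
  have s2 := hadv c2 2 (adv c1 1 (adv c0 0 u))
  have s3 := hadv c3 3 (adv c2 2 (adv c1 1 (adv c0 0 u)))
  rw [← hend] at s3
  linarith

/-- There is a pattern of length `128` such that, if the first configuration shows it and if `b` is
a nonzero sequence of period `2`, the next difference has at some site of the pattern a fair chance
not to coincide with `b`. -/
theorem exists_disturbing_pattern (hε : maxNoiseDist ν ≤ 1 / 2) : ∃ V : ℕ → Bool,
    ∀ (z : Config × Config) (x : ℤ) (b : Bool → Bool), (∃ i, b i = true) →
      (∀ j : ℕ, j < 128 → z.1 (x + j) = V j) →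
      ∃ y, x ≤ y ∧ y < x + 128 ∧
        ν.real {g | xor (xor (diff z (y - 1)) (diff z (y + 1))) (noiseDiff g z y) =
          b (decide (Even y))} ≤ 1 - maxNoiseDist ν / 4 := by
  have hch : ∀ k : Fin 4 → Bool, ∃ (φ : Fin 4) (u : Bool × Bool × Bool), ¬ (k 2 = k 0 ∧ k 3 = k 1) →
      maxNoiseDist ν ≤ 4 * noiseDist ν u (tripleXor u (cyclicTriple k φ)) := by
    intro k
    by_cases hk : k 2 = k 0 ∧ k 3 = k 1
    · exact ⟨0, (false, false, false), fun h => absurd hk h⟩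
    · obtain ⟨φ, u, h⟩ := exists_maxNoiseDist_le ν hk
      exact ⟨φ, u, fun _ => h⟩
  choose φ u hφu using hch
  -- One slot of length 8 for each of the 16 sequences `k`. Slots start at multiples of 4, so `k`
  -- has the same phase in all of them, and 8 leaves room for a triple starting at `φ k ≤ 3`: in all
  -- 16 · 8 = 128.
  let e : (Fin 4 → Bool) ≃ Fin 16 := Fintype.equivFinOfCardEq (by simp)
  let W : (Fin 4 → Bool) → ℕ → Bool := fun k r =>
    if r = φ k then (u k).1 else if r = φ k + 1 then (u k).2.1 else
      if r = φ k + 2 then (u k).2.2 else false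
  refine ⟨fun j => if h : j / 8 < 16 then W (e.symm ⟨j / 8, h⟩) (j % 8) else false, ?_⟩
  intro z x b hb hV
  -- Where the noiseless image already misses `b`, only a noise difference can restore it, which is
  -- unlikely. Otherwise the image is `b` throughout, and this determines the difference up to four
  -- values.
  by_cases hmis : ∃ y, x ≤ y ∧ y < x + 128 ∧
      xor (diff z (y - 1)) (diff z (y + 1)) ≠ b (decide (Even y))
  · obtain ⟨y, h1, h2, hy⟩ := hmis
    refine ⟨y, h1, h2, ?_⟩
    have h3 := noiseDist_le_max ν (nbhd z.1 y) (nbhd z.2 y)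
    refine (measureReal_mono (s₂ := {g | updateNoise g (nbhd z.1 y) ≠ updateNoise g (nbhd z.2 y)})
      ?_).trans (h3.trans (by linarith))
    intro g hg
    simp only [Set.mem_ofPred_eq, noiseDiff] at hg ⊢
    intro heq
    rw [heq, Bool.xor_self, Bool.xor_false] at hg
    exact hy hg
  · push Not at hmis
    -- Adding the equations at two sites of equal parity at distance two cancels `b` and the middle
    -- value.
    have hper : ∀ i : ℕ, i + 4 < 129 → diff z (x + (i + 4 : ℕ)) = diff z (x + i) := by
      intro i hi
      have h1 := hmis (x + i + 1) (by omega) (by omega)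
      have h2 := hmis (x + i + 3) (by omega) (by omega)
      have e0 : x + (i : ℤ) + 1 - 1 = x + i := by ring
      have e1 : x + (i : ℤ) + 1 + 1 = x + i + 2 := by ring
      have e2 : x + (i : ℤ) + 3 - 1 = x + i + 2 := by ring
      have e3 : x + (i : ℤ) + 3 + 1 = x + (i + 4 : ℕ) := by push_cast; ring
      have e4 : decide (Even (x + (i : ℤ) + 3)) = decide (Even (x + i + 1)) := by
        congr 1
        rw [show x + (i : ℤ) + 3 = (x + i + 1) + 2 by ring]
        simp [parity_simps]
      rw [e0, e1] at h1
      rw [e2, e3, e4, ← h1] at h2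
      revert h2
      cases diff z (x + i) <;> cases diff z (x + (i + 4 : ℕ)) <;> cases diff z (x + i + 2) <;> simp
    let k : Fin 4 → Bool := fun j => diff z (x + (j : ℕ))
    have hk : ∀ i : ℕ, i < 129 → diff z (x + i) = k ⟨i % 4, Nat.mod_lt _ (by norm_num)⟩ := by
      intro i
      induction i using Nat.strong_induction_on with
      | _ i ih =>
        intro hi
        by_cases h4 : i < 4
        · simp only [k, Nat.mod_eq_of_lt h4]
        · obtain ⟨j, rfl⟩ : ∃ j, i = j + 4 := ⟨i - 4, by omega⟩
          rw [hper j hi, ih j (by omega) (by omega)]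
          simp
    -- A 2-periodic difference would have image zero, whereas `b` is nonzero.
    have hkne : ¬ (k 2 = k 0 ∧ k 3 = k 1) := by
      rintro ⟨hk1, hk2⟩
      have h1 := hmis (x + 1) (by omega) (by omega)
      have h2 := hmis (x + 2) (by omega) (by omega)
      have e0 : x + 1 - 1 = x + ((0 : Fin 4) : ℕ) := by simp
      have e1 : x + 1 + 1 = x + ((2 : Fin 4) : ℕ) := by simp; ring
      have e2 : x + 2 - 1 = x + ((1 : Fin 4) : ℕ) := by simp; ring
      have e3 : x + 2 + 1 = x + ((3 : Fin 4) : ℕ) := by simp; ring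
      rw [e0, e1] at h1
      rw [e2, e3] at h2
      change xor (k 0) (k 2) = _ at h1
      change xor (k 1) (k 3) = _ at h2
      rw [hk1, Bool.xor_self] at h1
      rw [hk2, Bool.xor_self] at h2
      obtain ⟨i, hi⟩ := hb
      by_cases hx : Even x
      · have f1 : ¬ Even (x + 1) := by simp [parity_simps, hx]
        have f2 : Even (x + 2) := by simp [parity_simps, hx]
        simp only [f1, f2, decide_false, decide_true] at h1 h2
        cases i
        · rw [hi] at h1; simp at h1
        · rw [hi] at h2; simp at h2
      · have f1 : Even (x + 1) := by simpa [parity_simps] using hx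
        have f2 : ¬ Even (x + 2) := by simpa [parity_simps] using hx
        simp only [f1, f2, decide_false, decide_true] at h1 h2
        cases i
        · rw [hi] at h2; simp at h2
        · rw [hi] at h1; simp at h1
    have hq := (e k).2
    have hφ := (φ k).2
    set q : ℕ := (e k : ℕ) with hq'
    set f : ℕ := (φ k : ℕ) with hf'
    refine ⟨x + (8 * q + f + 1 : ℕ), by omega, by omega, ?_⟩
    set y : ℤ := x + (8 * q + f + 1 : ℕ) with hy
    have hVW : ∀ r : ℕ, r < 8 → z.1 (x + (8 * q + r : ℕ)) = W k r := by
      intro r hr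
      rw [hV _ (by omega)]
      have h1 : (8 * q + r) / 8 = q := by omega
      have h2 : (8 * q + r) % 8 = r := by omega
      simp only [h1, h2, hq, dif_pos]
      rw [show (⟨q, hq⟩ : Fin 16) = e k from rfl, e.symm_apply_apply]
    have hn1 : nbhd z.1 y = u k := by
      have a1 : y - 1 = x + (8 * q + f : ℕ) := by rw [hy]; push_cast; ring
      have a2 : y = x + (8 * q + (f + 1) : ℕ) := by rw [hy]; push_cast; ring
      have a3 : y + 1 = x + (8 * q + (f + 2) : ℕ) := by rw [hy]; push_cast; ring
      have b1 := hVW f (by omega)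
      have b2 := hVW (f + 1) (by omega)
      have b3 := hVW (f + 2) (by omega)
      rw [← a1] at b1
      rw [← a2] at b2
      rw [← a3] at b3
      rw [nbhd, b1, b2, b3]
      simp [W, ← hf']
    have hn2 : nbhd (diff z) y = cyclicTriple k (φ k) := by
      have a1 : y - 1 = x + (8 * q + f : ℕ) := by rw [hy]; push_cast; ring
      have a2 : y = x + (8 * q + (f + 1) : ℕ) := by rw [hy]; push_cast; ring
      have a3 : y + 1 = x + (8 * q + (f + 2) : ℕ) := by rw [hy]; push_cast; ring
      have b1 := hk (8 * q + f) (by omega)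
      have b2 := hk (8 * q + (f + 1)) (by omega)
      have b3 := hk (8 * q + (f + 2)) (by omega)
      rw [← a1] at b1
      rw [← a2] at b2
      rw [← a3] at b3
      rw [nbhd, b1, b2, b3, cyclicTriple]
      have c1 : (⟨(8 * q + f) % 4, Nat.mod_lt _ (by norm_num)⟩ : Fin 4) = φ k := by
        ext; simp only [← hf']; omega
      have c2 : (⟨(8 * q + (f + 1)) % 4, Nat.mod_lt _ (by norm_num)⟩ : Fin 4) = φ k + 1 := by
        ext; rw [Fin.val_add]; simp only [← hf', Fin.val_one]; omega
      have c3 : (⟨(8 * q + (f + 2)) % 4, Nat.mod_lt _ (by norm_num)⟩ : Fin 4) = φ k + 2 := by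
        ext; rw [Fin.val_add]; simp only [← hf', Fin.val_two]; omega
      rw [c1, c2, c3]
    have hmax := hφu k hkne
    have hn3 : nbhd z.2 y = tripleXor (u k) (cyclicTriple k (φ k)) := by rw [nbhd_snd, hn1, hn2]
    have hset : {g | xor (xor (diff z (y - 1)) (diff z (y + 1))) (noiseDiff g z y) =
        b (decide (Even y))} =
        {g | updateNoise g (u k) ≠ updateNoise g (tripleXor (u k) (cyclicTriple k (φ k)))}ᶜ := by
      ext g
      simp only [Set.mem_ofPred_eq, Set.mem_compl_iff, not_not, ne_eq,
        hmis y (by omega) (by omega), noiseDiff, hn1, hn3]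
      cases b (decide (Even y)) <;> simp
    rw [hset, probReal_compl_eq_one_sub (Set.toFinite _).measurableSet]
    unfold noiseDist at hmax
    linarith

end Noise

/-! ### Pair processes driven by an i.i.d. environment. -/

section Environment

/-- The update functions of all space-time sites. -/
abbrev Env : Type := ℤ × ℕ → UpdateFn

/-- The law of i.i.d. update functions with common law `ν`. -/
noncomputable abbrev envLaw (ν : Measure UpdateFn) [IsProbabilityMeasure ν] : Measure Env :=
  Measure.infinitePi fun _ => ν

/-- The sites of times `< s`. -/
def before (s : ℕ) : Set (ℤ × ℕ) := {i | i.2 < s}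

/-- The value of `f` only depends on the environment at times `< s`. -/
def IsAdapted {β : Type*} (f : Env → β) (s : ℕ) : Prop :=
  ∀ ω ω' : Env, (∀ i ∈ before s, ω i = ω' i) → f ω = f ω'

theorem IsAdapted.setDependsOn {β : Type*} {f : Env → β} {s : ℕ} (h : IsAdapted f s) (S : Set β) :
    SetDependsOn {ω | f ω ∈ S} (before s) := fun ω ω' hω => by
  simp only [Set.mem_ofPred_eq, h ω ω' hω]

theorem IsAdapted.comp {β γ : Type*} {f : Env → β} {s : ℕ} (h : IsAdapted f s) (g : β → γ) :
    IsAdapted (fun ω => g (f ω)) s := fun ω ω' hω => congrArg g (h ω ω' hω)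

theorem IsAdapted.mono {β : Type*} {f : Env → β} {s t : ℕ} (h : IsAdapted f s) (hst : s ≤ t) :
    IsAdapted f t := fun ω ω' hω => h ω ω' fun i hi => hω i (lt_of_lt_of_le hi hst)

theorem measurable_of_dependsOn {ι α β : Type*} [MeasurableSpace α] [DiscreteMeasurableSpace α]
    [Finite α] [MeasurableSpace β] {f : (ι → α) → β} (I : Finset ι)
    (h : ∀ ω ω' : ι → α, (∀ i ∈ I, ω i = ω' i) → f ω = f ω') : Measurable f := by
  intro S _
  refine SetDependsOn.measurableSet (I := I) fun ω ω' hω => ?_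
  rw [Set.mem_preimage, Set.mem_preimage, h ω ω' hω]

/-- Two coupled configurations, depending on the environment at earlier times; the first one is
updated from time `a₁` on and the second one from time `a₂` on. -/
structure IsPairProcess (Z : ℕ → Env → Config × Config) (a₁ a₂ : ℕ) : Prop where
  measurable : ∀ s, Measurable (Z s)
  adapted : ∀ s, IsAdapted (Z s) s
  step₁ : ∀ s, a₁ ≤ s → ∀ ω, (Z (s + 1) ω).1 = globalUpdate (fun x => ω (x, s)) (Z s ω).1
  step₂ : ∀ s, a₂ ≤ s → ∀ ω, (Z (s + 1) ω).2 = globalUpdate (fun x => ω (x, s)) (Z s ω).2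

theorem IsPairProcess.isNoisyRule {Z : ℕ → Env → Config × Config} {a : ℕ}
    (h : IsPairProcess Z a a) (ω : Env) :
    IsNoisyRule a (fun s => diff (Z s ω)) (fun s x => noiseDiff (ω (x, s)) (Z s ω) x) where
  step s hs x := by
    have : Z (s + 1) ω = (globalUpdate (fun x => ω (x, s)) (Z s ω).1,
        globalUpdate (fun x => ω (x, s)) (Z s ω).2) :=
      Prod.ext (h.step₁ s hs ω) (h.step₂ s hs ω)
    simp only [this]
    exact diff_globalUpdate (fun x => ω (x, s)) (Z s ω) x
  quiet s _ x h1 h2 h3 := noiseDiff_eq_false h1 h2 h3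

theorem IsPairProcess.mono {Z : ℕ → Env → Config × Config} {a₁ a₂ b₁ b₂ : ℕ}
    (h : IsPairProcess Z a₁ a₂) (h₁ : a₁ ≤ b₁) (h₂ : a₂ ≤ b₂) : IsPairProcess Z b₁ b₂ :=
  ⟨h.measurable, h.adapted, fun s hs => h.step₁ s (h₁.trans hs), fun s hs => h.step₂ s (h₂.trans hs)⟩

theorem measurable_diff : Measurable diff := by
  refine measurable_pi_lambda _ fun x => ?_
  have h : Measurable fun z : Config × Config => (z.1 x, z.2 x) :=
    ((measurable_pi_apply x).comp measurable_fst).prodMk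
      ((measurable_pi_apply x).comp measurable_snd)
  exact (measurable_of_finite fun q : Bool × Bool => xor q.1 q.2).comp h

theorem measurable_noiseDiff {Z : Env → Config × Config} (hZ : Measurable Z) (x : ℤ) (s : ℕ) :
    Measurable fun ω : Env => noiseDiff (ω (x, s)) (Z ω) x := by
  have h1 : ∀ y, Measurable fun ω => (Z ω).1 y := fun y =>
    (measurable_pi_apply y).comp (measurable_fst.comp hZ)
  have h2 : ∀ y, Measurable fun ω => (Z ω).2 y := fun y =>
    (measurable_pi_apply y).comp (measurable_snd.comp hZ)
  have h3 : Measurable fun ω : Env => (ω (x, s), nbhd (Z ω).1 x, nbhd (Z ω).2 x) :=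
    (measurable_pi_apply _).prodMk
      (((h1 _).prodMk ((h1 _).prodMk (h1 _))).prodMk ((h2 _).prodMk ((h2 _).prodMk (h2 _))))
  exact (measurable_of_countable fun q : UpdateFn × (Bool × Bool × Bool) × (Bool × Bool × Bool) =>
    xor (updateNoise q.1 q.2.1) (updateNoise q.1 q.2.2)).comp h3

theorem measurableSet_noiseDiff {Z : Env → Config × Config} (hZ : Measurable Z) {Y : Env → ℤ}
    (hY : Measurable Y) (s : ℕ) :
    MeasurableSet {ω : Env | noiseDiff (ω (Y ω, s)) (Z ω) (Y ω) = true} := by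
  have : {ω : Env | noiseDiff (ω (Y ω, s)) (Z ω) (Y ω) = true} =
      ⋃ y, Y ⁻¹' {y} ∩ (fun ω : Env => noiseDiff (ω (y, s)) (Z ω) y) ⁻¹' {true} := by
    ext ω; simp
  rw [this]
  exact MeasurableSet.iUnion fun y =>
    (hY (measurableSet_singleton y)).inter (measurable_noiseDiff hZ y s (measurableSet_singleton _))

variable (ν : Measure UpdateFn) [IsProbabilityMeasure ν]

theorem envLaw_eval (i : ℤ × ℕ) (G : Set UpdateFn) : (envLaw ν).real {ω | ω i ∈ G} = ν.real G := by
  have := (measurePreserving_eval_infinitePi (fun _ : ℤ × ℕ => ν) i).measure_preimage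
    (Set.toFinite G).measurableSet.nullMeasurableSet
  exact congrArg ENNReal.toReal this

theorem noiseDiff_eq_true_iff {g : UpdateFn} {z : Config × Config} {x : ℤ} :
    noiseDiff g z x = true ↔ updateNoise g (nbhd z.1 x) ≠ updateNoise g (nbhd z.2 x) := by
  simp [noiseDiff]

theorem envLaw_noiseDiff_le (z : Config × Config) (x : ℤ) (s : ℕ) :
    (envLaw ν).real {ω | noiseDiff (ω (x, s)) z x = true} ≤ maxNoiseDist ν := by
  refine (envLaw_eval ν (x, s) {g | noiseDiff g z x = true}).trans_le ?_
  simp only [noiseDiff_eq_true_iff]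
  exact noiseDist_le_max ν _ _

/-- Given the environment before `s`, the site and both configurations are fixed, while the update
function at time `s` is fresh. -/
theorem envLaw_inter_noiseDiff_le {Z : Env → Config × Config} {Y : Env → ℤ} {A : Set Env} {s : ℕ}
    (hZ : Measurable Z) (hZa : IsAdapted Z s) (hY : Measurable Y) (hYa : IsAdapted Y s)
    (hA : MeasurableSet A) (hAa : SetDependsOn A (before s)) :
    (envLaw ν).real (A ∩ {ω | noiseDiff (ω (Y ω, s)) (Z ω) (Y ω) = true}) ≤
      maxNoiseDist ν * (envLaw ν).real A := by
  refine measureReal_inter_le_of_section ν (before s) hA hAa (measurableSet_noiseDiff hZ hY s) ?_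
  intro ω _
  refine (measureReal_mono ?_).trans (envLaw_noiseDiff_le ν (Z ω) (Y ω) s)
  rintro ω' ⟨ω'', h1, h2, h3⟩
  simp only [Set.mem_ofPred_eq] at h1 ⊢
  rw [hZa ω'' ω h2, hYa ω'' ω h2, h3 _ (by simp [before])] at h1
  exact h1

theorem envLaw_noiseDiff_adapted_le {Z : Env → Config × Config} {Y : Env → ℤ} {s : ℕ}
    (hZ : Measurable Z) (hZa : IsAdapted Z s) (hY : Measurable Y) (hYa : IsAdapted Y s) :
    (envLaw ν).real {ω | noiseDiff (ω (Y ω, s)) (Z ω) (Y ω) = true} ≤ maxNoiseDist ν := by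
  simpa using envLaw_inter_noiseDiff_le ν hZ hZa hY hYa MeasurableSet.univ
    (fun _ _ _ => Iff.rfl)

theorem envLaw_noiseDiff_pair_le {Z : Env → Config × Config} {Y Y' : Env → ℤ} {s : ℕ}
    (hZ : Measurable Z) (hZa : IsAdapted Z s) (hY : Measurable Y) (hYa : IsAdapted Y s)
    (hY' : Measurable Y') (hYa' : IsAdapted Y' s) :
    (envLaw ν).real {ω | Y ω ≠ Y' ω ∧ noiseDiff (ω (Y ω, s)) (Z ω) (Y ω) = true ∧
      noiseDiff (ω (Y' ω, s)) (Z ω) (Y' ω) = true} ≤ maxNoiseDist ν ^ 2 := by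
  refine measureReal_le_of_section ν (before s) ?_ ?_
  · have hne : MeasurableSet {ω | Y ω ≠ Y' ω} := (measurableSet_eq_fun hY hY').compl
    exact hne.inter ((measurableSet_noiseDiff hZ hY s).inter (measurableSet_noiseDiff hZ hY' s))
  · intro ω
    by_cases hne : Y ω = Y' ω
    · refine le_trans (le_of_eq ?_) (sq_nonneg _)
      convert measureReal_empty (μ := envLaw ν)
      ext ω'
      simp only [Set.mem_ofPred_eq, Set.mem_empty_iff_false, iff_false, not_exists]
      rintro ω'' ⟨⟨h0, -⟩, h2, -⟩
      rw [hYa ω'' ω h2, hYa' ω'' ω h2] at h0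
      exact h0 hne
    · let S : Finset ℤ := {Y ω, Y' ω}
      have hc : S.card = 2 := Finset.card_pair hne
      have hp := measureReal_biInter_le_pow ν S (fun y => ({(y, s)} : Set (ℤ × ℕ)))
        (fun y => {ω' | noiseDiff (ω' (y, s)) (Z ω) y = true})
        (fun y _ => measurableSet_noiseDiff (measurable_const (a := Z ω)) measurable_const s)
        (fun y _ ω₁ ω₂ h => by
          simp only [Set.mem_singleton_iff, forall_eq] at h
          simp only [Set.mem_ofPred_eq, h])
        (fun y _ y' _ hyy => Set.disjoint_singleton.2 fun h => hyy (Prod.ext_iff.1 h).1)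
        (maxNoiseDist_nonneg ν) (fun y _ => envLaw_noiseDiff_le ν (Z ω) y s)
      rw [hc] at hp
      refine (measureReal_mono ?_).trans hp
      rintro ω' ⟨ω'', ⟨-, h1, h1'⟩, h2, h3⟩
      rw [hZa ω'' ω h2, hYa ω'' ω h2, h3 _ (by simp [before])] at h1
      rw [hZa ω'' ω h2, hYa' ω'' ω h2, h3 _ (by simp [before])] at h1'
      simp only [Set.mem_iInter, S, Finset.mem_insert, Finset.mem_singleton]
      rintro y (rfl | rfl)
      · exact h1
      · exact h1'

theorem map_globalUpdate_const {p : unitInterval}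
    (hν : ∀ a b c, ν.map (fun g : UpdateFn => g a b c) = localLaw p a c) (η : Config) (s : ℕ) :
    (envLaw ν).map (fun ω => globalUpdate (fun x => ω (x, s)) η) = stepLaw p η := by
  have h1 := measurePreserving_reindex ν (σ := fun x : ℤ => (x, s))
    (fun x y h => (Prod.ext_iff.1 h).1)
  have h2 := Measure.infinitePi_map_pi (fun _ : ℤ => ν)
    (f := fun (x : ℤ) (g : UpdateFn) => g (η (x - 1)) (η x) (η (x + 1)))
    (fun x => measurable_of_finite _)
  simp_rw [hν] at h2
  rw [stepLaw, ← h2, ← h1.map_eq, Measure.map_map _ h1.measurable]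
  · rfl
  · exact measurable_pi_lambda _ fun x => (measurable_of_finite
      fun g : UpdateFn => g (η (x - 1)) (η x) (η (x + 1))).comp (measurable_pi_apply x)

theorem measurable_globalUpdate {X : Env → Config} (hX : Measurable X) {s : ℕ} :
    Measurable fun ω : Env => globalUpdate (fun x => ω (x, s)) (X ω) := by
  refine measurable_pi_lambda _ fun x => ?_
  have h1 : ∀ y, Measurable fun ω => X ω y := fun y => (measurable_pi_apply y).comp hX
  have h3 : Measurable fun ω : Env => (ω (x, s), X ω (x - 1), X ω x, X ω (x + 1)) :=
    (measurable_pi_apply _).prodMk ((h1 _).prodMk ((h1 _).prodMk (h1 _)))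
  exact (measurable_of_countable fun q : UpdateFn × Bool × Bool × Bool =>
    q.1 q.2.1 q.2.2.1 q.2.2.2).comp h3

theorem map_globalUpdate {p : unitInterval}
    (hν : ∀ a b c, ν.map (fun g : UpdateFn => g a b c) = localLaw p a c) {X : Env → Config} {s : ℕ}
    (hX : Measurable X) (hXa : IsAdapted X s) :
    (envLaw ν).map (fun ω => globalUpdate (fun x => ω (x, s)) (X ω)) =
      pcaKernel p ∘ₘ ((envLaw ν).map X) := by
  classical
  have hm := measurable_globalUpdate hX (s := s)
  ext E hE
  have hp := measurePreserving_piecewise ν (before s)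
  have hE' := hm hE
  rw [Measure.map_apply hm hE, Measure.bind_apply hE (pcaKernel p).aemeasurable,
    lintegral_map ((pcaKernel p).measurable_coe hE) hX, ← hp.measure_preimage hE'.nullMeasurableSet,
    Measure.prod_apply (hp.measurable hE')]
  refine lintegral_congr fun ω => ?_
  change _ = stepLaw p (X ω) E
  rw [← map_globalUpdate_const ν hν (X ω) s, Measure.map_apply
    (measurable_globalUpdate measurable_const) hE]
  congr 1
  ext ω'
  simp only [Set.mem_preimage]
  rw [hXa ((before s).piecewise ω ω') ω fun i hi => Set.piecewise_eq_of_mem _ _ _ hi]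
  have : (fun x : ℤ => (before s).piecewise ω ω' (x, s)) = fun x => ω' (x, s) := by
    ext1 x; exact Set.piecewise_eq_of_notMem _ _ _ (by simp [before])
  rw [this]

/-- The law at time `a₁` is arbitrary, so the bound can be restarted after conditioning on the past.
Only the first copy needs it. -/
theorem IsPairProcess.charBound {p : unitInterval}
    (hν : ∀ a b c, ν.map (fun g : UpdateFn => g a b c) = localLaw p a c)
    {Z : ℕ → Env → Config × Config} {a₁ a₂ : ℕ} (h : IsPairProcess Z a₁ a₂) (t : ℕ) :
    CharBound ((envLaw ν).map fun ω => (Z (a₁ + t) ω).1) (|2 * (p : ℝ) - 1| ^ t) := by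
  have hm : ∀ s, Measurable fun ω => (Z s ω).1 := fun s => measurable_fst.comp (h.measurable s)
  have hprob : ∀ s, IsProbabilityMeasure ((envLaw ν).map fun ω => (Z s ω).1) := fun s =>
    Measure.isProbabilityMeasure_map (hm s).aemeasurable
  induction t with
  | zero => rw [pow_zero]; exact charBound_one _
  | succ t ih =>
    have h1 : (fun ω => (Z (a₁ + (t + 1)) ω).1) =
        fun ω => globalUpdate (fun x => ω (x, a₁ + t)) (Z (a₁ + t) ω).1 := by
      ext1 ω; exact h.step₁ (a₁ + t) (by omega) ω
    rw [h1, map_globalUpdate ν hν (hm _) ((h.adapted _).comp Prod.fst), pow_succ']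
    exact ih.bind

end Environment

/-! ### Long 2-periodic runs of the difference are unlikely. -/

section Runs

variable (ν : Measure UpdateFn) [IsProbabilityMeasure ν]

/-- Expand over the sets `S` of windows: showing `V` on all of `S` has probability `2^(-128|S|)` up
to `δ₀`. Main terms and errors resum separately by the binomial formula. -/
theorem integral_prod_one_sub_le {μ : Measure Config} [IsProbabilityMeasure μ] {δ₀ δ : ℝ}
    (h : CharBound μ δ₀) (hδ : 0 ≤ δ) (x : ℤ) (B : ℕ) (V : ℕ → Bool) :
    ∫ η, ∏ i ∈ Finset.range B,
        (1 + {η : Config | ∀ j : ℕ, j < 128 → η (x + (128 * i + j : ℕ)) = V j}.indicator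
          (fun _ => -δ) η) ∂μ ≤ (1 - δ * (1 / 2) ^ 128) ^ B + δ₀ * (1 + δ) ^ B := by
  classical
  let T : Finset ℕ → Finset ℤ := fun S => (S ×ˢ Finset.range 128).image
    fun q => x + (128 * q.1 + q.2 : ℕ)
  have hT : ∀ S, (T S).card = 128 * S.card := by
    intro S
    rw [Finset.card_image_of_injOn, Finset.card_product, Finset.card_range, mul_comm]
    rintro ⟨a, b⟩ hab ⟨a', b'⟩ hab' heq
    simp only [Finset.coe_product, Set.mem_prod, Finset.coe_range, Set.mem_Iio] at hab hab' heq
    have : 128 * a + b = 128 * a' + b' := by exact_mod_cast add_left_cancel heq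
    ext <;> simp only <;> omega
  let v : Config := fun y => V ((y - x).toNat % 128)
  have hexp : ∀ η : Config, ∏ i ∈ Finset.range B,
        (1 + {η : Config | ∀ j : ℕ, j < 128 → η (x + (128 * i + j : ℕ)) = V j}.indicator
          (fun _ => -δ) η) = ∑ S ∈ (Finset.range B).powerset,
          {η : Config | ∀ y ∈ T S, η y = v y}.indicator (fun _ => (-δ) ^ S.card) η := by
    intro η
    rw [Finset.prod_one_add]
    refine Finset.sum_congr rfl fun S _ => ?_
    by_cases hη : ∀ i ∈ S, ∀ j : ℕ, j < 128 → η (x + (128 * i + j : ℕ)) = V j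
    · rw [Set.indicator_of_mem, ← Finset.prod_const]
      · exact Finset.prod_congr rfl fun i hi => Set.indicator_of_mem (by exact hη i hi) _
      · intro y hy
        obtain ⟨q, hq, rfl⟩ := Finset.mem_image.1 hy
        obtain ⟨hq1, hq2⟩ := Finset.mem_product.1 hq
        rw [hη _ hq1 _ (Finset.mem_range.1 hq2)]
        simp only [v]
        congr 1
        have := Finset.mem_range.1 hq2
        rw [add_sub_cancel_left, Int.toNat_natCast]
        omega
    · rw [Set.indicator_of_notMem]
      · push Not at hη
        obtain ⟨i, hi, j, hj, hne⟩ := hη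
        refine Finset.prod_eq_zero hi (Set.indicator_of_notMem ?_ _)
        exact fun hcon : ∀ j : ℕ, j < 128 → η (x + (128 * i + j : ℕ)) = V j => hne (hcon j hj)
      · intro hcon
        apply hη
        intro i hi j hj
        rw [hcon _ (Finset.mem_image.2 ⟨(i, j), Finset.mem_product.2
          ⟨hi, Finset.mem_range.2 hj⟩, rfl⟩)]
        simp only [v]
        congr 1
        rw [add_sub_cancel_left, Int.toNat_natCast]
        omega
  simp_rw [hexp]
  rw [integral_finsetSum]
  swap
  · exact fun S _ => (integrable_const _).indicator (measurableSet_cylinder _ _)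
  have hterm : ∀ S ∈ (Finset.range B).powerset,
      ∫ η, {η : Config | ∀ y ∈ T S, η y = v y}.indicator (fun _ => (-δ) ^ S.card) η ∂μ ≤
        (-(δ * (1 / 2) ^ 128)) ^ S.card + δ₀ * δ ^ S.card := by
    intro S _
    rw [integral_indicator_const _ (measurableSet_cylinder _ _), smul_eq_mul]
    have h1 := h.abs_measureReal_sub_le (T S) v
    rw [hT] at h1
    set P := μ.real {η : Config | ∀ y ∈ T S, η y = v y}
    have h2 : P * (-δ) ^ S.card = (-(δ * (1 / 2) ^ 128)) ^ S.card +
        (P - (1 / 2) ^ (128 * S.card)) * (-δ) ^ S.card := by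
      rw [pow_mul, sub_mul, neg_mul_eq_neg_mul, mul_pow]; ring
    rw [h2]
    refine add_le_add le_rfl ((le_abs_self _).trans ?_)
    rw [abs_mul, abs_pow, abs_neg, abs_of_nonneg hδ]
    gcongr
  refine (Finset.sum_le_sum hterm).trans (le_of_eq ?_)
  rw [Finset.sum_add_distrib, ← Finset.mul_sum]
  have h3 : ∀ r : ℝ, ∑ S ∈ (Finset.range B).powerset, r ^ S.card = (1 + r) ^ B := by
    intro r
    have := Finset.prod_one_add (f := fun _ : ℕ => r) (Finset.range B)
    simp only [Finset.prod_const, Finset.card_range] at this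
    exact this.symm
  rw [h3, h3, sub_eq_add_neg]

/-- Given the past, each window where the first copy shows `V` contains a site at which the next
difference misses `b` with probability at least `δ`, independently over windows. The conditional
probability of following `b` is thus at most `1 - δ` to the number of such windows, whose mean is
bounded by `integral_prod_one_sub_le`. The factor 3 counts the nonzero `b`. -/
theorem IsPairProcess.measureReal_hasRun_le {Z : ℕ → Env → Config × Config} {s : ℕ} {δ₀ : ℝ}
    (h : IsPairProcess Z s s) (hδ₀ : CharBound ((envLaw ν).map fun ω => (Z s ω).1) δ₀)
    (hε : maxNoiseDist ν ≤ 1 / 2) (x : ℤ) (B : ℕ) :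
    (envLaw ν).real {ω | HasRun (diff (Z (s + 1) ω)) x (128 * B)} ≤
      3 * ((1 - maxNoiseDist ν / 4 * (1 / 2) ^ 128) ^ B + δ₀ * (1 + maxNoiseDist ν / 4) ^ B) := by
  classical
  have hε0 := maxNoiseDist_nonneg ν
  obtain ⟨V, hV⟩ := exists_disturbing_pattern ν hε
  set δ := maxNoiseDist ν / 4 with hδ
  let good : ℕ → Set Config := fun i => {η | ∀ j : ℕ, j < 128 → η (x + (128 * i + j : ℕ)) = V j}
  have hgm : ∀ i, MeasurableSet (good i) := fun i => by
    refine SetDependsOn.measurableSet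
      (I := (Finset.range 128).image fun j => x + (128 * i + j : ℕ)) fun η η' hη => ?_
    refine forall₂_congr fun j hj => ?_
    rw [hη _ (Finset.mem_image.2 ⟨j, Finset.mem_range.2 hj, rfl⟩)]
  have hmZ : Measurable fun ω => (Z s ω).1 := measurable_fst.comp (h.measurable s)
  have hmZ' : Measurable fun ω => diff (Z (s + 1) ω) := measurable_diff.comp (h.measurable _)
  have : IsProbabilityMeasure ((envLaw ν).map fun ω => (Z s ω).1) :=
    Measure.isProbabilityMeasure_map hmZ.aemeasurable
  let run : (Bool → Bool) → Set Config := fun b =>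
    {D | ∀ y, x ≤ y → y < x + (128 * B : ℕ) → D y = b (decide (Even y))}
  have hrm : ∀ b, MeasurableSet (run b) := fun b => by
    refine SetDependsOn.measurableSet (I := Finset.Ico x (x + (128 * B : ℕ))) fun D D' h => ?_
    refine forall_congr' fun y => forall_congr' fun h1 => forall_congr' fun h2 => ?_
    rw [h y (Finset.mem_Ico.2 ⟨h1, h2⟩)]
  have key : ∀ b : Bool → Bool, (∃ i, b i = true) →
      (envLaw ν).real ((fun ω => diff (Z (s + 1) ω)) ⁻¹' run b) ≤
        (1 - δ * (1 / 2) ^ 128) ^ B + δ₀ * (1 + δ) ^ B := by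
    intro b hb
    have hφm : Measurable fun η : Config => ∏ i ∈ Finset.range B,
        (1 + (good i).indicator (fun _ => -δ) η) :=
      Finset.measurable_prod _ fun i _ =>
        measurable_const.add (measurable_const.indicator (hgm i))
    have hbd : ∀ (i : ℕ) (η : Config), 0 ≤ 1 + (good i).indicator (fun _ => -δ) η ∧
        1 + (good i).indicator (fun _ => -δ) η ≤ 1 := by
      intro i η
      by_cases hη : η ∈ good i
      · rw [Set.indicator_of_mem hη]; constructor <;> linarith
      · rw [Set.indicator_of_notMem hη]; constructor <;> linarith
    have hint : Integrable (fun η : Config => ∏ i ∈ Finset.range B,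
        (1 + (good i).indicator (fun _ => -δ) η)) ((envLaw ν).map fun ω => (Z s ω).1) := by
      refine Integrable.of_bound hφm.aestronglyMeasurable 1 (Eventually.of_forall fun η => ?_)
      rw [Real.norm_eq_abs, abs_of_nonneg (Finset.prod_nonneg fun i _ => (hbd i η).1)]
      exact Finset.prod_le_one (fun i _ => (hbd i η).1) fun i _ => (hbd i η).2
    refine le_trans ?_ (integral_prod_one_sub_le hδ₀ (by positivity : 0 ≤ δ) x B V)
    rw [integral_map hmZ.aemeasurable hφm.aestronglyMeasurable]
    refine measureReal_le_integral_of_section ν (before s) (hmZ' (hrm b))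
      (hint.comp_measurable hmZ) fun ω => ?_
    let S := (Finset.range B).filter fun i => (Z s ω).1 ∈ good i
    have hex : ∀ i, ∃ y, i ∈ S → x + 128 * i ≤ y ∧ y < x + 128 * i + 128 ∧
        ν.real {g | xor (xor (diff (Z s ω) (y - 1)) (diff (Z s ω) (y + 1)))
          (noiseDiff g (Z s ω) y) = b (decide (Even y))} ≤ 1 - δ := by
      intro i
      by_cases hi : i ∈ S
      · have hgi : (Z s ω).1 ∈ good i := (Finset.mem_filter.1 hi).2
        obtain ⟨y, h1, h2, h3⟩ := hV (Z s ω) (x + 128 * i) b hb fun j hj => by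
          have := hgi j hj
          push_cast at this
          rw [add_assoc]; exact this
        exact ⟨y, fun _ => ⟨h1, h2, h3⟩⟩
      · exact ⟨0, fun h => absurd h hi⟩
    choose y hy using hex
    have hp := measureReal_biInter_le_pow ν S (fun i => ({(y i, s)} : Set (ℤ × ℕ)))
      (fun i => {ω' | ω' (y i, s) ∈ {g | xor (xor (diff (Z s ω) (y i - 1)) (diff (Z s ω) (y i + 1)))
          (noiseDiff g (Z s ω) (y i)) = b (decide (Even (y i)))}})
      (fun i _ => measurable_pi_apply (y i, s) (Set.toFinite _).measurableSet)
      (fun i _ ω₁ ω₂ h => by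
        simp only [Set.mem_singleton_iff, forall_eq] at h
        simp only [Set.mem_ofPred_eq, h])
      (fun i hi j hj hij => Set.disjoint_singleton.2 fun h => by
        have h1 := hy i hi
        have h2 := hy j hj
        have h3 : y i = y j := (Prod.ext_iff.1 h).1
        have : (i : ℤ) ≠ j := by exact_mod_cast hij
        omega)
      (by linarith : 0 ≤ 1 - δ) (fun i hi => by rw [envLaw_eval]; exact (hy i hi).2.2)
    have hprod : ∏ i ∈ Finset.range B, (1 + (good i).indicator (fun _ => -δ) (Z s ω).1) =
        (1 - δ) ^ S.card := by
      rw [← Finset.prod_const, Finset.prod_filter]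
      refine Finset.prod_congr rfl fun i _ => ?_
      split_ifs with hg
      · rw [Set.indicator_of_mem hg]; ring
      · rw [Set.indicator_of_notMem hg]; ring
    change _ ≤ ∏ i ∈ Finset.range B, (1 + (good i).indicator (fun _ => -δ) (Z s ω).1)
    rw [hprod]
    refine (measureReal_mono ?_).trans hp
    rintro ω' ⟨ω'', h1, h2, h3⟩
    simp only [Set.mem_iInter]
    intro i hi
    have hyi := hy i hi
    have hiB : i < B := Finset.mem_range.1 (Finset.mem_filter.1 hi).1
    have h4 : diff (Z (s + 1) ω'') (y i) = b (decide (Even (y i))) :=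
      h1 (y i) (by omega) (by push_cast; omega)
    have h5 := (h.isNoisyRule ω'').step s le_rfl (y i)
    rw [h4, h.adapted s ω'' ω h2, h3 _ (by simp [before])] at h5
    exact h5.symm
  have hsub : {ω | HasRun (diff (Z (s + 1) ω)) x (128 * B)} ⊆
      ⋃ b ∈ (Finset.univ.filter fun b : Bool → Bool => ∃ i, b i = true),
        (fun ω => diff (Z (s + 1) ω)) ⁻¹' run b := by
    rintro ω ⟨b, hb, hrun⟩
    simp only [Set.mem_iUnion]
    exact ⟨b, by simpa using hb, hrun⟩
  refine (measureReal_mono hsub (measure_ne_top _ _)).trans ((measureReal_biUnion_finset_le _ _).trans ?_)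
  refine (Finset.sum_le_sum fun b hb => key b (Finset.mem_filter.1 hb).2).trans ?_
  rw [Finset.sum_const, nsmul_eq_mul]
  have : (Finset.univ.filter fun b : Bool → Bool => ∃ i, b i = true).card = 3 := by decide
  rw [this]
  norm_num

end Runs

/-! ### Survival of a difference near a target with high probability. -/

section Growth

theorem measureReal_card_filter_lt_le {Ω : Type*} [MeasurableSpace Ω] (μ : Measure Ω)
    [IsProbabilityMeasure μ] (T K : ℕ) (E : ℕ → Set Ω) (hE : ∀ s < T, MeasurableSet (E s)) {ε : ℝ}
    (hε : ∀ s < T, μ.real (E s) ≤ ε) [∀ ω, DecidablePred fun s => ω ∈ E s] :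
    μ.real {ω | K < ((Finset.range T).filter fun s => ω ∈ E s).card} ≤ T * ε / (K + 1) := by
  have h1 : ∀ ω, (((Finset.range T).filter fun s => ω ∈ E s).card : ℝ) =
      ∑ s ∈ Finset.range T, (E s).indicator (fun _ => (1 : ℝ)) ω := by
    intro ω
    rw [Finset.card_filter]
    push_cast
    exact Finset.sum_congr rfl fun s _ => by simp [Set.indicator_apply]
  have hint : ∀ s ∈ Finset.range T, Integrable ((E s).indicator fun _ => (1 : ℝ)) μ := fun s hs =>
    (integrable_const _).indicator (hE s (Finset.mem_range.1 hs))
  have h2 := mul_meas_ge_le_integral_of_nonneg (μ := μ)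
    (f := fun ω => ∑ s ∈ Finset.range T, (E s).indicator (fun _ => (1 : ℝ)) ω)
    (Eventually.of_forall fun ω => Finset.sum_nonneg fun s _ =>
      Set.indicator_nonneg (fun _ _ => zero_le_one) _) (integrable_finsetSum _ hint) (K + 1)
  rw [integral_finsetSum _ hint] at h2
  have h3 : ∑ s ∈ Finset.range T, ∫ ω, (E s).indicator (fun _ => (1 : ℝ)) ω ∂μ ≤ T * ε := by
    calc _ ≤ ∑ s ∈ Finset.range T, ε := Finset.sum_le_sum fun s hs => by
          rw [integral_indicator_const _ (hE s (Finset.mem_range.1 hs)), smul_eq_mul, mul_one]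
          exact hε s (Finset.mem_range.1 hs)
      _ = T * ε := by simp
  rw [le_div_iff₀ (by positivity), mul_comm]
  refine le_trans ?_ (h2.trans h3)
  refine mul_le_mul_of_nonneg_left (measureReal_mono (fun ω hω => ?_) (measure_ne_top _ _))
    (by positivity)
  simp only [Set.mem_ofPred_eq] at hω ⊢
  rw [← h1]
  exact_mod_cast hω

theorem breaks_congr {c : ℤ} {R : ℕ} {D D' : Config}
    (h : ∀ x ∈ Finset.Icc (c - (R + 1)) (c + (R + 1)), D x = D' x) : breaks c R D = breaks c R D' := by
  refine Finset.filter_congr fun x hx => ?_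
  rw [Finset.mem_Icc] at hx
  rw [IsBreak, IsBreak, h (x - 1) (Finset.mem_Icc.2 (by omega)),
    h (x + 1) (Finset.mem_Icc.2 (by omega))]

theorem measurable_firstBreak (c : ℤ) (R : ℕ) : Measurable (firstBreak c R) :=
  measurable_of_dependsOn (Finset.Icc (c - (R + 1)) (c + (R + 1))) fun D D' h => by
    rw [firstBreak, firstBreak, breaks_congr h]

theorem measurable_secondBreak (c : ℤ) (R : ℕ) : Measurable (secondBreak c R) :=
  measurable_of_dependsOn (Finset.Icc (c - (R + 1)) (c + (R + 1))) fun D D' h => by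
    rw [secondBreak, secondBreak, firstBreak, firstBreak, breaks_congr h]

theorem measurableSet_isIsolated (c : ℤ) (R J : ℕ) :
    MeasurableSet {D : Config | IsIsolated c R J D} := by
  have h0 : ∀ D D' : Config, (∀ x ∈ Finset.Icc (c - (R + 2 * J + 1)) (c + (R + 2 * J + 1)),
      D x = D' x) → IsIsolated c R J D → IsIsolated c R J D' := by
    intro D D' h
    have hf : firstBreak c R D = firstBreak c R D' := by
      rw [firstBreak, firstBreak, breaks_congr fun x hx => h x ?_]
      rw [Finset.mem_Icc] at hx ⊢
      omega
    have hb : ∀ x, |x - c| ≤ R + 2 * J → (IsBreak D x ↔ IsBreak D' x) := by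
      intro x hx
      rw [abs_le] at hx
      rw [IsBreak, IsBreak, h (x - 1) (Finset.mem_Icc.2 (by omega)),
        h (x + 1) (Finset.mem_Icc.2 (by omega))]
    rintro ⟨h1, h2, h3, h4⟩
    rw [IsIsolated, ← hf]
    refine ⟨fun x hx => ?_, (hb _ (by omega)).1 h2, h3, fun y hy hlt => h4 y ?_ hlt⟩
    · rw [← h x (by rw [abs_le] at hx; exact Finset.mem_Icc.2 (by omega))]
      exact h1 x hx
    · exact (hb y (by omega)).2 hy
  exact SetDependsOn.measurableSet (I := Finset.Icc (c - (R + 2 * J + 1)) (c + (R + 2 * J + 1)))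
    fun D D' h => ⟨h0 D D' h, h0 D' D fun x hx => (h x hx).symm⟩

variable (ν : Measure UpdateFn) [IsProbabilityMeasure ν]

/-- Some noise occurs around the first break, or along the two diagonals leaving it. -/
def noisyCone (Z : ℕ → Env → Config × Config) (c : ℤ) (R J s : ℕ) : Set Env :=
  (⋃ i ∈ Finset.Icc (-(2 * J : ℤ)) (2 * J), {ω | noiseDiff
    (ω (firstBreak c R (diff (Z s ω)) + i, s)) (Z s ω) (firstBreak c R (diff (Z s ω)) + i) = true}) ∪
  ⋃ j ∈ Finset.range (J - 1),
    ({ω | noiseDiff (ω (firstBreak c R (diff (Z s ω)) + (j + 1), s + 1 + j)) (Z (s + 1 + j) ω)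
      (firstBreak c R (diff (Z s ω)) + (j + 1)) = true} ∪
    {ω | noiseDiff (ω (firstBreak c R (diff (Z s ω)) - (j + 1), s + 1 + j)) (Z (s + 1 + j) ω)
      (firstBreak c R (diff (Z s ω)) - (j + 1)) = true})

variable {Z : ℕ → Env → Config × Config} {a : ℕ}

theorem IsPairProcess.measurable_firstBreak_diff (h : IsPairProcess Z a a) (c : ℤ) (R s : ℕ) :
    Measurable fun ω => firstBreak c R (diff (Z s ω)) :=
  (measurable_firstBreak c R).comp (measurable_diff.comp (h.measurable s))

theorem IsPairProcess.isAdapted_firstBreak_diff (h : IsPairProcess Z a a) (c : ℤ) (R s : ℕ) :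
    IsAdapted (fun ω => firstBreak c R (diff (Z s ω))) s :=
  (h.adapted s).comp fun z => firstBreak c R (diff z)

theorem IsPairProcess.measurableSet_noisyCone (h : IsPairProcess Z a a) (c : ℤ) (R J s : ℕ) :
    MeasurableSet (noisyCone Z c R J s) := by
  have hx := h.measurable_firstBreak_diff c R s
  refine (Finset.measurableSet_biUnion _ fun i _ => ?_).union
    (Finset.measurableSet_biUnion _ fun j _ => ?_)
  · exact measurableSet_noiseDiff (h.measurable s) (hx.add_const i) s
  · exact (measurableSet_noiseDiff (h.measurable _) (hx.add_const _) _).union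
      (measurableSet_noiseDiff (h.measurable _) (hx.sub_const _) _)

/-- The cone has 4J+1 sites at time `s` and 2(J-1) later ones, all located by the environment before
`s`. -/
theorem IsPairProcess.measureReal_noisyCone_le (h : IsPairProcess Z a a) (c : ℤ) {R J s : ℕ}
    (hJ : 1 ≤ J) : (envLaw ν).real (noisyCone Z c R J s) ≤ 6 * J * maxNoiseDist ν := by
  have hx := h.measurable_firstBreak_diff c R s
  have hxa := h.isAdapted_firstBreak_diff c R s
  have hε := maxNoiseDist_nonneg ν
  refine (measureReal_union_le _ _).trans ?_
  have h1 : (envLaw ν).real (⋃ i ∈ Finset.Icc (-(2 * J : ℤ)) (2 * J), {ω | noiseDiff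
      (ω (firstBreak c R (diff (Z s ω)) + i, s)) (Z s ω) (firstBreak c R (diff (Z s ω)) + i) = true})
      ≤ (4 * J + 1) * maxNoiseDist ν := by
    refine (measureReal_biUnion_finset_le _ _).trans ((Finset.sum_le_sum fun i _ =>
      envLaw_noiseDiff_adapted_le ν (h.measurable s) (h.adapted s) (hx.add_const i)
        (hxa.comp fun x => x + i)).trans ?_)
    rw [Finset.sum_const, nsmul_eq_mul, Int.card_Icc]
    have : ((2 * J + 1 - -(2 * J : ℤ)).toNat : ℝ) = 4 * J + 1 := by
      rw [show (2 * J + 1 - -(2 * J : ℤ)) = ((4 * J + 1 : ℕ) : ℤ) by push_cast; ring,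
        Int.toNat_natCast]
      push_cast; ring
    rw [this]
  have h2 : (envLaw ν).real (⋃ j ∈ Finset.range (J - 1),
      ({ω | noiseDiff (ω (firstBreak c R (diff (Z s ω)) + (j + 1), s + 1 + j)) (Z (s + 1 + j) ω)
        (firstBreak c R (diff (Z s ω)) + (j + 1)) = true} ∪
      {ω | noiseDiff (ω (firstBreak c R (diff (Z s ω)) - (j + 1), s + 1 + j)) (Z (s + 1 + j) ω)
        (firstBreak c R (diff (Z s ω)) - (j + 1)) = true})) ≤ (J - 1 : ℕ) * (2 * maxNoiseDist ν) := by
    refine (measureReal_biUnion_finset_le _ _).trans ((Finset.sum_le_sum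
      (g := fun _ => 2 * maxNoiseDist ν) fun j _ => ?_).trans ?_)
    · refine (measureReal_union_le _ _).trans ?_
      rw [two_mul]
      exact add_le_add
        (envLaw_noiseDiff_adapted_le ν (h.measurable _) (h.adapted _) (hx.add_const _)
          ((hxa.comp fun x => x + (j + 1)).mono (by omega)))
        (envLaw_noiseDiff_adapted_le ν (h.measurable _) (h.adapted _) (hx.sub_const _)
          ((hxa.comp fun x => x - (j + 1)).mono (by omega)))
    · rw [Finset.sum_const, nsmul_eq_mul, Finset.card_range]
  refine (add_le_add h1 h2).trans ?_
  rw [Nat.cast_sub hJ]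
  push_cast
  nlinarith

theorem isQuietCone_of_notMem {c : ℤ} {R J s : ℕ} {ω : Env} (h : ω ∉ noisyCone Z c R J s) :
    IsQuietCone c R J s (fun s => diff (Z s ω)) (fun s x => noiseDiff (ω (x, s)) (Z s ω) x) := by
  simp only [noisyCone, Set.mem_union, Set.mem_iUnion, not_or, not_exists, Finset.mem_range,
    Finset.mem_Icc, Set.mem_ofPred_eq] at h
  refine ⟨fun x hx => ?_, fun j hj => ?_⟩
  · have := h.1 (x - firstBreak c R (diff (Z s ω))) (by rw [abs_le] at hx; omega)
    rw [add_sub_cancel] at this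
    simpa using this
  · have := h.2 j (by omega)
    exact ⟨by simpa using this.1, by simpa using this.2⟩

/-- The event that the difference is isolated at time `s`. -/
def isolatedEvent (Z : ℕ → Env → Config × Config) (c : ℤ) (R J s : ℕ) : Set Env :=
  {ω | IsIsolated c R J (diff (Z s ω))}

theorem IsPairProcess.measurableSet_isolatedEvent (h : IsPairProcess Z a a) (c : ℤ) (R J s : ℕ) :
    MeasurableSet (isolatedEvent Z c R J s) :=
  (measurable_diff.comp (h.measurable s)) (measurableSet_isIsolated c R J)

/-- Among `J` consecutive times, isolation with a quiet cone happens at most once, so these events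
are disjoint and contribute at most one. Isolation with a noisy cone is paid for by the noise. -/
theorem IsPairProcess.sum_isolatedEvent_le (h : IsPairProcess Z a a) (c : ℤ) {R J : ℕ}
    (hJ : 1 ≤ J) (q : ℕ) :
    ∑ s ∈ Finset.range (J * q), (envLaw ν).real (isolatedEvent Z c R J (a + s)) ≤
      q + (J * q : ℕ) * (6 * J * maxNoiseDist ν) := by
  induction q with
  | zero => simp
  | succ q ih =>
    rw [Nat.mul_succ, Finset.sum_range_add]
    let G : ℕ → Set Env := fun j =>
      isolatedEvent Z c R J (a + (J * q + j)) \ noisyCone Z c R J (a + (J * q + j))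
    have hG : ∀ j, MeasurableSet (G j) := fun j =>
      (h.measurableSet_isolatedEvent c R J _).diff (h.measurableSet_noisyCone c R J _)
    have hdisj : ∀ i j, i < j → j < J → Disjoint (G i) (G j) := by
      intro i j hij hj
      refine Set.disjoint_left.2 fun ω hi hj' => ?_
      have := (h.isNoisyRule ω).not_isIsolated (j := j - i - 1) (by omega) hi.1
        (isQuietCone_of_notMem hi.2) (by omega)
      have e : a + (J * q + i) + 1 + (j - i - 1) = a + (J * q + j) := by omega
      rw [e] at this
      exact this hj'.1
    have hsum : ∑ j ∈ Finset.range J, (envLaw ν).real (G j) ≤ 1 := by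
      rw [← measureReal_biUnion_finset (fun i hi j hj hij => ?_) fun j _ => hG j]
      · exact measureReal_le_one
      · rw [Finset.mem_coe, Finset.mem_range] at hi hj
        rcases lt_or_gt_of_ne hij with hlt | hlt
        · exact hdisj i j hlt hj
        · exact (hdisj j i hlt hi).symm
    have hterm : ∑ j ∈ Finset.range J, (envLaw ν).real (isolatedEvent Z c R J (a + (J * q + j))) ≤
        1 + J * (6 * J * maxNoiseDist ν) := by
      calc _ ≤ ∑ j ∈ Finset.range J, ((envLaw ν).real (G j) + 6 * J * maxNoiseDist ν) := by
            refine Finset.sum_le_sum fun j _ => ?_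
            refine le_trans ?_ (add_le_add le_rfl (h.measureReal_noisyCone_le ν c hJ
              (s := a + (J * q + j)) (R := R)))
            refine (measureReal_mono ?_).trans (measureReal_union_le _ _)
            intro ω hω
            by_cases hc : ω ∈ noisyCone Z c R J (a + (J * q + j))
            · exact Or.inr hc
            · exact Or.inl ⟨hω, hc⟩
        _ ≤ _ := by
            rw [Finset.sum_add_distrib]
            refine add_le_add hsum (le_of_eq ?_)
            simp
    refine (add_le_add ih hterm).trans (le_of_eq ?_)
    push_cast; ring

/-- With high probability a difference near `c` does not vanish near `c` for a while. -/
theorem IsPairProcess.measureReal_vanish_le (h : IsPairProcess Z a a) (c : ℤ)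
    {R J m q k K : ℕ} {pm : ℝ} (hJ : 1 ≤ J) (hm : 3 ≤ m)
    (hR : k + 2 * m + 2 * J * (K + 1) + 1 ≤ R) (hR' : 4 * m + 2 * J * (K + 1) + 1 ≤ R)
    (hrun : ∀ s < J * q, ∀ x, (envLaw ν).real {ω | HasRun (diff (Z (a + s) ω)) x m} ≤ pm) :
    (envLaw ν).real {ω | (∃ y, |y - c| ≤ k ∧ diff (Z a ω) y = true) ∧
        ¬ ∃ y, |y - c| ≤ max (k - (J * q : ℕ) : ℤ) (2 * m) + 2 * J * K ∧
          diff (Z (a + J * q) ω) y = true} ≤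
      (J * q : ℕ) * ((2 * R + 1) * pm) + (J * q : ℕ) * maxNoiseDist ν ^ 2 +
        maxNoiseDist ν * (q + (J * q : ℕ) * (6 * J * maxNoiseDist ν)) +
        (J * q : ℕ) * maxNoiseDist ν / (K + 1) := by
  classical
  set T := J * q with hT
  let x₁ : ℕ → Env → ℤ := fun s ω => firstBreak c R (diff (Z (a + s) ω))
  let x₂ : ℕ → Env → ℤ := fun s ω => secondBreak c R (diff (Z (a + s) ω))
  have hx1 : ∀ s, Measurable (x₁ s) := fun s => h.measurable_firstBreak_diff c R _
  have hx1a : ∀ s, IsAdapted (x₁ s) (a + s) := fun s => h.isAdapted_firstBreak_diff c R _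
  have hx2 : ∀ s, Measurable (x₂ s) := fun s =>
    (measurable_secondBreak c R).comp (measurable_diff.comp (h.measurable _))
  have hx2a : ∀ s, IsAdapted (x₂ s) (a + s) := fun s =>
    (h.adapted _).comp fun z => secondBreak c R (diff z)
  let N : ℕ → Set Env := fun s =>
    {ω | noiseDiff (ω (x₁ s ω, a + s)) (Z (a + s) ω) (x₁ s ω) = true}
  -- The four obstructions: a run, noise on both nearest breaks, noise on an isolated break, and
  -- more than `K` noisy first breaks. Outside them `IsNoisyRule.exists_one` applies.
  let U₁ : Set Env := ⋃ s ∈ Finset.range T, ⋃ x ∈ Finset.Icc (c - R) (c + R),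
    {ω | HasRun (diff (Z (a + s) ω)) x m}
  let U₂ : Set Env := ⋃ s ∈ Finset.range T, {ω | x₁ s ω ≠ x₂ s ω ∧
    noiseDiff (ω (x₁ s ω, a + s)) (Z (a + s) ω) (x₁ s ω) = true ∧
    noiseDiff (ω (x₂ s ω, a + s)) (Z (a + s) ω) (x₂ s ω) = true}
  let U₃ : Set Env := ⋃ s ∈ Finset.range T, (isolatedEvent Z c R J (a + s) ∩ N s)
  let U₄ : Set Env := {ω | K < ((Finset.range T).filter fun s => ω ∈ N s).card}
  have b1 : (envLaw ν).real U₁ ≤ T * ((2 * R + 1) * pm) := by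
    refine (measureReal_biUnion_finset_le _ _).trans ((Finset.sum_le_sum
      (g := fun _ => (2 * R + 1) * pm) fun s hs => ?_).trans ?_)
    · refine (measureReal_biUnion_finset_le _ _).trans ((Finset.sum_le_sum fun x _ =>
        hrun s (Finset.mem_range.1 hs) x).trans ?_)
      rw [Finset.sum_const, nsmul_eq_mul, Int.card_Icc]
      have : ((c + R + 1 - (c - R)).toNat : ℝ) = 2 * R + 1 := by
        rw [show c + R + 1 - (c - R) = ((2 * R + 1 : ℕ) : ℤ) by push_cast; ring, Int.toNat_natCast]
        push_cast; ring
      rw [this]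
    · rw [Finset.sum_const, nsmul_eq_mul, Finset.card_range]
  have b2 : (envLaw ν).real U₂ ≤ T * maxNoiseDist ν ^ 2 := by
    refine (measureReal_biUnion_finset_le _ _).trans ((Finset.sum_le_sum fun s _ =>
      envLaw_noiseDiff_pair_le ν (h.measurable _) (h.adapted _) (hx1 s) (hx1a s)
        (hx2 s) (hx2a s)).trans ?_)
    rw [Finset.sum_const, nsmul_eq_mul, Finset.card_range]
  have b3 : (envLaw ν).real U₃ ≤
      maxNoiseDist ν * (q + T * (6 * J * maxNoiseDist ν)) := by
    refine (measureReal_biUnion_finset_le _ _).trans ((Finset.sum_le_sum fun s _ =>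
      envLaw_inter_noiseDiff_le ν (h.measurable _) (h.adapted _) (hx1 s) (hx1a s)
        (h.measurableSet_isolatedEvent c R J _)
        ((h.adapted (a + s)).setDependsOn {z | IsIsolated c R J (diff z)})).trans ?_)
    rw [← Finset.mul_sum]
    exact mul_le_mul_of_nonneg_left (h.sum_isolatedEvent_le ν c hJ q) (maxNoiseDist_nonneg ν)
  have b4 : (envLaw ν).real U₄ ≤ T * maxNoiseDist ν / (K + 1) :=
    measureReal_card_filter_lt_le (envLaw ν) T K N
      (fun s _ => measurableSet_noiseDiff (h.measurable _) (hx1 s) _)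
      (fun s _ => envLaw_noiseDiff_adapted_le ν (h.measurable _) (h.adapted _) (hx1 s) (hx1a s))
  have hsub : {ω | (∃ y, |y - c| ≤ k ∧ diff (Z a ω) y = true) ∧
        ¬ ∃ y, |y - c| ≤ max (k - (T : ℕ) : ℤ) (2 * m) + 2 * J * K ∧
          diff (Z (a + T) ω) y = true} ⊆ U₁ ∪ U₂ ∪ U₃ ∪ U₄ := by
    rintro ω ⟨h1, h2⟩
    by_contra hcon
    simp only [Set.mem_union, not_or] at hcon
    obtain ⟨⟨⟨c1, c2⟩, c3⟩, c4⟩ := hcon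
    apply h2
    refine (h.isNoisyRule ω).exists_one hm hR hR' (fun s hs x hx hr => c1 ?_)
      (fun s hs hd => c2 ?_) (fun s hs hi => c3 ?_) (not_lt.1 c4) h1
    · simp only [U₁, Set.mem_iUnion]
      rw [abs_le] at hx
      exact ⟨s, Finset.mem_range.2 hs, x, Finset.mem_Icc.2 (by omega), hr⟩
    · simp only [U₂, Set.mem_iUnion]
      exact ⟨s, Finset.mem_range.2 hs, hd⟩
    · simp only [U₃, Set.mem_iUnion]
      exact ⟨s, Finset.mem_range.2 hs, hi⟩
  refine (measureReal_mono hsub).trans ((measureReal_union_le _ _).trans (add_le_add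
    ((measureReal_union_le _ _).trans (add_le_add ((measureReal_union_le _ _).trans
      (add_le_add b1 b2)) b3)) b4))

end Growth

/-! ### Lipschitz percolation: an open surface along which occupation propagates. -/

section LipschitzPercolation

/-- Backward moves: `none` goes down and `some _` goes up along one of the two diagonals. -/
def moveBack : Option Bool → ℤ × ℕ → ℤ × ℕ
  | none, p => (p.1 - 1, p.2)
  | some true, p => (p.1 + 1, p.2 + 1)
  | some false, p => (p.1 + 1, p.2 - 1)

/-- The moves lead from `p` to a negative height, going down only from sites of `C`. -/
def IsBackPath (C : Set (ℤ × ℕ)) : ℤ × ℕ → List (Option Bool) → Prop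
  | p, [] => p.1 < 0
  | p, d :: w => (d = none → p ∈ C) ∧ IsBackPath C (moveBack d p) w

/-- The sites visited before the last one. -/
def visitedSites : ℤ × ℕ → List (Option Bool) → List (ℤ × ℕ)
  | _, [] => []
  | p, d :: w => p :: visitedSites (moveBack d p) w

/-- The sites from which the path goes down. -/
def downSites : ℤ × ℕ → List (Option Bool) → List (ℤ × ℕ)
  | _, [] => []
  | p, none :: w => p :: downSites (moveBack none p) w
  | p, some b :: w => downSites (moveBack (some b) p) w

theorem downSites_sublist (w : List (Option Bool)) :
    ∀ p, (downSites p w).Sublist (visitedSites p w) := by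
  induction w with
  | nil => intro p; exact List.Sublist.slnil
  | cons d w ih =>
    intro p
    cases d with
    | none => exact (ih _).cons_cons p
    | some b => exact (ih _).cons p

theorem IsBackPath.mem_of_mem_downSites {C : Set (ℤ × ℕ)} {w : List (Option Bool)} :
    ∀ {p}, IsBackPath C p w → ∀ q ∈ downSites p w, q ∈ C := by
  induction w with
  | nil => intro p _ q hq; simp [downSites] at hq
  | cons d w ih =>
    rintro p ⟨h1, h2⟩ q hq
    cases d with
    | none =>
      rcases List.mem_cons.1 hq with rfl | hq
      · exact h1 rfl
      · exact ih h2 q hq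
    | some b => exact ih h2 q hq

/-- Every move changes the height by one and the final height is negative; from height zero, more
than half of the moves go down. -/
theorem IsBackPath.length_lt {C : Set (ℤ × ℕ)} {w : List (Option Bool)} :
    ∀ {p}, IsBackPath C p w → p.1 + w.length < 2 * (downSites p w).length := by
  induction w with
  | nil =>
    intro p h
    have h' : p.1 < 0 := h
    simpa [downSites] using h'
  | cons d w ih =>
    rintro p ⟨-, h2⟩
    have := ih h2
    match d with
    | none => simp only [moveBack, downSites, List.length_cons] at this ⊢; push_cast; omega
    | some true => simp only [moveBack, downSites, List.length_cons] at this ⊢; push_cast; omega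
    | some false => simp only [moveBack, downSites, List.length_cons] at this ⊢; push_cast; omega

theorem IsBackPath.exists_suffix {C : Set (ℤ × ℕ)} {w : List (Option Bool)} :
    ∀ {p}, IsBackPath C p w → ∀ q ∈ visitedSites p w,
      ∃ w', IsBackPath C q w' ∧ (visitedSites q w').Sublist (visitedSites p w) := by
  induction w with
  | nil => intro p _ q hq; simp [visitedSites] at hq
  | cons d w ih =>
    intro p h q hq
    rcases List.mem_cons.1 hq with rfl | hq
    · exact ⟨_, h, List.Sublist.refl _⟩
    · obtain ⟨w', h1, h2⟩ := ih h.2 q hq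
      exact ⟨w', h1, h2.cons _⟩

/-- Loops are cut so that the down sites are distinct and each counts in the product bound. -/
theorem IsBackPath.exists_nodup {C : Set (ℤ × ℕ)} {w : List (Option Bool)} :
    ∀ {p}, IsBackPath C p w → ∃ w', IsBackPath C p w' ∧ (visitedSites p w').Nodup := by
  induction w with
  | nil => intro p h; exact ⟨[], h, List.nodup_nil⟩
  | cons d w ih =>
    intro p h
    obtain ⟨w', h1, h2⟩ := ih h.2
    by_cases hp : p ∈ visitedSites (moveBack d p) w'
    · obtain ⟨w'', h3, h4⟩ := h1.exists_suffix p hp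
      exact ⟨w'', h3, h4.nodup h2⟩
    · exact ⟨d :: w', ⟨h.1, h1⟩, List.nodup_cons.2 ⟨hp, h2⟩⟩

/-- Space is the height and time is the base. The surface consists of the sites without a back path
just above a site with one. It avoids `C`, since from a site of `C` one could go down and continue.
The diagonal moves ensure that a surface site `(i, n + 1)` has a surface site among `(i - 1, n)`,
`(i, n)`, `(i + 1, n)`, from which it inherits occupation. -/
theorem occupied_of_not_isBackPath {C : Set (ℤ × ℕ)} {O : ℤ → ℕ → Prop} (h0 : ∀ i, O i 0)
    (hO : ∀ i n, O i n → (i, n) ∉ C → ∀ j, |j - i| ≤ 1 → O j (n + 1)) (n : ℕ) :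
    ∀ i, (∃ w, IsBackPath C (i - 1, n) w) → (¬ ∃ w, IsBackPath C (i, n) w) → O i n := by
  induction n with
  | zero => intro i _ _; exact h0 i
  | succ n ih =>
    rintro i ⟨w, hw⟩ hi
    have h1 : ¬ ∃ w, IsBackPath C (i + 1, n) w := by
      rintro ⟨w', hw'⟩
      exact hi ⟨some false :: w', by simp, by simpa [moveBack] using hw'⟩
    have h2 : ∃ w, IsBackPath C (i - 1 - 1, n) w :=
      ⟨some true :: w, by simp, by simpa [moveBack] using hw⟩
    have hup : ∀ j : ℤ, (∃ w, IsBackPath C (j - 1, n) w) → (¬ ∃ w, IsBackPath C (j, n) w) →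
        (j, n) ∉ C := by
      rintro j ⟨w', hw'⟩ hj hC
      exact hj ⟨none :: w', fun _ => hC, by simpa [moveBack] using hw'⟩
    have hstep : ∀ j : ℤ, |i - j| ≤ 1 → (∃ w, IsBackPath C (j - 1, n) w) →
        (¬ ∃ w, IsBackPath C (j, n) w) → O i (n + 1) := fun j hj h3 h4 =>
      hO j n (ih j h3 h4) (hup j h3 h4) i hj
    by_cases h3 : ∃ w, IsBackPath C (i - 1, n) w
    · by_cases h4 : ∃ w, IsBackPath C (i, n) w
      · exact hstep (i + 1) (by rw [abs_le]; omega) (by rwa [add_sub_cancel_right]) h1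
      · exact hstep i (by simp) h3 h4
    · exact hstep (i - 1) (by simp) h2 h3

/-- Peierls count: a path of `L` moves has at least `(L+1)/2` down sites in `C`, hence probability
at most `16^(-(L+1))`. With `3^L` paths the sum is 1/13. -/
theorem measure_exists_isBackPath_le {Ω : Type*} [MeasurableSpace Ω] (μ : Measure Ω)
    [IsProbabilityMeasure μ] (C : Ω → Set (ℤ × ℕ))
    (hC : ∀ S : Finset (ℤ × ℕ), μ.real {ω | ∀ q ∈ S, q ∈ C ω} ≤ (1 / 256) ^ S.card) (n : ℕ) :
    μ.real {ω | ∃ w, IsBackPath (C ω) (0, n) w} ≤ 1 / 2 := by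
  classical
  let E : (L : ℕ) → (Fin L → Option Bool) → Set Ω := fun L v =>
    {ω | (visitedSites (0, n) (List.ofFn v)).Nodup ∧ IsBackPath (C ω) (0, n) (List.ofFn v)}
  have hE : ∀ L v, μ.real (E L v) ≤ (1 / 16) ^ (L + 1) := by
    intro L v
    by_cases hne : (E L v).Nonempty
    · obtain ⟨ω₀, hnd, hp⟩ := hne
      have hlen := hp.length_lt
      have hnd' := hnd.sublist (downSites_sublist (List.ofFn v) (0, n))
      set D := downSites (0, n) (List.ofFn v) with hD
      have hcard : D.toFinset.card = D.length := List.toFinset_card_of_nodup hnd'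
      have hsub : E L v ⊆ {ω | ∀ q ∈ D.toFinset, q ∈ C ω} := fun ω hω q hq =>
        hω.2.mem_of_mem_downSites q (List.mem_toFinset.1 hq)
      refine (measureReal_mono hsub (measure_ne_top _ _)).trans ((hC _).trans ?_)
      rw [hcard, show (1 / 256 : ℝ) = (1 / 16) ^ 2 by norm_num, ← pow_mul]
      rw [List.length_ofFn] at hlen
      exact pow_le_pow_of_le_one (by norm_num) (by norm_num) (by push_cast at hlen; omega)
    · rw [Set.not_nonempty_iff_eq_empty.1 hne]
      simp only [measureReal_empty]; positivity
  have hsub : {ω | ∃ w, IsBackPath (C ω) (0, n) w} ⊆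
      ⋃ L, ⋃ v ∈ (Finset.univ : Finset (Fin L → Option Bool)), E L v := by
    rintro ω ⟨w, hw⟩
    obtain ⟨w', h1, h2⟩ := hw.exists_nodup
    simp only [Set.mem_iUnion]
    exact ⟨w'.length, w'.get, Finset.mem_univ _, by
      simp only [E, List.ofFn_get]; exact ⟨h2, h1⟩⟩
  have hL : ∀ L, μ (⋃ v ∈ (Finset.univ : Finset (Fin L → Option Bool)), E L v) ≤
      ENNReal.ofReal ((1 / 16) * (3 / 16) ^ L) := by
    intro L
    rw [← ofReal_measureReal (measure_ne_top _ _)]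
    refine ENNReal.ofReal_le_ofReal ((measureReal_biUnion_finset_le _ _).trans
      ((Finset.sum_le_sum fun v _ => hE L v).trans (le_of_eq ?_)))
    rw [Finset.sum_const, nsmul_eq_mul, Finset.card_univ, Fintype.card_fun, Fintype.card_fin,
      Fintype.card_option, Fintype.card_bool, pow_succ, show (3 / 16 : ℝ) = 3 * (1 / 16) by norm_num,
      mul_pow]
    push_cast; ring
  have hs : Summable fun L : ℕ => (1 / 16 : ℝ) * (3 / 16) ^ L :=
    (summable_geometric_of_lt_one (by norm_num) (by norm_num)).mul_left _
  have hfin : μ {ω | ∃ w, IsBackPath (C ω) (0, n) w} ≤ ENNReal.ofReal (1 / 2) := by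
    refine (measure_mono hsub).trans ((measure_iUnion_le _).trans
      ((ENNReal.tsum_le_tsum hL).trans ?_))
    rw [← ENNReal.ofReal_tsum_of_nonneg (fun L => by positivity) hs, tsum_mul_left,
      tsum_geometric_of_lt_one (by norm_num) (by norm_num)]
    exact ENNReal.ofReal_le_ofReal (by norm_num)
  exact ENNReal.toReal_le_of_le_ofReal (by norm_num) hfin

end LipschitzPercolation

/-! ### Product bounds for block failures of finite range. -/

section BlockEvents

variable (ν : Measure UpdateFn) [IsProbabilityMeasure ν]

open Classical in
/-- Events indexed by blocks, with bounded conditional probabilities given the environment before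
their time level and conditionally determined by strips, are jointly unlikely. -/
theorem measureReal_forall_mem_le_pow_of_class {Fail : ℤ × ℕ → Set Env} {T : ℕ}
    {I : ℤ → Set (ℤ × ℕ)} {η : ℝ} (hη : 0 ≤ η)
    (hI : ∀ i j, i + 12 ≤ j → Disjoint (I i) (I j))
    (hm : ∀ q, MeasurableSet (Fail q))
    (hdep : ∀ q, SetDependsOn (Fail q) (before ((q.2 + 2) * T)))
    (hsec : ∀ (q : ℤ × ℕ) (ω : Env),
      SetDependsOn {ω' | (before (q.2 * T)).piecewise ω ω' ∈ Fail q} (I q.1) ∧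
      (envLaw ν).real {ω' | (before (q.2 * T)).piecewise ω ω' ∈ Fail q} ≤ η)
    (r : ℤ) (r' : ℕ) (N : ℕ) :
    ∀ S : Finset (ℤ × ℕ), (∀ q ∈ S, q.1 % 12 = r ∧ q.2 % 2 = r' ∧ q.2 < N) →
      (envLaw ν).real {ω | ∀ q ∈ S, ω ∈ Fail q} ≤ η ^ S.card := by
  have hpm : ∀ (q : ℤ × ℕ) (ω : Env),
      MeasurableSet {ω' | (before (q.2 * T)).piecewise ω ω' ∈ Fail q} := by
    intro q ω
    refine ((measurePreserving_piecewise ν (before (q.2 * T))).measurable.comp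
      measurable_prodMk_left) (hm q)
  induction N with
  | zero =>
    intro S hS
    have : S = ∅ := Finset.eq_empty_of_forall_notMem fun q hq => by have := hS q hq; omega
    subst this
    simp
  | succ N ih =>
    intro S hS
    -- Levels of equal parity differ by at least two, so earlier failures are settled before time `N
    -- * T`; given that past, failures at level `N` live on disjoint strips and are independent.
    set S₁ := S.filter fun q => q.2 < N with hS₁
    set S₂ := S.filter fun q => ¬ q.2 < N with hS₂
    have hcard : S₁.card + S₂.card = S.card := Finset.card_filter_add_card_filter_not _
    have hS2 : ∀ q ∈ S₂, q.2 = N := fun q hq => by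
      have h1 := hS q (Finset.mem_filter.1 hq).1
      have h2 := (Finset.mem_filter.1 hq).2
      omega
    have ih1 := ih S₁ fun q hq => by
      have h1 := hS q (Finset.mem_filter.1 hq).1
      exact ⟨h1.1, h1.2.1, (Finset.mem_filter.1 hq).2⟩
    by_cases hemp : S₂ = ∅
    · have : S₁ = S := by
        rw [hemp, Finset.card_empty, add_zero] at hcard
        exact Finset.eq_of_subset_of_card_le (Finset.filter_subset _ _) hcard.ge
      rw [this] at ih1
      exact ih1
    · obtain ⟨q₀, hq₀⟩ := Finset.nonempty_iff_ne_empty.2 hemp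
      have hN : N % 2 = r' := by
        rw [← hS2 q₀ hq₀]; exact (hS q₀ (Finset.mem_filter.1 hq₀).1).2.1
      have hset : {ω | ∀ q ∈ S, ω ∈ Fail q} =
          {ω | ∀ q ∈ S₁, ω ∈ Fail q} ∩ {ω | ∀ q ∈ S₂, ω ∈ Fail q} := by
        ext ω
        simp only [Set.mem_inter_iff, Set.mem_ofPred_eq]
        constructor
        · exact fun h => ⟨fun q hq => h q (Finset.mem_filter.1 hq).1,
            fun q hq => h q (Finset.mem_filter.1 hq).1⟩
        · rintro ⟨h1, h2⟩ q hq
          by_cases hqN : q.2 < N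
          · exact h1 q (Finset.mem_filter.2 ⟨hq, hqN⟩)
          · exact h2 q (Finset.mem_filter.2 ⟨hq, hqN⟩)
      have hmS : ∀ S' : Finset (ℤ × ℕ), MeasurableSet {ω | ∀ q ∈ S', ω ∈ Fail q} := fun S' => by
        have : {ω | ∀ q ∈ S', ω ∈ Fail q} = ⋂ q ∈ S', Fail q := by ext; simp
        rw [this]
        exact Finset.measurableSet_biInter _ fun q _ => hm q
      have hd : SetDependsOn {ω | ∀ q ∈ S₁, ω ∈ Fail q} (before (N * T)) := by
        intro ω ω' h
        refine forall₂_congr fun q hq => (hdep q).mono ?_ ω ω' h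
        have h1 := hS q (Finset.mem_filter.1 hq).1
        have h2 := (Finset.mem_filter.1 hq).2
        intro i hi
        exact lt_of_lt_of_le hi (Nat.mul_le_mul_right _ (by omega))
      rw [hset, ← hcard, pow_add, mul_comm]
      refine (measureReal_inter_le_of_section ν (before (N * T)) (hmS _) hd (hmS _)
        (c := η ^ S₂.card) fun ω _ => ?_).trans
        (mul_le_mul_of_nonneg_left ih1 (pow_nonneg hη _))
      have hp := measureReal_biInter_le_pow ν S₂ (fun q => I q.1)
        (fun q => {ω' | (before (q.2 * T)).piecewise ω ω' ∈ Fail q}) (fun q _ => hpm q ω)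
        (fun q _ => (hsec q ω).1) (fun q hq q' hq' hne => by
          have h1 := hS q (Finset.mem_filter.1 hq).1
          have h2 := hS q' (Finset.mem_filter.1 hq').1
          have h3 := hS2 q hq
          have h4 := hS2 q' hq'
          have h5 : q.1 ≠ q'.1 := fun h => hne (Prod.ext h (h3.trans h4.symm))
          rcases lt_or_gt_of_ne h5 with hlt | hlt
          · exact hI _ _ (by omega)
          · exact (hI _ _ (by omega)).symm) hη (fun q _ => (hsec q ω).2)
      refine (measureReal_mono ?_ (measure_ne_top _ _)).trans hp
      rintro ω' ⟨ω'', h1, h2, h3⟩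
      simp only [Set.mem_iInter, Set.mem_ofPred_eq]
      intro q hq
      have heq : (before (q.2 * T)).piecewise ω ω' = ω'' := by
        rw [hS2 q hq]
        funext i
        by_cases hi : i ∈ before (N * T)
        · rw [Set.piecewise_eq_of_mem _ _ _ hi, h2 i hi]
        · rw [Set.piecewise_eq_of_notMem _ _ _ hi, h3 i hi]
      rw [heq]
      exact h1 q hq

open Classical in
theorem measureReal_forall_mem_le_pow {Fail : ℤ × ℕ → Set Env} {T : ℕ}
    {I : ℤ → Set (ℤ × ℕ)} {η : ℝ} (hη : 0 ≤ η) (hη' : η ≤ (1 / 256) ^ 24)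
    (hI : ∀ i j, i + 12 ≤ j → Disjoint (I i) (I j))
    (hm : ∀ q, MeasurableSet (Fail q))
    (hdep : ∀ q, SetDependsOn (Fail q) (before ((q.2 + 2) * T)))
    (hsec : ∀ (q : ℤ × ℕ) (ω : Env),
      SetDependsOn {ω' | (before (q.2 * T)).piecewise ω ω' ∈ Fail q} (I q.1) ∧
      (envLaw ν).real {ω' | (before (q.2 * T)).piecewise ω ω' ∈ Fail q} ≤ η)
    (S : Finset (ℤ × ℕ)) :
    (envLaw ν).real {ω | ∀ q ∈ S, ω ∈ Fail q} ≤ (1 / 256) ^ S.card := by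
  -- Pigeonhole over 12 · 2 residue classes; `hη'` absorbs the factor 24 lost in the exponent.
  obtain ⟨⟨r, r'⟩, -, hcl⟩ : ∃ k ∈ (Finset.Ico (0 : ℤ) 12 ×ˢ Finset.range 2),
      S.card ≤ 24 * (S.filter fun q => (q.1 % 12, q.2 % 2) = k).card := by
    by_contra! hcon
    have h1 := Finset.card_eq_sum_card_fiberwise (s := S)
      (t := Finset.Ico (0 : ℤ) 12 ×ˢ Finset.range 2) (f := fun q => (q.1 % 12, q.2 % 2))
      (fun q _ => by
        simp only [Finset.coe_product, Set.mem_prod, Finset.mem_coe, Finset.mem_Ico,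
          Finset.mem_range]
        omega)
    have h2 := Finset.sum_lt_sum_of_nonempty (s := Finset.Ico (0 : ℤ) 12 ×ˢ Finset.range 2)
      ⟨(0, 0), by simp⟩ hcon
    rw [← Finset.mul_sum, ← h1, Finset.sum_const, Finset.card_product] at h2
    simp at h2
  set S' := S.filter fun q => (q.1 % 12, q.2 % 2) = (r, r') with hS'
  have h1 := measureReal_forall_mem_le_pow_of_class ν hη hI hm hdep hsec r r'
    (S'.sup (fun q => q.2) + 1) S' fun q hq => by
      have h2 := (Finset.mem_filter.1 hq).2
      simp only [Prod.mk.injEq] at h2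
      exact ⟨h2.1, h2.2, Nat.lt_succ_of_le (Finset.le_sup (f := fun q : ℤ × ℕ => q.2) hq)⟩
  have hsub : {ω | ∀ q ∈ S, ω ∈ Fail q} ⊆ {ω | ∀ q ∈ S', ω ∈ Fail q} := by
    intro ω hω q hq
    exact Set.mem_ofPred_eq ▸ hω q (Finset.mem_filter.1 hq).1
  refine (measureReal_mono hsub (measure_ne_top _ _)).trans (h1.trans ?_)
  refine (pow_le_pow_left₀ hη hη' _).trans ?_
  rw [← pow_mul]
  exact pow_le_pow_of_le_one (by norm_num) (by norm_num) hcl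

end BlockEvents

/-! ### Separation events, their locality and translation invariance. -/

section Separation

/-- The canonical update functions on the space of environments. -/
def canonicalUpdate (x : ℤ) (t : ℕ) (ω : Env) : UpdateFn := ω (x, t)

/-- Two initial configurations lead to different states of `x` at time `t`. -/
def separated {Ω : Type*} (F : ℤ → ℕ → Ω → UpdateFn) (x : ℤ) (t : ℕ) : Set Ω :=
  {ω | ∃ ξ₁ ξ₂ : Config, forwardState F ω ξ₁ t x ≠ forwardState F ω ξ₂ t x}

theorem forwardState_congr {Ω Ω' : Type*} {F : ℤ → ℕ → Ω → UpdateFn} {F' : ℤ → ℕ → Ω' → UpdateFn}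
    {ω : Ω} {ω' : Ω'} (ξ : Config) (y : ℤ) (t : ℕ) :
    ∀ x : ℤ, (∀ (z : ℤ) (s : ℕ), |z - x| ≤ (t : ℤ) → s < t → F (z + y) s ω = F' z s ω') →
      forwardState F ω ξ t (x + y) = forwardState F' ω' (fun z => ξ (z + y)) t x := by
  induction t with
  | zero => intro x _; rfl
  | succ t ih =>
    intro x h
    have hn : ∀ x', |x' - x| ≤ 1 →
        forwardState F ω ξ t (x' + y) = forwardState F' ω' (fun z => ξ (z + y)) t x' := by
      intro x' hx'
      refine ih x' fun z s hz hs => h z s ?_ (by omega)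
      have : |z - x| ≤ |z - x'| + |x' - x| := by
        calc |z - x| = |(z - x') + (x' - x)| := by ring_nf
          _ ≤ _ := abs_add_le _ _
      push_cast; omega
    simp only [forwardState, globalUpdate]
    rw [h x t (by simp; omega) (by omega), show x + y - 1 = (x - 1) + y by ring,
      show x + y + 1 = (x + 1) + y by ring, hn (x - 1) (by simp), hn x (by simp), hn (x + 1) (by simp)]

theorem mem_separated_congr {Ω Ω' : Type*} {F : ℤ → ℕ → Ω → UpdateFn}
    {F' : ℤ → ℕ → Ω' → UpdateFn} {ω : Ω} {ω' : Ω'} {x y : ℤ} {t : ℕ}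
    (h : ∀ z s, |z - x| ≤ t → s < t → F (z + y) s ω = F' z s ω') :
    ω ∈ separated F (x + y) t ↔ ω' ∈ separated F' x t := by
  have h1 := fun ξ => forwardState_congr ξ y t x h
  constructor
  · rintro ⟨ξ₁, ξ₂, hne⟩
    rw [h1, h1] at hne
    exact ⟨_, _, hne⟩
  · rintro ⟨ξ₁, ξ₂, hne⟩
    refine ⟨fun z => ξ₁ (z - y), fun z => ξ₂ (z - y), ?_⟩
    rw [h1, h1]
    simpa using hne

theorem measurableSet_separated (x : ℤ) (t : ℕ) : MeasurableSet (separated canonicalUpdate x t) := by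
  refine SetDependsOn.measurableSet (I := Finset.Icc (x - t) (x + t) ×ˢ Finset.range t)
    fun ω ω' h => ?_
  have := mem_separated_congr (F := canonicalUpdate) (F' := canonicalUpdate) (ω := ω) (ω' := ω')
    (x := x) (y := 0) (t := t) fun z s hz hs => by
      rw [abs_le] at hz
      rw [add_zero]
      exact h (z, s) (Finset.mem_product.2 ⟨Finset.mem_Icc.2 (by omega), Finset.mem_range.2 hs⟩)
  rwa [add_zero] at this

variable (ν : Measure UpdateFn) [IsProbabilityMeasure ν]

theorem envLaw_separated_shift (x : ℤ) (a t : ℕ) :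
    (envLaw ν).real {ω | (fun i : ℤ × ℕ => ω (i.1, a + i.2)) ∈ separated canonicalUpdate x t} =
      (envLaw ν).real (separated canonicalUpdate 0 t) := by
  have hp := measurePreserving_reindex ν (σ := fun i : ℤ × ℕ => (i.1 + x, a + i.2))
    (fun i j h => by
      simp only [Prod.mk.injEq] at h
      exact Prod.ext (by omega) (by omega))
  have h1 := hp.measure_preimage (measurableSet_separated 0 t).nullMeasurableSet
  rw [Measure.real, Measure.real, ← h1]
  congr 2
  ext ω
  have := mem_separated_congr (F := canonicalUpdate) (F' := canonicalUpdate)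
    (ω := fun i : ℤ × ℕ => ω (i.1, a + i.2)) (ω' := fun i : ℤ × ℕ => ω (i.1 + x, a + i.2))
    (x := 0) (y := x) (t := t) fun z s _ _ => rfl
  rw [zero_add] at this
  exact this

end Separation

/-! ### Two copies, one of them perturbed periodically at time T. -/

section BlockProcess

/-- The configuration with a one at each multiple of `ℓ`. -/
def spacedOnes (ℓ : ℕ) : Config := fun x => decide ((ℓ : ℤ) ∣ x)

/-- Two copies of the process started from zero, the second one being perturbed at time `T` at the
multiples of `ℓ`. -/
def blockProcess (T ℓ : ℕ) : ℕ → Env → Config × Config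
  | 0, _ => (fun _ => false, fun _ => false)
  | s + 1, ω =>
    (globalUpdate (fun x => ω (x, s)) (blockProcess T ℓ s ω).1,
      if s + 1 < T then globalUpdate (fun x => ω (x, s)) (blockProcess T ℓ s ω).1
      else if s + 1 = T then
        fun x => xor (globalUpdate (fun x => ω (x, s)) (blockProcess T ℓ s ω).1 x) (spacedOnes ℓ x)
      else globalUpdate (fun x => ω (x, s)) (blockProcess T ℓ s ω).2)

variable {T ℓ : ℕ}

theorem isAdapted_blockProcess (s : ℕ) : IsAdapted (blockProcess T ℓ s) s := by
  induction s with
  | zero => intro ω ω' _; rfl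
  | succ s ih =>
    intro ω ω' h
    have h1 := ih ω ω' fun i hi => h i (lt_trans hi (Nat.lt_succ_self s))
    have h2 : ∀ x : ℤ, ω (x, s) = ω' (x, s) := fun x => h (x, s) (Nat.lt_succ_self s)
    simp only [blockProcess, h1, h2]

theorem measurable_blockProcess (s : ℕ) : Measurable (blockProcess T ℓ s) := by
  induction s with
  | zero => exact measurable_const
  | succ s ih =>
    have h1 := measurable_globalUpdate (s := s) (measurable_fst.comp ih)
    have h2 := measurable_globalUpdate (s := s) (measurable_snd.comp ih)
    refine h1.prodMk ?_
    split_ifs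
    · exact h1
    · refine measurable_pi_lambda _ fun x => ?_
      exact (measurable_of_finite fun b : Bool => xor b (spacedOnes ℓ x)).comp
        ((measurable_pi_apply x).comp h1)
    · exact h2

theorem isPairProcess_blockProcess : IsPairProcess (blockProcess T ℓ) 0 T where
  measurable := measurable_blockProcess
  adapted := isAdapted_blockProcess
  step₁ s _ ω := rfl
  step₂ s hs ω := by
    have h1 : ¬ s + 1 < T := by omega
    have h2 : s + 1 ≠ T := by omega
    simp [blockProcess, h1, h2]

theorem diff_blockProcess (hT : 0 < T) (ω : Env) : diff (blockProcess T ℓ T ω) = spacedOnes ℓ := by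
  obtain ⟨s, rfl⟩ : ∃ s, T = s + 1 := ⟨T - 1, by omega⟩
  funext x
  simp [blockProcess, diff]

theorem globalUpdate_congr {g g' : ℤ → UpdateFn} {η η' : Config} {x : ℤ} (hg : g x = g' x)
    (hη : ∀ y, |y - x| ≤ 1 → η y = η' y) : globalUpdate g η x = globalUpdate g' η' x := by
  simp only [globalUpdate]
  rw [hg, hη (x - 1) (by simp), hη x (by simp), hη (x + 1) (by simp)]

/-- Influence travels at speed at most one: after a common past, `d` steps see only sites within
distance `d`. -/
theorem blockProcess_congr {ω ω' : Env} {u : ℕ} {c r : ℤ} (h : ∀ i ∈ before u, ω i = ω' i)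
    (hr : ∀ i : ℤ × ℕ, |i.1 - c| ≤ r → ω i = ω' i) (d : ℕ) : ∀ x, |x - c| + d ≤ r →
      (blockProcess T ℓ (u + d) ω).1 x = (blockProcess T ℓ (u + d) ω').1 x ∧
      (blockProcess T ℓ (u + d) ω).2 x = (blockProcess T ℓ (u + d) ω').2 x := by
  induction d with
  | zero =>
    intro x _
    rw [add_zero, isAdapted_blockProcess u ω ω' h]
    exact ⟨rfl, rfl⟩
  | succ d ih =>
    intro x hx
    push_cast at hx
    have hn : ∀ y, |y - x| ≤ 1 → |y - c| + d ≤ r := by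
      intro y hy
      have : |y - c| ≤ |y - x| + |x - c| := by
        calc |y - c| = |(y - x) + (x - c)| := by ring_nf
          _ ≤ _ := abs_add_le _ _
      omega
    have h0 : ω (x, u + d) = ω' (x, u + d) := hr _ (by simp only; omega)
    have h1 := globalUpdate_congr (g := fun x => ω (x, u + d)) (g' := fun x => ω' (x, u + d)) h0
      fun y hy => (ih y (hn y hy)).1
    have h2 := globalUpdate_congr (g := fun x => ω (x, u + d)) (g' := fun x => ω' (x, u + d)) h0
      fun y hy => (ih y (hn y hy)).2
    rw [← add_assoc]
    refine ⟨h1, ?_⟩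
    simp only [blockProcess]
    split_ifs
    · exact h1
    · exact congrArg (fun b => xor b (spacedOnes ℓ x)) h1
    · exact h2

theorem blockProcess_add (ω : Env) (t : ℕ) :
    blockProcess T ℓ (T + t) ω =
      (forwardState canonicalUpdate (fun i : ℤ × ℕ => ω (i.1, T + i.2)) (blockProcess T ℓ T ω).1 t,
        forwardState canonicalUpdate (fun i : ℤ × ℕ => ω (i.1, T + i.2))
          (blockProcess T ℓ T ω).2 t) := by
  induction t with
  | zero => rfl
  | succ t ih =>
    have h1 := (isPairProcess_blockProcess (T := T) (ℓ := ℓ)).step₁ (T + t) (by omega) ω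
    have h2 := (isPairProcess_blockProcess (T := T) (ℓ := ℓ)).step₂ (T + t) (by omega) ω
    rw [ih] at h1 h2
    exact Prod.ext h1 h2

open Classical in
-- Fixing the environment before `u` leaves a pair process, so every estimate on pair processes also
-- holds conditionally on the past.
theorem IsPairProcess.freeze {Z : ℕ → Env → Config × Config} {a₁ a₂ : ℕ}
    (h : IsPairProcess Z a₁ a₂) (u : ℕ) (ω : Env) :
    IsPairProcess (fun s ω' => Z s ((before u).piecewise ω ω')) (max a₁ u) (max a₂ u) where
  measurable s := by
    refine (h.measurable s).comp (measurable_pi_lambda _ fun i => ?_)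
    by_cases hi : i ∈ before u
    · simp only [Set.piecewise_eq_of_mem _ _ _ hi]; exact measurable_const
    · simp only [Set.piecewise_eq_of_notMem _ _ _ hi]; exact measurable_pi_apply i
  adapted s ω₁ ω₂ hω := h.adapted s _ _ fun i hi => by
    by_cases hu : i ∈ before u
    · rw [Set.piecewise_eq_of_mem _ _ _ hu, Set.piecewise_eq_of_mem _ _ _ hu]
    · rw [Set.piecewise_eq_of_notMem _ _ _ hu, Set.piecewise_eq_of_notMem _ _ _ hu, hω i hi]
  step₁ s hs ω' := by
    rw [h.step₁ s (by omega)]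
    congr 1
    funext x
    exact Set.piecewise_eq_of_notMem _ _ _ (by simp [before]; omega)
  step₂ s hs ω' := by
    rw [h.step₂ s (by omega)]
    congr 1
    funext x
    exact Set.piecewise_eq_of_notMem _ _ _ (by simp [before]; omega)

/-- A nonzero 2-periodic run of length 4 has ones two sites apart, closer than `ℓ`. -/
theorem not_hasRun_spacedOnes {m : ℕ} (hm : 4 ≤ m) (hℓ : 3 ≤ ℓ) (x : ℤ) :
    ¬ HasRun (spacedOnes ℓ) x m := by
  rintro ⟨b, ⟨i, hi⟩, h⟩
  have hp : ∀ y : ℤ, spacedOnes ℓ y = true → spacedOnes ℓ (y + 2) = true → False := by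
    intro y hy hz
    simp only [spacedOnes, decide_eq_true_eq] at hy hz
    have := Int.le_of_dvd (by norm_num) ((Int.dvd_iff_dvd_of_dvd_add hz).1 hy)
    omega
  obtain ⟨y, hy1, hy2, hy⟩ : ∃ y, x ≤ y ∧ y ≤ x + 1 ∧ decide (Even y) = i := by
    by_cases hx : decide (Even x) = i
    · exact ⟨x, le_rfl, by omega, hx⟩
    · refine ⟨x + 1, by omega, le_rfl, ?_⟩
      have : decide (Even (x + 1)) = !decide (Even x) := by
        rw [← decide_not]; congr 1; simp [parity_simps]
      rw [this]
      revert hx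
      cases decide (Even x) <;> cases i <;> simp
  have h0 := h y hy1 (by omega)
  have h1 := h (y + 2) (by omega) (by omega)
  have hpar : decide (Even (y + 2)) = decide (Even y) := by
    congr 1; simp [parity_simps]
  rw [hy, hi] at h0
  rw [hpar, hy, hi] at h1
  exact hp y h0 h1

end BlockProcess

/-! ### Propagation between blocks, and separation at the origin. -/

section BlockEstimates

theorem CharBound.mono {μ : Measure Config} {δ δ' : ℝ} (h : CharBound μ δ) (hδ : δ ≤ δ') :
    CharBound μ δ' := fun A hA => (h A hA).trans hδ

/-- The difference does not vanish on the `i`-th block at the end of the `n`-th time slab. -/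
def blockOne (T ℓ : ℕ) (i : ℤ) (n : ℕ) : Set Env :=
  {ω | ∃ y, i * ℓ ≤ y ∧ y < (i + 1) * ℓ ∧ diff (blockProcess T ℓ ((n + 1) * T) ω) y = true}

/-- The difference does not propagate from a block to some neighbouring block. -/
def blockFail (T ℓ : ℕ) (q : ℤ × ℕ) : Set Env :=
  {ω | ω ∈ blockOne T ℓ q.1 q.2 ∧ ∃ j, |j - q.1| ≤ 1 ∧ ω ∉ blockOne T ℓ j (q.2 + 1)}

variable {T ℓ : ℕ}

theorem measurableSet_blockOne (i : ℤ) (n : ℕ) : MeasurableSet (blockOne T ℓ i n) := by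
  have h1 : MeasurableSet {D : Config | ∃ y, i * ℓ ≤ y ∧ y < (i + 1) * ℓ ∧ D y = true} := by
    refine SetDependsOn.measurableSet (I := Finset.Ico (i * ℓ) ((i + 1) * ℓ)) fun D D' h => ?_
    refine exists_congr fun y => and_congr_right fun hy1 => and_congr_right fun hy2 => ?_
    rw [h y (Finset.mem_Ico.2 ⟨hy1, hy2⟩)]
  exact (measurable_diff.comp (measurable_blockProcess _)) h1

theorem measurableSet_blockFail (q : ℤ × ℕ) : MeasurableSet (blockFail T ℓ q) := by
  have : blockFail T ℓ q = blockOne T ℓ q.1 q.2 ∩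
      ⋃ j ∈ Finset.Icc (q.1 - 1) (q.1 + 1), (blockOne T ℓ j (q.2 + 1))ᶜ := by
    ext ω
    simp only [blockFail, Set.mem_ofPred_eq, Set.mem_inter_iff, Set.mem_iUnion, Finset.mem_Icc,
      Set.mem_compl_iff, abs_le, exists_prop]
    refine and_congr_right fun _ => exists_congr fun j => and_congr_left fun _ => ?_
    omega
  rw [this]
  exact (measurableSet_blockOne _ _).inter
    (Finset.measurableSet_biUnion _ fun j _ => (measurableSet_blockOne _ _).compl)

theorem setDependsOn_blockOne (i : ℤ) (n : ℕ) :
    SetDependsOn (blockOne T ℓ i n) (before ((n + 1) * T)) := fun ω ω' h => by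
  simp only [blockOne, Set.mem_ofPred_eq, isAdapted_blockProcess _ ω ω' h]

theorem setDependsOn_blockFail (q : ℤ × ℕ) :
    SetDependsOn (blockFail T ℓ q) (before ((q.2 + 2) * T)) := by
  have hb : before ((q.2 + 1) * T) ⊆ before ((q.2 + 2) * T) := fun i hi =>
    lt_of_lt_of_le hi (Nat.mul_le_mul_right _ (by omega))
  intro ω ω' h
  refine and_congr ((setDependsOn_blockOne _ _).mono hb ω ω' h) (exists_congr fun j =>
    and_congr_right fun _ => not_congr (setDependsOn_blockOne _ _ ω ω' h))

open Classical in
-- The three blocks involved lie within 24m of the centre, and two slabs of time carry influence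
-- over 2T = 64m: 88m in all. Centres 12 blocks apart are 192m > 2 · 88m apart, whence the modulus
-- 12.
theorem setDependsOn_piecewise_blockFail {m : ℕ} (hT : T = 32 * m) (hℓ : ℓ = 16 * m)
    (q : ℤ × ℕ) (ω : Env) :
    SetDependsOn {ω' | (before (q.2 * T)).piecewise ω ω' ∈ blockFail T ℓ q}
      {i | |i.1 - (q.1 * ℓ + 8 * m)| ≤ 88 * m} := by
  intro ω₁ ω₂ h
  have hb : ∀ i ∈ before (q.2 * T),
      (before (q.2 * T)).piecewise ω ω₁ i = (before (q.2 * T)).piecewise ω ω₂ i := fun i hi => by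
    rw [Set.piecewise_eq_of_mem _ _ _ hi, Set.piecewise_eq_of_mem _ _ _ hi]
  have hr : ∀ i : ℤ × ℕ, |i.1 - (q.1 * ℓ + 8 * m)| ≤ (88 * m : ℤ) →
      (before (q.2 * T)).piecewise ω ω₁ i = (before (q.2 * T)).piecewise ω ω₂ i := fun i hi => by
    by_cases hu : i ∈ before (q.2 * T)
    · exact hb i hu
    · rw [Set.piecewise_eq_of_notMem _ _ _ hu, Set.piecewise_eq_of_notMem _ _ _ hu, h i hi]
  have hone : ∀ (j : ℤ) (e : ℕ), |j - q.1| ≤ 1 → e ≤ 1 →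
      ((before (q.2 * T)).piecewise ω ω₁ ∈ blockOne T ℓ j (q.2 + e) ↔
        (before (q.2 * T)).piecewise ω ω₂ ∈ blockOne T ℓ j (q.2 + e)) := by
    intro j e hj he
    refine exists_congr fun y => and_congr_right fun hy1 => and_congr_right fun hy2 => ?_
    have hd : (q.2 + e + 1) * T = q.2 * T + (e + 1) * T := by ring
    have h64 : (((e + 1) * T : ℕ) : ℤ) ≤ 64 * m := by
      have : (e + 1) * T ≤ 2 * T := Nat.mul_le_mul_right _ (by omega)
      omega
    have hjl : (q.1 - 1) * ℓ ≤ j * ℓ ∧ (j + 1) * ℓ ≤ (q.1 + 2) * ℓ := by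
      rw [abs_le] at hj
      exact ⟨mul_le_mul_of_nonneg_right (by omega) (by omega),
        mul_le_mul_of_nonneg_right (by omega) (by omega)⟩
    have hc := blockProcess_congr (T := T) (ℓ := ℓ) hb hr ((e + 1) * T) y (by
      have h1 : (q.1 - 1) * (ℓ : ℤ) = q.1 * ℓ - ℓ := by ring
      have h2 : (q.1 + 2) * (ℓ : ℤ) = q.1 * ℓ + 2 * ℓ := by ring
      have h3 : |y - (q.1 * ℓ + 8 * m)| ≤ (24 * m : ℤ) := by
        rw [abs_le]
        constructor
        · have : (ℓ : ℤ) = 16 * m := by exact_mod_cast hℓ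
          linarith [hjl.1]
        · have : (ℓ : ℤ) = 16 * m := by exact_mod_cast hℓ
          linarith [hjl.2]
      linarith)
    rw [hd]
    simp only [diff, hc.1, hc.2]
  refine and_congr (hone q.1 0 (by simp) (by omega)) (exists_congr fun j =>
    and_congr_right fun hj => not_congr (hone j 1 hj le_rfl))

variable (ν : Measure UpdateFn)

/-- A bound on the probability of a long run. -/
noncomputable def runBound (p : unitInterval) (T B : ℕ) : ℝ :=
  3 * ((1 - maxNoiseDist ν / 4 * (1 / 2) ^ 128) ^ B +
    |2 * (p : ℝ) - 1| ^ (T - 1) * (1 + maxNoiseDist ν / 4) ^ B)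

/-- A bound on the conditional probability of a failure of propagation. -/
noncomputable def failBound (p : unitInterval) (J K B : ℕ) : ℝ :=
  3 * ((J * (32 * K) : ℕ) * ((2 * (64 * (J * K) : ℕ) + 1) * runBound ν p (J * (32 * K)) B) +
    (J * (32 * K) : ℕ) * maxNoiseDist ν ^ 2 +
    maxNoiseDist ν * ((32 * K : ℕ) + (J * (32 * K) : ℕ) * (6 * J * maxNoiseDist ν)) +
    (J * (32 * K) : ℕ) * maxNoiseDist ν / (K + 1))

variable {ν} in
theorem runBound_nonneg (p : unitInterval) (T B : ℕ) (hε : maxNoiseDist ν ≤ 1 / 2) :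
    0 ≤ runBound ν p T B := by
  have h0 := maxNoiseDist_nonneg ν
  have h1 : maxNoiseDist ν / 4 * (1 / 2) ^ 128 ≤ 1 := by
    have : (1 / 2 : ℝ) ^ 128 ≤ 1 := pow_le_one₀ (by norm_num) (by norm_num)
    nlinarith
  have h2 : 0 ≤ 1 - maxNoiseDist ν / 4 * (1 / 2) ^ 128 := by linarith
  unfold runBound
  positivity

variable {ν} in
theorem failBound_nonneg (p : unitInterval) (J K B : ℕ) (hε : maxNoiseDist ν ≤ 1 / 2) :
    0 ≤ failBound ν p J K B := by
  have h0 := maxNoiseDist_nonneg ν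
  have h1 := runBound_nonneg p (J * (32 * K)) B hε
  unfold failBound
  positivity

variable [IsProbabilityMeasure ν]

open Classical in
-- A one in block `i` is within 24m ≤ 32m of the centre of a neighbouring block `j`. After T = 32m
-- steps a one is within 2m + 2JK = 4m of that centre, hence inside block `j`, whose half-width is
-- 8m. The factor 3 in `failBound` counts the `j`.
theorem measureReal_piecewise_blockFail_le {p : unitInterval}
    (hν : ∀ a b c, ν.map (fun g : UpdateFn => g a b c) = localLaw p a c)
    (hε : maxNoiseDist ν ≤ 1 / 2) {J K B : ℕ} (hJ : 1 ≤ J) (hK : 1 ≤ K) (hm : J * K = 128 * B)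
    (q : ℤ × ℕ) (ω : Env) :
    (envLaw ν).real {ω' | (before (q.2 * (J * (32 * K)))).piecewise ω ω' ∈
      blockFail (J * (32 * K)) (16 * (J * K)) q} ≤ failBound ν p J K B := by
  obtain ⟨i, n⟩ := q
  simp only
  have hJm : J ≤ J * K := Nat.le_mul_of_pos_right J hK
  have hm4 : 4 ≤ J * K := by
    have : 0 < J * K := Nat.mul_pos hJ hK
    omega
  have hTm : J * (32 * K) = 32 * (J * K) := by ring
  set m := J * K with hmdef
  set T := J * (32 * K) with hT
  set ℓ := 16 * m with hℓ
  have hp := (isPairProcess_blockProcess (T := T) (ℓ := ℓ)).freeze (n * T) ω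
  set Z : ℕ → Env → Config × Config :=
    fun s ω' => blockProcess T ℓ s ((before (n * T)).piecewise ω ω') with hZ
  have hn1 : (n + 1) * T = n * T + T := by ring
  have hpa : IsPairProcess Z ((n + 1) * T) ((n + 1) * T) := hp.mono (by omega) (by omega)
  have hrun : ∀ s < J * (32 * K), ∀ x,
      (envLaw ν).real {ω' | HasRun (diff (Z ((n + 1) * T + s) ω')) x m} ≤ runBound ν p T B := by
    intro s hs x
    -- At the perturbation time the difference is explicit. At all other times the first copy has
    -- run at least `T - 1` steps beyond the frozen past before the last step, so its law was nearly
    -- uniform.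
    by_cases h0 : n = 0 ∧ s = 0
    · obtain ⟨rfl, rfl⟩ := h0
      refine le_trans (le_of_eq ?_) (runBound_nonneg p T B hε)
      convert measureReal_empty (μ := envLaw ν)
      ext ω'
      simp only [hZ, zero_add, one_mul, add_zero, Set.mem_ofPred_eq, Set.mem_empty_iff_false,
        iff_false]
      rw [diff_blockProcess (by omega)]
      exact not_hasRun_spacedOnes hm4 (by omega) x
    · have hv : max T (n * T) ≤ n * T + (T + s - 1) := by
        by_cases hn : n = 0
        · subst hn; omega
        · have : T ≤ n * T := Nat.le_mul_of_pos_left T (by omega)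
          omega
      have e1 : (n + 1) * T + s = n * T + (T + s - 1) + 1 := by omega
      have hc := hp.charBound ν hν (T + s - 1)
      rw [show max 0 (n * T) = n * T by omega] at hc
      have hc' := hc.mono (pow_le_pow_of_le_one (abs_nonneg _) (abs_two_mul_sub_one_le p)
        (by omega : T - 1 ≤ T + s - 1))
      rw [e1, hm]
      exact (hp.mono (by omega) hv).measureReal_hasRun_le ν hc' hε x B
  have hvan : ∀ j : ℤ, (envLaw ν).real {ω' | (∃ y, |y - (j * ℓ + 8 * m)| ≤ (32 * m : ℕ) ∧
      diff (Z ((n + 1) * T) ω') y = true) ∧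
        ¬ ∃ y, |y - (j * ℓ + 8 * m)| ≤ max ((32 * m : ℕ) - (J * (32 * K) : ℕ) : ℤ) (2 * m) +
          2 * J * K ∧ diff (Z ((n + 1) * T + J * (32 * K)) ω') y = true} ≤ failBound ν p J K B / 3 := by
    intro j
    have hJK : 2 * J * (K + 1) = 2 * m + 2 * J := by rw [hmdef]; ring
    refine (hpa.measureReal_vanish_le ν (j * ℓ + 8 * m) (R := 64 * m) (m := m) (K := K) hJ (by omega)
      (by omega) (by omega) hrun).trans (le_of_eq ?_)
    rw [failBound, mul_div_cancel_left₀ _ (by norm_num : (3 : ℝ) ≠ 0)]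
  have hsub : {ω' | (before (n * T)).piecewise ω ω' ∈ blockFail T ℓ (i, n)} ⊆
      ⋃ j ∈ Finset.Icc (i - 1) (i + 1), {ω' | (∃ y, |y - (j * ℓ + 8 * m)| ≤ (32 * m : ℕ) ∧
        diff (Z ((n + 1) * T) ω') y = true) ∧
        ¬ ∃ y, |y - (j * ℓ + 8 * m)| ≤ max ((32 * m : ℕ) - (J * (32 * K) : ℕ) : ℤ) (2 * m) +
          2 * J * K ∧ diff (Z ((n + 1) * T + J * (32 * K)) ω') y = true} := by
    rintro ω' ⟨⟨y, hy1, hy2, hy⟩, j, hj, hj'⟩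
    simp only [Set.mem_iUnion]
    simp only at hy1 hy2 hj
    rw [abs_le] at hj
    have hl : (ℓ : ℤ) = 16 * m := by rw [hℓ]; push_cast; ring
    refine ⟨j, Finset.mem_Icc.2 (by omega), ⟨y, ?_, hy⟩, ?_⟩
    · have h1 : (j - 1) * (ℓ : ℤ) ≤ i * ℓ := mul_le_mul_of_nonneg_right (by omega) (by omega)
      have h2 : (i + 1) * (ℓ : ℤ) ≤ (j + 2) * ℓ := mul_le_mul_of_nonneg_right (by omega) (by omega)
      have h3 : (j - 1) * (ℓ : ℤ) = j * ℓ - ℓ := by ring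
      have h4 : (j + 2) * (ℓ : ℤ) = j * ℓ + 2 * ℓ := by ring
      rw [abs_le]
      push_cast
      constructor <;> linarith
    · rintro ⟨z, hz, hDz⟩
      refine hj' ⟨z, ?_⟩
      have e2 : (n + 1 + 1) * T = (n + 1) * T + J * (32 * K) := by rw [← hT]; ring
      simp only
      rw [e2]
      have h5 : (2 * J * K : ℤ) = 2 * m := by rw [hmdef]; push_cast; ring
      have h6 : max ((32 * m : ℕ) - (J * (32 * K) : ℕ) : ℤ) (2 * m) = 2 * m := by
        rw [← hT]; omega
      rw [h5, h6, abs_le] at hz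
      have h7 : (j + 1) * (ℓ : ℤ) = j * ℓ + ℓ := by ring
      have hm0 : (0 : ℤ) < m := by omega
      refine ⟨by linarith, by linarith, hDz⟩
  refine (measureReal_mono hsub (measure_ne_top _ _)).trans ((measureReal_biUnion_finset_le _ _).trans
    ((Finset.sum_le_sum fun j _ => hvan j).trans (le_of_eq ?_)))
  rw [Finset.sum_const, nsmul_eq_mul, Int.card_Icc,
    show (i + 1 + 1 - (i - 1)).toNat = 3 by omega]
  push_cast; ring

theorem half_le_measureReal_blockOne {p : unitInterval}
    (hν : ∀ a b c, ν.map (fun g : UpdateFn => g a b c) = localLaw p a c)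
    (hε : maxNoiseDist ν ≤ 1 / 2) {J K B : ℕ} (hJ : 1 ≤ J) (hK : 1 ≤ K) (hm : J * K = 128 * B)
    (hfail : failBound ν p J K B ≤ (1 / 256) ^ 24) (n : ℕ) :
    1 / 2 ≤ (envLaw ν).real (blockOne (J * (32 * K)) (16 * (J * K)) 0 n) := by
  classical
  have hmpos : 0 < J * K := Nat.mul_pos hJ hK
  have hTm : J * (32 * K) = 32 * (J * K) := by ring
  have hC := measureReal_forall_mem_le_pow ν (Fail := blockFail (J * (32 * K)) (16 * (J * K)))
    (T := J * (32 * K)) (I := fun i =>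
      {q | |q.1 - (i * (16 * (J * K) : ℕ) + 8 * (J * K : ℕ))| ≤ 88 * (J * K : ℕ)})
    (failBound_nonneg p J K B hε) hfail
    (fun i j hij => Set.disjoint_left.2 fun q hq hq' => by
      simp only [Set.mem_ofPred_eq, abs_le] at hq hq'
      have h1 : (i + 12) * ((16 * (J * K) : ℕ) : ℤ) ≤ j * (16 * (J * K) : ℕ) :=
        mul_le_mul_of_nonneg_right hij (by omega)
      have h2 : (i + 12) * ((16 * (J * K) : ℕ) : ℤ) =
        i * (16 * (J * K) : ℕ) + 12 * (16 * (J * K) : ℕ) := by ring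
      omega)
    measurableSet_blockFail setDependsOn_blockFail
    (fun q ω => ⟨setDependsOn_piecewise_blockFail hTm rfl q ω,
      measureReal_piecewise_blockFail_le ν hν hε hJ hK hm q ω⟩)
  have h1 := measure_exists_isBackPath_le (envLaw ν)
    (fun ω => {q | ω ∈ blockFail (J * (32 * K)) (16 * (J * K)) q}) hC n
  have hsub : (blockOne (J * (32 * K)) (16 * (J * K)) 0 n)ᶜ ⊆
      {ω | ∃ w, IsBackPath {q | ω ∈ blockFail (J * (32 * K)) (16 * (J * K)) q} (0, n) w} := by
    intro ω hω
    by_contra hcon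
    refine hω (occupied_of_not_isBackPath
      (C := {q | ω ∈ blockFail (J * (32 * K)) (16 * (J * K)) q})
      (O := fun i n => ω ∈ blockOne (J * (32 * K)) (16 * (J * K)) i n) (fun i => ?_)
      (fun i n hi hni j hj => ?_) n 0 ⟨[], by simp [IsBackPath]⟩ hcon)
    · refine ⟨i * (16 * (J * K) : ℕ), le_rfl, ?_, ?_⟩
      · have : (i + 1) * ((16 * (J * K) : ℕ) : ℤ) =
          i * (16 * (J * K) : ℕ) + (16 * (J * K) : ℕ) := by ring
        omega
      · rw [zero_add, one_mul, diff_blockProcess (by omega)]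
        simp [spacedOnes]
    · by_contra hj'
      exact hni ⟨hi, j, hj, hj'⟩
  have h2 := (measureReal_mono hsub (measure_ne_top _ _)).trans h1
  rw [probReal_compl_eq_one_sub (measurableSet_blockOne _ _)] at h2
  linarith

/-- A one in block 0 at time `T + n * T` makes the two configurations of time `T` witnesses of
separation for the later environment. A union bound over the sites of the block and invariance under
translations bring this to the origin. -/
theorem half_le_mul_measureReal_separated {p : unitInterval}
    (hν : ∀ a b c, ν.map (fun g : UpdateFn => g a b c) = localLaw p a c)
    (hε : maxNoiseDist ν ≤ 1 / 2) {J K B : ℕ} (hJ : 1 ≤ J) (hK : 1 ≤ K) (hm : J * K = 128 * B)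
    (hfail : failBound ν p J K B ≤ (1 / 256) ^ 24) (n : ℕ) :
    1 / 2 ≤ (16 * (J * K) : ℕ) *
      (envLaw ν).real (separated canonicalUpdate 0 (n * (J * (32 * K)))) := by
  refine (half_le_measureReal_blockOne ν hν hε hJ hK hm hfail n).trans ?_
  set T := J * (32 * K)
  set ℓ := 16 * (J * K)
  have hsub : blockOne T ℓ 0 n ⊆ ⋃ x ∈ Finset.Ico (0 : ℤ) ℓ,
      {ω | (fun i : ℤ × ℕ => ω (i.1, T + i.2)) ∈ separated canonicalUpdate x (n * T)} := by
    rintro ω ⟨y, hy1, hy2, hy⟩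
    simp only [Set.mem_iUnion]
    refine ⟨y, Finset.mem_Ico.2 (by simpa using And.intro hy1 hy2),
      (blockProcess T ℓ T ω).1, (blockProcess T ℓ T ω).2, ?_⟩
    rw [show (n + 1) * T = T + n * T by ring, blockProcess_add] at hy
    simpa [diff] using hy
  refine (measureReal_mono hsub (measure_ne_top _ _)).trans ((measureReal_biUnion_finset_le _ _).trans
    ((Finset.sum_le_sum fun x _ => (envLaw_separated_shift ν x T (n * T)).le).trans (le_of_eq ?_)))
  rw [Finset.sum_const, nsmul_eq_mul, Int.card_Ico]
  simp

end BlockEstimates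

/-! ### Choice of scales, uniformly in the coupling. -/

section Parameters

variable (ν : Measure UpdateFn)

theorem measureReal_updateNoise {p : unitInterval}
    (hν : ∀ a b c, ν.map (fun g : UpdateFn => g a b c) = localLaw p a c) (u : Bool × Bool × Bool) :
    ν.real {g | updateNoise g u = true} = 1 - p := by
  have h1 : {g : UpdateFn | updateNoise g u = true} =
      (fun g : UpdateFn => g u.1 u.2.1 u.2.2) ⁻¹' {!(addMod2 u.1 u.2.2)} := by
    ext g
    simp only [updateNoise, addMod2, Set.mem_ofPred_eq, Set.mem_preimage, Set.mem_singleton_iff]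
    cases g u.1 u.2.1 u.2.2 <;> cases u.1 <;> cases u.2.2 <;> simp
  rw [h1, Measure.real, ← Measure.map_apply (measurable_of_finite _) (measurableSet_singleton _), hν]
  have hp : 0 ≤ 1 - (p : ℝ) := by linarith [p.2.2]
  simp [localLaw, addMod2, hp]

/-- Since `ε * n^9 ≥ n / 256`, both terms are exponentially small, and `2^(-138) = 2^(-8) · 2^(-2) ·
2^(-128)`. In the second one `|2p-1| ≤ 1 - ε` follows from `hεp`, and 4096 n^9 steps of contraction
beat the growth of `(1 + ε/4)^(n^9)`. -/
theorem runBound_le {p : unitInterval} {n : ℕ} (hn : 1 ≤ n)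
    (hεp : maxNoiseDist ν ≤ 2 * (1 - p)) (hp : 1 / 2 ≤ (p : ℝ))
    (hlow : 1 ≤ 256 * (n : ℝ) ^ 8 * maxNoiseDist ν) :
    runBound ν p (4096 * n ^ 9) (n ^ 9) ≤ 6 * Real.exp (-((1 / 2) ^ 138 * n)) := by
  have hε0 := maxNoiseDist_nonneg ν
  set ε := maxNoiseDist ν with hε
  have hn' : (1 : ℝ) ≤ n := by exact_mod_cast hn
  have hlow' : (n : ℝ) / 256 ≤ ε * n ^ 9 := by
    have : (n : ℝ) * 1 ≤ n * (256 * (n : ℝ) ^ 8 * ε) := by gcongr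
    nlinarith
  have hp1 := p.2.2
  have h1 : (1 - ε / 4 * (1 / 2) ^ 128) ^ (n ^ 9) ≤ Real.exp (-((1 / 2) ^ 138 * n)) := by
    have h0 : 0 ≤ 1 - ε / 4 * (1 / 2) ^ 128 := by
      have : (1 / 2 : ℝ) ^ 128 ≤ 1 := pow_le_one₀ (by norm_num) (by norm_num)
      nlinarith
    have h2 : 1 - ε / 4 * (1 / 2) ^ 128 ≤ Real.exp (-(ε / 4 * (1 / 2) ^ 128)) :=
      Real.one_sub_le_exp_neg _
    refine (pow_le_pow_left₀ h0 h2 _).trans ?_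
    rw [← Real.exp_nat_mul, Real.exp_le_exp]
    push_cast
    have h3 : ((n : ℝ) / 256) * ((1 / 4) * (1 / 2) ^ 128) ≤ ε * n ^ 9 * ((1 / 4) * (1 / 2) ^ 128) := by
      gcongr
    have h4 : (1 / 2 : ℝ) ^ 138 = (1 / 256) * ((1 / 4) * (1 / 2) ^ 128) := by norm_num
    rw [h4]
    linarith
  have h2 : |2 * (p : ℝ) - 1| ^ (4096 * n ^ 9 - 1) * (1 + ε / 4) ^ (n ^ 9) ≤
      Real.exp (-((1 / 2) ^ 138 * n)) := by
    have h3 : |2 * (p : ℝ) - 1| ≤ Real.exp (-ε) := by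
      rw [abs_of_nonneg (by linarith)]
      exact le_trans (by linarith) (Real.one_sub_le_exp_neg ε)
    have h4 : 1 + ε / 4 ≤ Real.exp (ε / 4) := by linarith [Real.add_one_le_exp (ε / 4)]
    have h5 : (4096 : ℝ) * n ^ 9 - 1 = ((4096 * n ^ 9 - 1 : ℕ) : ℝ) := by
      rw [Nat.cast_sub (by have := Nat.one_le_pow 9 n hn; omega)]
      push_cast; ring
    calc _ ≤ Real.exp (-ε) ^ (4096 * n ^ 9 - 1) * Real.exp (ε / 4) ^ (n ^ 9) :=
          mul_le_mul (pow_le_pow_left₀ (abs_nonneg _) h3 _)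
            (pow_le_pow_left₀ (by positivity) h4 _) (by positivity) (by positivity)
      _ ≤ _ := by
          rw [← Real.exp_nat_mul, ← Real.exp_nat_mul, ← Real.exp_add, Real.exp_le_exp, ← h5]
          push_cast
          have h6 : (1 : ℝ) ≤ n ^ 9 := one_le_pow₀ hn'
          have h7 : ε * 1 ≤ ε * (n : ℝ) ^ 9 := by gcongr
          have h8 : (1 / 2 : ℝ) ^ 138 * n ≤ 1 / 256 * n := by
            gcongr; norm_num
          nlinarith
  unfold runBound
  rw [← hε]
  linarith

/-- With `ε` of order `n^(-8)`, the terms for runs, double noise, isolated noise and excess noise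
are of order `n^18 exp(-cn)`, `n^(-7)`, `n^(-3)` and `n^(-4)`; this is what the exponents 4, 5 and 9
are chosen for. -/
theorem failBound_le {p : unitInterval} {n : ℕ} (hn : 1 ≤ n)
    (hεp : maxNoiseDist ν ≤ 2 * (1 - p)) (hp : 1 / 2 ≤ (p : ℝ))
    (hlow : 1 ≤ 256 * (n : ℝ) ^ 8 * maxNoiseDist ν) (hup : (n : ℝ) ^ 8 * maxNoiseDist ν ≤ 1) :
    failBound ν p (n ^ 4) (128 * n ^ 5) (n ^ 9) ≤
      10 ^ 10 * ((n : ℝ) ^ 18 * Real.exp (-((1 / 2) ^ 138 * n))) + 10 ^ 6 * (1 / (n : ℝ)) := by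
  have hε0 := maxNoiseDist_nonneg ν
  have hrb := runBound_le ν hn hεp hp hlow
  have hT : n ^ 4 * (32 * (128 * n ^ 5)) = 4096 * n ^ 9 := by ring
  unfold failBound
  rw [hT]
  set ε := maxNoiseDist ν with hε
  set rb := runBound ν p (4096 * n ^ 9) (n ^ 9)
  set E := Real.exp (-((1 / 2) ^ 138 * n))
  have hE : 0 < E := Real.exp_pos _
  have hn' : (1 : ℝ) ≤ n := by exact_mod_cast hn
  have hn0 : (0 : ℝ) < n := by linarith
  have hε1 : ε ≤ 1 / (n : ℝ) ^ 8 := by rw [le_div_iff₀ (by positivity)]; linarith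
  have hinv : ∀ k : ℕ, 1 ≤ k → 1 / (n : ℝ) ^ k ≤ 1 / n := fun k hk => by
    refine one_div_le_one_div_of_le hn0 ?_
    calc (n : ℝ) = n ^ 1 := (pow_one _).symm
      _ ≤ n ^ k := pow_le_pow_right₀ hn' hk
  have t1 : ((4096 * n ^ 9 : ℕ) : ℝ) * ((2 * ((64 * (n ^ 4 * (128 * n ^ 5)) : ℕ) : ℝ) + 1) * rb) ≤
      4096 * 16385 * 6 * ((n : ℝ) ^ 18 * E) := by
    push_cast
    have h1 : (1 : ℝ) ≤ n ^ 9 := one_le_pow₀ hn'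
    have h2 : 2 * (64 * ((n : ℝ) ^ 4 * (128 * n ^ 5))) + 1 ≤ 16385 * n ^ 9 := by nlinarith
    calc 4096 * (n : ℝ) ^ 9 * ((2 * (64 * ((n : ℝ) ^ 4 * (128 * n ^ 5))) + 1) * rb)
        ≤ 4096 * (n : ℝ) ^ 9 * ((2 * (64 * ((n : ℝ) ^ 4 * (128 * n ^ 5))) + 1) * (6 * E)) := by gcongr
      _ ≤ 4096 * (n : ℝ) ^ 9 * ((16385 * n ^ 9) * (6 * E)) := by gcongr
      _ = _ := by ring
  have t2 : ((4096 * n ^ 9 : ℕ) : ℝ) * ε ^ 2 ≤ 4096 * (1 / n) := by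
    push_cast
    calc 4096 * (n : ℝ) ^ 9 * ε ^ 2 ≤ 4096 * (n : ℝ) ^ 9 * (1 / (n : ℝ) ^ 8) ^ 2 := by gcongr
      _ = 4096 * (1 / (n : ℝ) ^ 7) := by field_simp
      _ ≤ _ := by have := hinv 7 (by norm_num); linarith
  have t3 : ε * (((32 * (128 * n ^ 5) : ℕ) : ℝ) + ((4096 * n ^ 9 : ℕ) : ℝ) *
      (6 * ((n ^ 4 : ℕ) : ℝ) * ε)) ≤ 28672 * (1 / n) := by
    push_cast
    calc ε * (32 * (128 * (n : ℝ) ^ 5) + 4096 * (n : ℝ) ^ 9 * (6 * (n : ℝ) ^ 4 * ε))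
        ≤ 1 / (n : ℝ) ^ 8 * (32 * (128 * (n : ℝ) ^ 5) +
          4096 * (n : ℝ) ^ 9 * (6 * (n : ℝ) ^ 4 * (1 / (n : ℝ) ^ 8))) := by gcongr
      _ = 28672 * (1 / (n : ℝ) ^ 3) := by field_simp; ring
      _ ≤ _ := by have := hinv 3 (by norm_num); linarith
  have t4 : ((4096 * n ^ 9 : ℕ) : ℝ) * ε / (((128 * n ^ 5 : ℕ) : ℝ) + 1) ≤ 32 * (1 / n) := by
    push_cast
    calc 4096 * (n : ℝ) ^ 9 * ε / (128 * (n : ℝ) ^ 5 + 1)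
        ≤ 4096 * (n : ℝ) ^ 9 * (1 / (n : ℝ) ^ 8) / (128 * (n : ℝ) ^ 5) := by
          gcongr; linarith
      _ = 32 * (1 / (n : ℝ) ^ 4) := by field_simp; norm_num
      _ ≤ _ := by have := hinv 4 (by norm_num); linarith
  have h5 : 0 < 1 / (n : ℝ) := by positivity
  have h6 : 0 < (n : ℝ) ^ 18 * E := by positivity
  linarith

variable [IsProbabilityMeasure ν]

theorem maxNoiseDist_le {p : unitInterval}
    (hν : ∀ a b c, ν.map (fun g : UpdateFn => g a b c) = localLaw p a c) :
    maxNoiseDist ν ≤ 2 * (1 - p) := by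
  obtain ⟨u, u', h⟩ := exists_noiseDist_eq_max ν
  rw [← h, two_mul]
  nth_rw 1 [← measureReal_updateNoise ν hν u]
  rw [← measureReal_updateNoise ν hν u']
  refine (measureReal_mono ?_).trans (measureReal_union_le _ _)
  intro g hg
  simp only [Set.mem_ofPred_eq, Set.mem_union, ne_eq] at hg ⊢
  cases h1 : updateNoise g u <;> cases h2 : updateNoise g u' <;> simp_all

theorem exists_forall_failBound_le : ∃ n₀ : ℕ, ∀ n : ℕ, n₀ ≤ n →
    10 ^ 10 * ((n : ℝ) ^ 18 * Real.exp (-((1 / 2) ^ 138 * n))) + 10 ^ 6 * (1 / (n : ℝ)) ≤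
      (1 / 256) ^ 24 := by
  have h1 : Tendsto (fun n : ℕ => (1 / 2 : ℝ) ^ 138 * n) atTop atTop :=
    tendsto_natCast_atTop_atTop.const_mul_atTop (by positivity)
  have h2 := ((Real.tendsto_pow_mul_exp_neg_atTop_nhds_zero 18).comp h1).const_mul
    (((1 / 2 : ℝ) ^ 138) ^ 18)⁻¹
  have h3 : Tendsto (fun n : ℕ => (n : ℝ) ^ 18 * Real.exp (-((1 / 2) ^ 138 * n))) atTop (𝓝 0) := by
    rw [mul_zero] at h2
    refine h2.congr fun n => ?_
    simp only [Function.comp_apply]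
    rw [mul_pow]
    field_simp
  have h4 := (h3.const_mul (10 ^ 10)).add
    ((tendsto_one_div_atTop_nhds_zero_nat (𝕜 := ℝ)).const_mul (10 ^ 6))
  rw [mul_zero, mul_zero, add_zero] at h4
  have h5 := h4.eventually (eventually_le_nhds (by positivity : (0 : ℝ) < (1 / 256) ^ 24))
  exact eventually_atTop.1 h5

/-- Take `n = N - 1` for the least `N` with `N^8 * ε > 1`; as `N ≤ 2n`, the lower bound only loses
`2^8 = 256`. -/
theorem exists_nat_pow_mul_le {ε : ℝ} (hε : 0 < ε) {n₀ : ℕ} (hn₀ : 1 ≤ n₀)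
    (h : (n₀ : ℝ) ^ 8 * ε ≤ 1) :
    ∃ n : ℕ, n₀ ≤ n ∧ (n : ℝ) ^ 8 * ε ≤ 1 ∧ 1 ≤ 256 * (n : ℝ) ^ 8 * ε := by
  classical
  have hex : ∃ N : ℕ, 1 < (N : ℝ) ^ 8 * ε := by
    obtain ⟨N, hN⟩ := exists_nat_gt (1 / ε)
    have h1 : 1 < (N : ℝ) * ε := by rwa [div_lt_iff₀ hε] at hN
    have hN1 : (1 : ℝ) ≤ N := by
      have : 0 < (N : ℝ) := by
        by_contra hcon
        nlinarith
      exact_mod_cast (by exact_mod_cast this : 0 < N)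
    refine ⟨N, h1.trans_le ?_⟩
    gcongr
    calc (N : ℝ) = N ^ 1 := (pow_one _).symm
      _ ≤ N ^ 8 := pow_le_pow_right₀ hN1 (by norm_num)
  have h1 := Nat.find_spec hex
  have hmin := fun m (hm : m < Nat.find hex) => not_lt.1 (Nat.find_min hex hm)
  set N := Nat.find hex
  have hlt : n₀ < N := by
    by_contra hcon
    have : (N : ℝ) ^ 8 * ε ≤ (n₀ : ℝ) ^ 8 * ε := by
      have : (N : ℝ) ≤ n₀ := by exact_mod_cast not_lt.1 hcon
      gcongr
    linarith
  obtain ⟨n, hn⟩ : ∃ n, N = n + 1 := ⟨N - 1, by omega⟩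
  refine ⟨n, by omega, hmin n (by omega), ?_⟩
  have hle : (N : ℝ) ≤ 2 * n := by
    have : N ≤ 2 * n := by omega
    exact_mod_cast this
  calc (1 : ℝ) ≤ (N : ℝ) ^ 8 * ε := h1.le
    _ ≤ (2 * (n : ℝ)) ^ 8 * ε := by gcongr
    _ = 256 * (n : ℝ) ^ 8 * ε := by ring

/-- Almost surely the difference is exactly linear. The leftmost one, placed at `t`, moves left by
one site per step and reaches the origin at time `t`. -/
theorem measureReal_separated_of_maxNoiseDist_eq_zero (h : maxNoiseDist ν = 0) (t : ℕ) :
    (envLaw ν).real (separated canonicalUpdate 0 t) = 1 := by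
  let δ : Config := fun x => decide (x = t)
  let Z : ℕ → Env → Config × Config := fun s ω =>
    (forwardState canonicalUpdate ω (fun _ => false) s, forwardState canonicalUpdate ω δ s)
  have hfm : ∀ ξ s, Measurable fun ω => forwardState canonicalUpdate ω ξ s := by
    intro ξ s
    induction s with
    | zero => exact measurable_const
    | succ s ih => exact measurable_globalUpdate ih
  have hfa : ∀ ξ s, IsAdapted (fun ω => forwardState canonicalUpdate ω ξ s) s := by
    intro ξ s
    induction s with
    | zero => intro ω ω' _; rfl
    | succ s ih =>
      intro ω ω' hω
      have h1 := ih ω ω' fun i hi => hω i (lt_trans hi (Nat.lt_succ_self s))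
      have h2 : ∀ x : ℤ, ω (x, s) = ω' (x, s) := fun x => hω (x, s) (Nat.lt_succ_self s)
      simp only at h1
      simp only [forwardState, canonicalUpdate, h1, h2]
  have hZ : IsPairProcess Z 0 0 :=
    ⟨fun s => (hfm _ s).prodMk (hfm _ s), fun s ω ω' hω => Prod.ext (hfa _ s ω ω' hω) (hfa _ s ω ω' hω),
      fun s _ ω => rfl, fun s _ ω => rfl⟩
  have hnull : ∀ᵐ ω ∂(envLaw ν), ∀ (s : ℕ) (x : ℤ), noiseDiff (ω (x, s)) (Z s ω) x = false := by
    rw [ae_all_iff]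
    intro s
    rw [ae_all_iff]
    intro x
    have h1 := envLaw_noiseDiff_adapted_le ν (hZ.measurable s) (hZ.adapted s)
      (measurable_const (a := x)) (fun _ _ _ => rfl)
    rw [h] at h1
    have h2 := (measureReal_eq_zero_iff).1 (le_antisymm h1 measureReal_nonneg)
    rw [ae_iff]
    convert h2 using 2
    ext ω; simp
  have hsep : ∀ᵐ ω ∂(envLaw ν), ω ∈ separated canonicalUpdate 0 t := by
    filter_upwards [hnull] with ω hω
    have key : ∀ s : ℕ, (∀ x : ℤ, x < t - s → diff (Z s ω) x = false) ∧
        diff (Z s ω) (t - s) = true := by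
      intro s
      induction s with
      | zero =>
        constructor
        · intro x hx
          have : x ≠ t := by push_cast at hx; omega
          simp [diff, Z, δ, forwardState, this]
        · simp [diff, Z, δ, forwardState]
      | succ s ih =>
        obtain ⟨h1, h2⟩ := ih
        have hst := fun x => (hZ.isNoisyRule ω).step s (Nat.zero_le s) x
        push_cast
        constructor
        · intro x hx
          refine (hst x).trans ?_
          rw [h1 (x - 1) (by omega), h1 (x + 1) (by omega), hω s x]; rfl
        · refine (hst _).trans ?_
          rw [h1 _ (by omega), hω s, show (t : ℤ) - (s + 1) + 1 = t - s by ring, h2]; rfl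
    refine ⟨fun _ => false, δ, ?_⟩
    have := (key t).2
    rw [sub_self] at this
    simpa [diff, Z] using this
  have := (mem_ae_iff_prob_eq_one (measurableSet_separated 0 t)).1 hsep
  simp [Measure.real, this]

/-- For small noise, uniformly in the coupling, two configurations are frequently separated. -/
theorem exists_frequently_le_measureReal_separated : ∃ p₀ : ℝ, p₀ < 1 ∧ ∀ p : unitInterval, p₀ < p →
    ∀ (ν : Measure UpdateFn) [IsProbabilityMeasure ν],
      (∀ a b c, ν.map (fun g : UpdateFn => g a b c) = localLaw p a c) →
      ∃ c : ℝ, 0 < c ∧ ∃ᶠ t in atTop, c ≤ (envLaw ν).real (separated canonicalUpdate 0 t) := by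
  obtain ⟨n₁, hn₁⟩ := exists_forall_failBound_le
  set n₀ := max n₁ 2 with hn₀
  have hn₀2 : (2 : ℝ) ≤ n₀ := by exact_mod_cast le_max_right n₁ 2
  have hpow : (256 : ℝ) ≤ (n₀ : ℝ) ^ 8 := by
    calc (256 : ℝ) = 2 ^ 8 := by norm_num
      _ ≤ _ := by gcongr
  -- This makes `2(1-p) ≤ n₀^(-8)`, hence `n₀^8 ε ≤ 1` for every coupling: the scale `n` varies with
  -- the coupling, but the threshold does not.
  refine ⟨1 - 1 / (2 * (n₀ : ℝ) ^ 8), by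
    have : 0 < 1 / (2 * (n₀ : ℝ) ^ 8) := by positivity
    linarith, fun p hp ν _ hν => ?_⟩
  have hεp := maxNoiseDist_le ν hν
  have hsmall : 2 * (1 - (p : ℝ)) ≤ 1 / (n₀ : ℝ) ^ 8 := by
    have h1 : 1 / (2 * (n₀ : ℝ) ^ 8) = 1 / (n₀ : ℝ) ^ 8 / 2 := by field_simp
    linarith
  have hsmall' : 1 / (n₀ : ℝ) ^ 8 ≤ 1 / 256 := one_div_le_one_div_of_le (by norm_num) hpow
  rcases (maxNoiseDist_nonneg ν).eq_or_lt with h0 | hpos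
  · refine ⟨1, one_pos, Frequently.of_forall fun t => ?_⟩
    rw [measureReal_separated_of_maxNoiseDist_eq_zero ν h0.symm]
  · have h1 : (n₀ : ℝ) ^ 8 * maxNoiseDist ν ≤ 1 := by
      rw [mul_comm, ← le_div_iff₀ (by positivity)]
      linarith
    obtain ⟨n, hn, hup, hlow⟩ := exists_nat_pow_mul_le hpos (by omega : 1 ≤ n₀) h1
    have hn1 : 1 ≤ n := by omega
    have hfail := (failBound_le ν hn1 hεp (by linarith) hlow hup).trans (hn₁ n (by omega))
    have hJ : 1 ≤ n ^ 4 := Nat.one_le_pow _ _ hn1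
    have hK : 1 ≤ 128 * n ^ 5 := by have := Nat.one_le_pow 5 n hn1; omega
    have hm : n ^ 4 * (128 * n ^ 5) = 128 * n ^ 9 := by ring
    have hmain := half_le_mul_measureReal_separated ν hν (by linarith) hJ hK hm hfail
    have hℓ : (0 : ℝ) < (16 * (n ^ 4 * (128 * n ^ 5)) : ℕ) := by
      exact_mod_cast by positivity
    refine ⟨1 / 2 / (16 * (n ^ 4 * (128 * n ^ 5)) : ℕ), by positivity, ?_⟩
    refine frequently_atTop.2 fun a => ⟨a * (n ^ 4 * (32 * (128 * n ^ 5))), ?_, ?_⟩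
    · exact Nat.le_mul_of_pos_right a (by positivity)
    · rw [div_le_iff₀ hℓ, mul_comm]
      exact hmain a

end Parameters

/-! ### Coupling from the past as time-reversed forward evolution. -/

section TimeReversal

variable {Ω : Type*} {F : ℤ → ℕ → Ω → UpdateFn}

theorem separated_eq_preimage (x : ℤ) (t : ℕ) :
    separated F x t = (fun ω (i : ℤ × ℕ) => F i.1 i.2 ω) ⁻¹' separated canonicalUpdate x t := by
  ext ω
  have := mem_separated_congr (F := F) (F' := canonicalUpdate) (ω := ω)
    (ω' := fun i : ℤ × ℕ => F i.1 i.2 ω) (x := x) (y := 0) (t := t) fun z s _ _ => by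
      rw [add_zero]; rfl
  rwa [add_zero] at this

theorem forwardState_succ_left (F : ℤ → ℕ → Ω → UpdateFn) (ω : Ω) (ξ : Config) (t : ℕ) :
    forwardState F ω ξ (t + 1) =
      forwardState (fun x s => F x (s + 1)) ω (globalUpdate (fun x => F x 0 ω) ξ) t := by
  induction t with
  | zero => rfl
  | succ t ih =>
    rw [forwardState, ih]
    rfl

theorem pastState_eq_forwardState (ω : Ω) (T : ℕ) : ∀ (G : ℤ → ℕ → Ω → UpdateFn) (ξ : Config),
    (∀ x s, s < T → G x s ω = F x (T - 1 - s) ω) → pastState F ω T ξ = forwardState G ω ξ T := by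
  induction T with
  | zero => intro G ξ _; rfl
  | succ T ih =>
    intro G ξ hG
    rw [forwardState_succ_left, pastState]
    have h0 : (fun x => G x 0 ω) = fun x => F x T ω := by
      funext x
      exact hG x 0 (Nat.succ_pos T)
    rw [h0]
    refine ih _ _ fun x s hs => ?_
    rw [hG x (s + 1) (by omega)]
    congr 1
    omega

/-- The states of `x` reached by coupling from the past from time `-T` do not all agree. -/
def pastSeparated (F : ℤ → ℕ → Ω → UpdateFn) (x : ℤ) (T : ℕ) : Set Ω :=
  {ω | ∃ ξ₁ ξ₂ : Config, pastState F ω T ξ₁ x ≠ pastState F ω T ξ₂ x}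

/-- Translation of space by `x` and reversal of the times `< T`. -/
def reverseTime (x : ℤ) (T : ℕ) (i : ℤ × ℕ) : ℤ × ℕ :=
  (i.1 + x, if i.2 < T then T - 1 - i.2 else i.2)

theorem reverseTime_injective (x : ℤ) (T : ℕ) : Function.Injective (reverseTime x T) := by
  rintro ⟨y, s⟩ ⟨y', s'⟩ h
  simp only [reverseTime, Prod.mk.injEq] at h
  obtain ⟨h1, h2⟩ := h
  refine Prod.ext (by simp only; omega) ?_
  simp only
  split_ifs at h2 <;> omega

/-- Reading the times below `T` backwards turns the past evolution into a forward one. Later times,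
which play no role, stay fixed so that `reverseTime` is injective on all of space-time. -/
theorem pastSeparated_eq (x : ℤ) (T : ℕ) : pastSeparated F x T =
    separated (fun y s ω => F (reverseTime x T (y, s)).1 (reverseTime x T (y, s)).2 ω) 0 T := by
  ext ω
  have h1 : ω ∈ pastSeparated F x T ↔
      ω ∈ separated (fun y s ω => F y (if s < T then T - 1 - s else s) ω) x T := by
    have h2 := fun ξ => pastState_eq_forwardState (F := F) ω T
      (fun y s ω => F y (if s < T then T - 1 - s else s) ω) ξ
      fun y s hs => by simp only [hs, if_true]
    simp only [pastSeparated, separated, Set.mem_ofPred_eq, h2]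
  have h3 := mem_separated_congr (F := fun y s ω => F y (if s < T then T - 1 - s else s) ω)
    (F' := fun y s ω => F (reverseTime x T (y, s)).1 (reverseTime x T (y, s)).2 ω)
    (ω := ω) (ω' := ω) (x := 0) (y := x) (t := T) fun z s _ _ => rfl
  rw [zero_add] at h3
  exact h1.trans h3

theorem pastSeparated_antitone (x : ℤ) : Antitone (pastSeparated F x) := by
  refine antitone_nat_of_succ_le fun T ω => ?_
  rintro ⟨ξ₁, ξ₂, h⟩
  exact ⟨_, _, h⟩

end TimeReversal

/-! ### From the canonical environment to an arbitrary coupling. -/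

section Transfer

variable {Ω : Type*} [MeasurableSpace Ω] {μ : Measure Ω} {F : ℤ → ℕ → Ω → UpdateFn}
  {p : unitInterval}

theorem IsBasicIIDCoupling.measurable_env (h : IsBasicIIDCoupling p μ F) :
    Measurable fun (ω : Ω) (i : ℤ × ℕ) => F i.1 i.2 ω :=
  measurable_pi_lambda _ fun i => h.measurable i.1 i.2

theorem IsBasicIIDCoupling.map_eval (h : IsBasicIIDCoupling p μ F) (a b c : Bool) :
    (μ.map (F 0 0)).map (fun g : UpdateFn => g a b c) = localLaw p a c := by
  rw [Measure.map_map (measurable_of_finite _) (h.measurable 0 0)]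
  exact h.law 0 0 a b c

theorem IsBasicIIDCoupling.measurableSet_pastSeparated (h : IsBasicIIDCoupling p μ F) (x : ℤ)
    (T : ℕ) : MeasurableSet (pastSeparated F x T) := by
  rw [pastSeparated_eq, separated_eq_preimage]
  have hm : Measurable fun (ω : Ω) (i : ℤ × ℕ) =>
      F (reverseTime x T i).1 (reverseTime x T i).2 ω :=
    measurable_pi_lambda _ fun i => h.measurable _ _
  exact hm (measurableSet_separated 0 T)

variable [IsProbabilityMeasure μ]

theorem IsBasicIIDCoupling.map_env (h : IsBasicIIDCoupling p μ F)
    [IsProbabilityMeasure (μ.map (F 0 0))] :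
    μ.map (fun ω (i : ℤ × ℕ) => F i.1 i.2 ω) = envLaw (μ.map (F 0 0)) := by
  have h1 := (iIndepFun_iff_map_fun_eq_infinitePi_map
    (fun i : ℤ × ℕ => h.measurable i.1 i.2)).1 h.iIndepFun
  rw [h1, envLaw]
  congr 1
  funext i
  exact (h.identDistrib i.1 i.2).map_eq

theorem IsBasicIIDCoupling.isProbabilityMeasure_map (h : IsBasicIIDCoupling p μ F) :
    IsProbabilityMeasure (μ.map (F 0 0)) :=
  Measure.isProbabilityMeasure_map (h.measurable 0 0).aemeasurable

theorem IsBasicIIDCoupling.measure_separated_reindex (h : IsBasicIIDCoupling p μ F)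
    [IsProbabilityMeasure (μ.map (F 0 0))] {σ : ℤ × ℕ → ℤ × ℕ} (hσ : Function.Injective σ)
    (t : ℕ) :
    μ (separated (fun x s ω => F (σ (x, s)).1 (σ (x, s)).2 ω) 0 t) =
      envLaw (μ.map (F 0 0)) (separated canonicalUpdate 0 t) := by
  have h1 := measurePreserving_reindex (μ.map (F 0 0)) hσ
  have h2 := h1.measure_preimage (measurableSet_separated 0 t).nullMeasurableSet
  change envLaw (μ.map (F 0 0)) _ = envLaw (μ.map (F 0 0)) _ at h2
  rw [← h2, ← h.map_env, separated_eq_preimage,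
    Measure.map_apply h.measurable_env (h1.measurable (measurableSet_separated 0 t))]
  rfl

/-- The events `pastSeparated F x T` decrease in `T`, so a lower bound for infinitely many `T`
passes to their intersection, on which no starting time works. -/
theorem IsBasicIIDCoupling.not_cftpSucceedsAt (h : IsBasicIIDCoupling p μ F) {c : ENNReal}
    (hc : 0 < c) (hfreq : ∃ᶠ T in atTop, ∀ x, c ≤ μ (pastSeparated F x T)) (x : ℤ) :
    ¬ CFTPSucceedsAt μ F x := by
  intro hs
  have h1 : μ (⋂ T, pastSeparated F x T) = 0 := by
    refine measure_mono_null ?_ hs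
    intro ω hω
    simp only [Set.mem_iInter] at hω
    rintro ⟨T, hT⟩
    obtain ⟨ξ₁, ξ₂, hne⟩ := hω T
    exact hne (hT ξ₁ ξ₂)
  have h2 := tendsto_measure_iInter_atTop (μ := μ)
    (fun T => (h.measurableSet_pastSeparated x T).nullMeasurableSet)
    (pastSeparated_antitone (F := F) x) ⟨0, measure_ne_top _ _⟩
  rw [h1] at h2
  obtain ⟨T, hT1, hT2⟩ := (hfreq.and_eventually (h2.eventually_lt_const hc)).exists
  exact absurd (hT1 x) (not_le.2 hT2)

end Transfer

theorem theorem1 :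
    (∃ p₀ : ℝ, p₀ < 1 ∧ ∀ p : unitInterval, p₀ < (p : ℝ) →
      ∀ (Ω : Type*) [MeasurableSpace Ω] (μ : Measure Ω) [IsProbabilityMeasure μ]
        (F : ℤ → ℕ → Ω → UpdateFn), IsBasicIIDCoupling p μ F →
          0 < limsup (fun t : ℕ => μ {ω | ∃ ξ₁ ξ₂ : Config,
            forwardState F ω ξ₁ t 0 ≠ forwardState F ω ξ₂ t 0}) atTop ∧
          ∀ x : ℤ, ¬ CFTPSucceedsAt μ F x) ∧
    ∀ p : unitInterval, 0 < (p : ℝ) → (p : ℝ) < 1 → IsErgodicPCA (pcaKernel p) := by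
  refine ⟨?_, fun p h0 h1 => isErgodicPCA_pcaKernel h0 h1⟩
  obtain ⟨p₀, hp₀, hmain⟩ := exists_frequently_le_measureReal_separated
  refine ⟨p₀, hp₀, fun p hp Ω _ μ _ F hF => ?_⟩
  have := hF.isProbabilityMeasure_map
  obtain ⟨c, hc, hfreq⟩ := hmain p hp (μ.map (F 0 0)) hF.map_eval
  have hc' : 0 < ENNReal.ofReal c := ENNReal.ofReal_pos.2 hc
  have hfreq' : ∃ᶠ t in atTop, ENNReal.ofReal c ≤
      envLaw (μ.map (F 0 0)) (separated canonicalUpdate 0 t) :=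
    hfreq.mono fun t ht => (ENNReal.ofReal_le_iff_le_toReal (measure_ne_top _ _)).2 ht
  constructor
  · refine hc'.trans_le (le_limsup_of_frequently_le (hfreq'.mono fun t ht => ?_))
    refine ht.trans (le_of_eq ?_)
    exact (hF.measure_separated_reindex (σ := id) Function.injective_id t).symm
  · refine hF.not_cftpSucceedsAt hc' (hfreq'.mono fun T hT x => ?_)
    rw [pastSeparated_eq, hF.measure_separated_reindex (reverseTime_injective x T)]
    exact hT
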